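/- **Theorem (Extreme points characterization).** *Notation.* Let $K\in\mathbb R$, $N\in(-\infty,0]\cup(1,\infty]$, $D\in(0,\infty]$. Put $\delta=\frac{K}{N-1}$ ($\delta=0$ if $N=\infty$), and $l_\delta=\pi/\sqrt\delta$ if $\delta>0$, $l_\delta=\infty$ otherwise. For $t\in[0,1]$, $d\ge 0$ and a real number $n$ with $\frac Kn d^2<\pi^2$ let $\sigma^{(t)}_{K,n}(d)$ be $\frac{\sin(td\sqrt{K/n})}{\sin(d\sqrt{K/n})}$ if $\frac Knd^2>0$, $t$ if $\frac Knd^2=0$, and $\frac{\sinh(td\sqrt{-K/n})}{\sinh(d\sqrt{-K/n})}$ if $\frac Knd^2<0$; and, for finite $N\neq0$, let $\tau^{(t)}_{K,N}(d)=t^{1/N}\sigma^{(t)}_{K,N-1}(d)^{1-1/N}$. For $a,b>0$ define the distorted means $$M^{(t)}_{K,N-1}[d](a,b)=\begin{cases}\bigl(\sigma^{(1-t)}_{K,N-1}(d)a^{\frac1{N-1}}+\sigma^{(t)}_{K,N-1}(d)b^{\frac1{N-1}}\bigr)^{N-1}&N\ne\infty\\ a^{1-t}b^te^{Kt(1-t)d^2/2}&N=\infty,\end{cases}$$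 $$\tilde M^{(t)}_{K,N}[d](a,b)=\begin{cases}\bigl(\tau^{(1-t)}_{K,N}(d)a^{\frac1N}+\tau^{(t)}_{K,N}(d)b^{\frac1N}\bigr)^{N}&N\ne0,\infty\\ \min\bigl(\tfrac{1-t}{\sigma^{(1-t)}_{K,-1}(d)}a,\tfrac{t}{\sigma^{(t)}_{K,-1}(d)}b\bigr)&N=0\\ a^{1-t}b^te^{Kt(1-t)d^2/2}&N=\infty,\end{cases}$$ when $\delta d^2<\pi^2$; when $\delta d^2\ge\pi^2$ both means are $+\infty$ if $K>0$ and $0$ if $K<0$. Both means are $0$ when $ab=0$. For a closed interval $I\subset\mathbb R$, a finite Borel measure $\xi$ on $\mathbb R$ satisfies the *synthetic $CDD_b(K,N,D)$ condition on $I$* if $\mathrm{supp}(\xi)\subset I$, $\mathrm{diam}(\mathrm{supp}(\xi))\le D$ and $$\xi\bigl((1-t)A_0+tA_1\bigr)\ \ge\ \tilde M^{(t)}_{K,N}[\theta_K(A_0,A_1)]\bigl(\xi(A_0),\xi(A_1)\bigr)$$ for all compact $A_0,A_1\subset\mathbb R$ and all $t\in[0,1]$, where $\theta_K(A_0,A_1)$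 is the infimum (if $K\ge0$), respectively the supremum (if $K<0$), of $|x-y|$ over $x\in A_0$, $y\in A_1$. A nonzero finite measure $\xi=J\,dx$ is a *model measure on $I$* if its support is an interval contained in $I$ of length at most $D$, and (for some version of $J\ge0$) $J((1-t)x_0+tx_1)=M^{(t)}_{K,N-1}[|x_1-x_0|](J(x_0),J(x_1))$ for all $x_0,x_1$ in the interior of $\mathrm{supp}(\xi)$ and all $t\in[0,1]$. A point $\nu$ of a (not necessarily convex) set $A$ is an *extreme point* of $A$, $\nu\in\mathrm{Ext}(A)$, if $\nu=(1-s)\xi_0+s\xi_1$ with $\xi_0,\xi_1\in A$ and $0<s<1$ implies $\xi_0=\xi_1=\nu$. *Statement.* Let $h:\mathbb R\to\mathbb R$ have compact support and be continuous on the interval $I_h:=\mathrm{conv}(\mathrm{supp}(h))$ (for instance $h\in C_c(\mathbb R)$). If $\delta>0$ and $K<0$, assume in addition $D<l_\delta$. Let - $A$ be the set of probability measures $\xi$ satisfying the synthetic $CDD_b(K,N,D)$ condition on $I_h$ with $\int h\,d\xi=0$; - $B$ be the union of the set of model probability measures $\xi$ on $I_h$ with $\int h\,d\xi=0$ and $\int_{-\infty}^xh\,d\xi\ne0$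 for every $x$ in the interior of $\mathrm{supp}(\xi)$, and of the set of Dirac masses $\delta_{x_0}$, $x_0\in I_h$, that belong to $A$. Then: 1. if $N\in(-\infty,0]\cup[2,\infty]$, then $\mathrm{Ext}(A)\subset B$; 2. if $N\in(-\infty,0]\cup(1,\infty]$, then $B\subset\mathrm{Ext}(A)$. -/

import Mathlib

open MeasureTheory Set
open scoped ENNReal NNReal

noncomputable section

namespace SyntheticCDD

/-- `δ(K,N) = K / (N - 1)`, equal to `0` for `N = ∞` and for `N = 1`. -/
def delta (K : ℝ) : WithTop ℝ → ℝ
  | ⊤ => 0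
  | (n : ℝ) => K / (n - 1)

/-- `l_δ = π / √δ` if `δ > 0`, and `l_δ = ∞` otherwise. -/
def ell (K : ℝ) (N : WithTop ℝ) : ℝ≥0∞ :=
  if 0 < delta K N then ENNReal.ofReal (Real.pi / √(delta K N)) else ⊤

/-- The distortion coefficient `σ_{K,n}^{(t)}(θ)` for a finite parameter `n`, in the range
`(K / n) θ² < π²`. (Outside this range its value is `∞`; the distorted means below treat that range
as a separate case and do not call this function there.) -/
def sigma (K n t θ : ℝ) : ℝ :=
  if 0 < K / n * θ ^ 2 then Real.sin (t * θ * √(K / n)) / Real.sin (θ * √(K / n))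
  else if K / n * θ ^ 2 < 0 then Real.sinh (t * θ * √(-(K / n))) / Real.sinh (θ * √(-(K / n)))
  else t

/-- The distortion coefficient `τ_{K,n}^{(t)}(θ) = t^{1/n} σ_{K,n-1}^{(t)}(θ)^{1-1/n}`, for `n ≠ 0`. -/
def tau (K n t θ : ℝ) : ℝ :=
  t ^ (1 / n) * sigma K (n - 1) t θ ^ (1 - 1 / n)

/-- The distorted mean `M_{K,N-1}^{(t)}[d](a,b)`, for `N ∈ (-∞,0] ∪ (1,∞]` and `a, b ≥ 0`. -/
def distMean (K : ℝ) (N : WithTop ℝ) (t d a b : ℝ) : ℝ≥0∞ :=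
  if a * b = 0 then 0 else
  match N with
  | ⊤ => ENNReal.ofReal (a ^ (1 - t) * b ^ t * Real.exp (K * t * (1 - t) * d ^ 2 / 2))
  | (n : ℝ) =>
    if Real.pi ^ 2 ≤ K / (n - 1) * d ^ 2 then (if 0 < K then ⊤ else 0)
    else ENNReal.ofReal
      ((sigma K (n - 1) (1 - t) d * a ^ (1 / (n - 1)) + sigma K (n - 1) t d * b ^ (1 / (n - 1)))
        ^ (n - 1))

/-- The distorted mean `M̃_{K,N}^{(t)}[d](a,b)`, for `N ∈ (-∞,0] ∪ (1,∞]` and `a, b ≥ 0`.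
For `N = 0` it is `min ((1-t) σ_{K,-1}^{(1-t)}(d)⁻¹ a) (t σ_{K,-1}^{(t)}(d)⁻¹ b)`, which is `0` in the
range where `σ = ∞`. -/
def distMeanTilde (K : ℝ) (N : WithTop ℝ) (t d a b : ℝ) : ℝ≥0∞ :=
  if a * b = 0 then 0 else
  match N with
  | ⊤ => ENNReal.ofReal (a ^ (1 - t) * b ^ t * Real.exp (K * t * (1 - t) * d ^ 2 / 2))
  | (n : ℝ) =>
    if Real.pi ^ 2 ≤ K / (n - 1) * d ^ 2 then (if 0 < K then ⊤ else 0)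
    else if n = 0 then ENNReal.ofReal
      (min ((1 - t) * (sigma K (-1) (1 - t) d)⁻¹ * a) (t * (sigma K (-1) t d)⁻¹ * b))
    else ENNReal.ofReal
      ((tau K n (1 - t) d * a ^ (1 / n) + tau K n t d * b ^ (1 / n)) ^ n)

/-- `θ_K(A₀,A₁)`: the infimum (`K ≥ 0`) or the supremum (`K < 0`) of the distances `|x - y|`,
`x ∈ A₀`, `y ∈ A₁`. -/
def theta (K : ℝ) (A₀ A₁ : Set ℝ) : ℝ :=
  if 0 ≤ K then sInf (image2 (fun x y => |x - y|) A₀ A₁)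
  else sSup (image2 (fun x y => |x - y|) A₀ A₁)

/-- `A_t = (1 - t) A₀ + t A₁`. -/
def interp (t : ℝ) (A₀ A₁ : Set ℝ) : Set ℝ :=
  image2 (fun x y => (1 - t) * x + t * y) A₀ A₁

/-- The class of finite measures on `ℝ`, supported in `I`, that satisfy the synthetic
`CDD_b(K,N,D)` condition. -/
structure IsSynthetic (K : ℝ) (N : WithTop ℝ) (D : ℝ≥0∞) (I : Set ℝ) (ξ : Measure ℝ) : Prop where
  finite : IsFiniteMeasure ξ
  support_subset : ξ.support ⊆ I
  distorted : ∀ A₀ A₁ : Set ℝ, IsCompact A₀ → IsCompact A₁ → ∀ t ∈ Icc (0 : ℝ) 1,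
    distMeanTilde K N t (theta K A₀ A₁) (ξ.real A₀) (ξ.real A₁) ≤ ξ (interp t A₀ A₁)
  diam_le : Metric.ediam ξ.support ≤ D

/-- The class of model measures supported in `I`: nonzero finite absolutely continuous measures
`J dm` whose support is an interval of diameter at most `D`, and whose density satisfies the
distorted-mean relation with equality in the interior of the support. -/
structure IsModel (K : ℝ) (N : WithTop ℝ) (D : ℝ≥0∞) (I : Set ℝ) (ξ : Measure ℝ) : Prop where
  finite : IsFiniteMeasure ξ
  ne_zero : ξ ≠ 0
  support_subset : ξ.support ⊆ I
  support_interval : ξ.support.OrdConnected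
  density : ∃ J : ℝ → ℝ, Measurable J ∧ (∀ x, 0 ≤ J x) ∧
    ξ = volume.withDensity (fun x => ENNReal.ofReal (J x)) ∧
    ∀ x₀ ∈ interior ξ.support, ∀ x₁ ∈ interior ξ.support, ∀ t ∈ Icc (0 : ℝ) 1,
      ENNReal.ofReal (J ((1 - t) * x₀ + t * x₁)) = distMean K N t |x₁ - x₀| (J x₀) (J x₁)
  diam_le : Metric.ediam ξ.support ≤ D

/-- `I_h`, the convex hull of the support of `h`. -/
def hullSupport (h : ℝ → ℝ) : Set ℝ := convexHull ℝ (tsupport h)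

/-- `P_{[K,N,D],h}(I_h)`: probability measures on `I_h` of the synthetic class with `∫ h dξ = 0`. -/
def synthProb (K : ℝ) (N : WithTop ℝ) (D : ℝ≥0∞) (h : ℝ → ℝ) : Set (Measure ℝ) :=
  {ξ | IsProbabilityMeasure ξ ∧ IsSynthetic K N D (hullSupport h) ξ ∧ ∫ x, h x ∂ξ = 0}

/-- `P^s_{[K,N,D],h}(I_h)`: the Dirac masses of the previous class. -/
def diracProb (K : ℝ) (N : WithTop ℝ) (D : ℝ≥0∞) (h : ℝ → ℝ) : Set (Measure ℝ) :=
  {ξ | ξ ∈ synthProb K N D h ∧ ∃ x₀ ∈ hullSupport h, ξ = Measure.dirac x₀}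

/-- `P̂^M_{[K,N,D],h}(I_h)`: model probability measures on `I_h` with `∫ h dξ = 0` and
`∫_{-∞}^x h dξ ≠ 0` for every `x` in the interior of the support. -/
def modelProb (K : ℝ) (N : WithTop ℝ) (D : ℝ≥0∞) (h : ℝ → ℝ) : Set (Measure ℝ) :=
  {ξ | IsProbabilityMeasure ξ ∧ IsModel K N D (hullSupport h) ξ ∧ ∫ x, h x ∂ξ = 0 ∧
    ∀ x ∈ interior ξ.support, ∫ y in Iic x, h y ∂ξ ≠ 0}

end SyntheticCDD

end

/-!
Write `δ = K / (N - 1)`. In the potential coordinate `u` of a density (`u = log J`, `J ^ (1/(N-1))`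
or `-J ^ (1/(N-1))`, see `toDens`) the distorted mean `M` is an interpolation that is linear up to
a constant, increasing in both arguments, and exact along the solutions of `u'' + δ u = 0` (of
`u'' = -K` if `N = ∞`), the potentials of model densities.

**Synthetic measures.** A synthetic probability measure is a Dirac mass or has a density `J`
satisfying `M (J x) (J y) ≤ J ((1 - t) x + t y)` on an open interval, and conversely such a density
(`IsConcaveDensity`) defines a synthetic measure. For the converse the quantile functions of the
two parts of the measure turn the inequality for sets into the pointwise one
(`IsConcaveDensity.isSynthetic`). For the direct statement, balls whose radii are in the optimal
ratio give the pointwise inequality for the lower density, which is defined at every point; if the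
lower density is infinite at `x` and positive at another point, then it dominates a multiple of
`1 / |z - x|` near `x` on one side, which is not integrable
(`IsSynthetic.eq_dirac_or_eq_densMeasure`).

**Extreme measures are models.** Let `f` be the concave density of an extreme measure. If the
primitive of `f h` vanished at an interior point, the measure could be cut there into two pieces
that satisfy the constraint. Otherwise cut `f` off by a model density with potential `ℓ` (that is,
replace the potential `u` of `f` by `min u ℓ`) which at a fixed point `x₀` has half the height of
`f`. As the slope of `ℓ` at `x₀` runs from `-∞` to `∞`, the cut-off runs from `f` restricted to the
left of `x₀` to `f` restricted to the right of it, so by the intermediate value theorem it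
satisfies the constraint for some slope (`IsConcaveDensity.exists_slope`). Both the cut-off and the
rest of `f` are concave densities: the former because the interpolation is increasing, the latter
because on densities the mean lies below its tangent hyperplanes, which is where `N ≤ 0` or `2 ≤ N`
enters (`exists_tangent`). Extremality makes the cut-off proportional to `f`, hence `f`
proportional to the model density.

**Models are extreme.** Suppose a model density `f` is a convex combination of concave densities
`f₀` and `f₁`. Since `M` is exact on `f`, both ratios `f₀ / f` and `f₁ / f` are quasi-concave; as a
weighted sum of them is constant, they are monotone, and after exchanging the two the first one is
increasing. The integral of `h f` against an increasing function is an average of the integrals of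
`h f` over half-lines, which all have the same sign and vanish at no interior point. So the
constraint on `f₀` forces the ratio to be constant (`ae_eq_of_monotoneOn_ratio`).
-/

open Filter Topology

namespace SyntheticCDD

/-! ### Generalized sine and cosine, and the coefficients `σ` -/

/-- The generalized sine: the solution of `y'' + δ y = 0` with `y 0 = 0` and `y' 0 = 1`. -/
noncomputable def sn (δ x : ℝ) : ℝ :=
  if 0 < δ then Real.sin (√δ * x) / √δ else if δ < 0 then Real.sinh (√(-δ) * x) / √(-δ) else x

/-- The generalized cosine: the solution of `y'' + δ y = 0` with `y 0 = 1` and `y' 0 = 0`. -/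
noncomputable def cs (δ x : ℝ) : ℝ :=
  if 0 < δ then Real.cos (√δ * x) else if δ < 0 then Real.cosh (√(-δ) * x) else 1

@[simp] lemma sn_zero (δ : ℝ) : sn δ 0 = 0 := by simp [sn]

@[simp] lemma cs_zero (δ : ℝ) : cs δ 0 = 1 := by simp [cs]

@[simp] lemma sn_neg (δ x : ℝ) : sn δ (-x) = -sn δ x := by
  unfold sn; split_ifs <;> simp [neg_div]

@[simp] lemma cs_neg (δ x : ℝ) : cs δ (-x) = cs δ x := by
  unfold cs; split_ifs <;> simp

lemma sn_add (δ x y : ℝ) : sn δ (x + y) = sn δ x * cs δ y + cs δ x * sn δ y := by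
  unfold sn cs
  split_ifs with h1 h2
  · rw [mul_add, Real.sin_add]; ring
  · rw [mul_add, Real.sinh_add]; ring
  · ring

lemma cs_add (δ x y : ℝ) : cs δ (x + y) = cs δ x * cs δ y - δ * sn δ x * sn δ y := by
  unfold sn cs
  split_ifs with h1 h2
  · have h : √δ ≠ 0 := (Real.sqrt_pos.2 h1).ne'
    rw [mul_add, Real.cos_add]
    field_simp
    rw [Real.sq_sqrt h1.le]; ring
  · have h : √(-δ) ≠ 0 := (Real.sqrt_pos.2 (neg_pos.2 h2)).ne'
    rw [mul_add, Real.cosh_add]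
    field_simp
    rw [Real.sq_sqrt (by linarith)]; ring
  · have : δ = 0 := by linarith
    simp [this]

lemma hasDerivAt_sn (δ x : ℝ) : HasDerivAt (sn δ) (cs δ x) x := by
  unfold sn cs
  split_ifs with h1 h2
  · have h : √δ ≠ 0 := (Real.sqrt_pos.2 h1).ne'
    have := (((hasDerivAt_id' x).const_mul (√δ)).sin).div_const (√δ)
    refine this.congr_deriv ?_
    field_simp
  · have h : √(-δ) ≠ 0 := (Real.sqrt_pos.2 (neg_pos.2 h2)).ne'
    have := (((hasDerivAt_id' x).const_mul (√(-δ))).sinh).div_const (√(-δ))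
    refine this.congr_deriv ?_
    field_simp
  · exact hasDerivAt_id x

lemma hasDerivAt_cs (δ x : ℝ) : HasDerivAt (cs δ) (-δ * sn δ x) x := by
  unfold sn cs
  split_ifs with h1 h2
  · have h : √δ ≠ 0 := (Real.sqrt_pos.2 h1).ne'
    have := (((hasDerivAt_id' x).const_mul (√δ)).cos)
    refine this.congr_deriv ?_
    field_simp
    rw [Real.sq_sqrt h1.le]; ring
  · have h : √(-δ) ≠ 0 := (Real.sqrt_pos.2 (neg_pos.2 h2)).ne'
    have := (((hasDerivAt_id' x).const_mul (√(-δ))).cosh)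
    refine this.congr_deriv ?_
    field_simp
    rw [Real.sq_sqrt (by linarith)]; ring
  · have : δ = 0 := by linarith
    simpa [this] using hasDerivAt_const x (1 : ℝ)

lemma continuous_sn (δ : ℝ) : Continuous (sn δ) :=
  continuous_iff_continuousAt.2 fun x => (hasDerivAt_sn δ x).continuousAt

lemma continuous_cs (δ : ℝ) : Continuous (cs δ) :=
  continuous_iff_continuousAt.2 fun x => (hasDerivAt_cs δ x).continuousAt

lemma sn_pos {δ x : ℝ} (hx : 0 < x) (h : δ * x ^ 2 < Real.pi ^ 2) : 0 < sn δ x := by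
  unfold sn
  split_ifs with h1 h2
  · have hs := Real.sqrt_pos.2 h1
    refine div_pos (Real.sin_pos_of_pos_of_lt_pi (by positivity) ?_) hs
    refine lt_of_pow_lt_pow_left₀ 2 Real.pi_pos.le ?_
    rwa [mul_pow, Real.sq_sqrt h1.le]
  · have hs := Real.sqrt_pos.2 (neg_pos.2 h2)
    exact div_pos (Real.sinh_pos_iff.2 (by positivity)) hs
  · exact hx

lemma range_mono {δ x y : ℝ} (hx : 0 ≤ x) (hxy : x ≤ y) (h : δ * y ^ 2 < Real.pi ^ 2) :
    δ * x ^ 2 < Real.pi ^ 2 := by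
  rcases le_or_gt 0 δ with h0 | h0
  · refine lt_of_le_of_lt ?_ h; gcongr
  · have : δ * x ^ 2 ≤ 0 := mul_nonpos_of_nonpos_of_nonneg h0.le (sq_nonneg x)
    have := Real.pi_pos
    have : 0 < Real.pi ^ 2 := by positivity
    linarith

lemma sn_nonneg {δ x : ℝ} (hx : 0 ≤ x) (h : δ * x ^ 2 < Real.pi ^ 2) : 0 ≤ sn δ x := by
  rcases hx.eq_or_lt with rfl | hx
  · simp
  · exact (sn_pos hx h).le

/-- The derivative of `x ↦ sn (t x) / sn x` has the sign of `δ`. -/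
lemma wronskian_sign {δ t x : ℝ} (ht : t ∈ Icc (0 : ℝ) 1) (hx : 0 ≤ x)
    (h : δ * x ^ 2 < Real.pi ^ 2) :
    0 ≤ δ * (t * cs δ (t * x) * sn δ x - sn δ (t * x) * cs δ x) := by
  set k : ℝ → ℝ := fun x => δ * (t * cs δ (t * x) * sn δ x - sn δ (t * x) * cs δ x) with hk
  have hd : ∀ y, HasDerivAt k (δ ^ 2 * (1 - t ^ 2) * sn δ (t * y) * sn δ y) y := by
    intro y
    have hm : HasDerivAt (fun y : ℝ => t * y) t y := by
      simpa using (hasDerivAt_id y).const_mul t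
    have h1 : HasDerivAt (fun y => cs δ (t * y)) (-δ * sn δ (t * y) * t) y :=
      (hasDerivAt_cs δ (t * y)).comp y hm
    have h2 : HasDerivAt (fun y => sn δ (t * y)) (cs δ (t * y) * t) y :=
      (hasDerivAt_sn δ (t * y)).comp y hm
    have := (((h1.const_mul t).mul (hasDerivAt_sn δ y)).sub
      (h2.mul (hasDerivAt_cs δ y))).const_mul δ
    refine this.congr_deriv ?_
    ring
  have hmono : MonotoneOn k (Icc 0 x) := by
    refine monotoneOn_of_deriv_nonneg (convex_Icc 0 x)
      (fun y _ => (hd y).continuousAt.continuousWithinAt)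
      (fun y _ => (hd y).differentiableAt.differentiableWithinAt) ?_
    intro y hy
    rw [interior_Icc] at hy
    rw [(hd y).deriv]
    have r1 : δ * y ^ 2 < Real.pi ^ 2 := range_mono hy.1.le hy.2.le h
    have r2 : 0 ≤ sn δ (t * y) := sn_nonneg (mul_nonneg ht.1 hy.1.le)
      (range_mono (mul_nonneg ht.1 hy.1.le) (mul_le_of_le_one_left hy.1.le ht.2) r1)
    have r3 : 0 ≤ 1 - t ^ 2 := by nlinarith [ht.1, ht.2]
    have := sn_nonneg hy.1.le r1
    positivity
  have := hmono (left_mem_Icc.2 hx) (right_mem_Icc.2 hx) hx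
  simpa [hk] using this

lemma hasDerivAt_sn_ratio {δ t x : ℝ} (hx : 0 < x) (h : δ * x ^ 2 < Real.pi ^ 2) :
    HasDerivAt (fun x => sn δ (t * x) / sn δ x)
      ((t * cs δ (t * x) * sn δ x - sn δ (t * x) * cs δ x) / sn δ x ^ 2) x := by
  have hm : HasDerivAt (fun y : ℝ => t * y) t x := by
    simpa using (hasDerivAt_id x).const_mul t
  have h2 : HasDerivAt (fun y => sn δ (t * y)) (cs δ (t * x) * t) x :=
    (hasDerivAt_sn δ (t * x)).comp x hm
  have := h2.div (hasDerivAt_sn δ x) (sn_pos hx h).ne'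
  refine this.congr_deriv ?_
  ring

lemma sn_ratio_monotone {δ t x y : ℝ} (ht : t ∈ Icc (0 : ℝ) 1) (hx : 0 < x) (hxy : x ≤ y)
    (h : δ * y ^ 2 < Real.pi ^ 2) :
    δ * (sn δ (t * x) / sn δ x) ≤ δ * (sn δ (t * y) / sn δ y) := by
  have hy : ∀ z ∈ Icc x y, δ * z ^ 2 < Real.pi ^ 2 := fun z hz =>
    range_mono (hx.le.trans hz.1) hz.2 h
  have hd : ∀ z ∈ Icc x y, HasDerivAt (fun x => δ * (sn δ (t * x) / sn δ x))
      (δ * ((t * cs δ (t * z) * sn δ z - sn δ (t * z) * cs δ z) / sn δ z ^ 2)) z := fun z hz =>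
    (hasDerivAt_sn_ratio (hx.trans_le hz.1) (hy z hz)).const_mul δ
  have hmono : MonotoneOn (fun x => δ * (sn δ (t * x) / sn δ x)) (Icc x y) := by
    refine monotoneOn_of_deriv_nonneg (convex_Icc x y)
      (fun z hz => (hd z hz).continuousAt.continuousWithinAt)
      (fun z hz => (hd z (interior_subset hz)).differentiableAt.differentiableWithinAt) ?_
    intro z hz
    have hz := interior_subset hz
    rw [(hd z hz).deriv, ← mul_div_assoc]
    exact div_nonneg (wronskian_sign ht (hx.le.trans hz.1) (hy z hz)) (sq_nonneg _)
  exact hmono (left_mem_Icc.2 hxy) (right_mem_Icc.2 hxy) hxy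

lemma sn_ratio_ge {δ t x : ℝ} (ht : t ∈ Icc (0 : ℝ) 1) (hx : 0 < x)
    (h : δ * x ^ 2 < Real.pi ^ 2) : δ * t ≤ δ * (sn δ (t * x) / sn δ x) := by
  have h1 : Tendsto (fun y => y⁻¹ * sn δ y) (𝓝[>] 0) (𝓝 1) := by
    have := (hasDerivAt_sn δ 0).tendsto_slope_zero_right
    simpa using this
  have h2 : Tendsto (fun y => y⁻¹ * sn δ (t * y)) (𝓝[>] 0) (𝓝 t) := by
    have hm : HasDerivAt (fun y : ℝ => t * y) t 0 := by
      simpa using (hasDerivAt_id (0 : ℝ)).const_mul t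
    have h3 : HasDerivAt (fun y => sn δ (t * y)) (cs δ (t * 0) * t) 0 :=
      (hasDerivAt_sn δ (t * 0)).comp 0 hm
    have := h3.tendsto_slope_zero_right
    simpa using this
  have h3 := (h2.div h1 one_ne_zero).const_mul δ
  rw [div_one] at h3
  refine le_of_tendsto h3 ?_
  filter_upwards [Ioc_mem_nhdsGT hx] with y hy
  refine le_of_eq_of_le ?_ (sn_ratio_monotone ht hy.1 hy.2 h)
  have : y ≠ 0 := hy.1.ne'
  simp only [Pi.div_apply]
  rw [mul_div_mul_left _ _ (inv_ne_zero this)]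

lemma sigma_zero_right (K m t : ℝ) : sigma K m t 0 = t := by simp [sigma]

lemma sigma_eq {K m t θ : ℝ} (hθ : 0 < θ) :
    sigma K m t θ = sn (K / m) (t * θ) / sn (K / m) θ := by
  unfold sigma sn
  have h2 : 0 < θ ^ 2 := by positivity
  by_cases h : 0 < K / m
  · have hs := (Real.sqrt_pos.2 h).ne'
    rw [if_pos (mul_pos h h2), if_pos h, if_pos h, div_div_div_cancel_right₀ hs,
      mul_comm (t * θ), mul_comm θ]
  · by_cases h' : K / m < 0
    · have hs := (Real.sqrt_pos.2 (neg_pos.2 h')).ne'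
      rw [if_neg (by nlinarith), if_pos (by nlinarith), if_neg h, if_pos h', if_neg h, if_pos h',
        div_div_div_cancel_right₀ hs, mul_comm (t * θ), mul_comm θ]
    · have : K / m = 0 := by linarith
      simp [this, hθ.ne']

lemma sigma_pos {K m t θ : ℝ} (ht : t ∈ Ioc (0 : ℝ) 1) (hθ : 0 ≤ θ)
    (h : K / m * θ ^ 2 < Real.pi ^ 2) : 0 < sigma K m t θ := by
  rcases hθ.eq_or_lt with rfl | hθ
  · rw [sigma_zero_right]; exact ht.1
  · rw [sigma_eq hθ]
    exact div_pos (sn_pos (mul_pos ht.1 hθ) (range_mono (mul_pos ht.1 hθ).le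
      (mul_le_of_le_one_left hθ.le ht.2) h)) (sn_pos hθ h)

lemma sigma_zero_left (K m θ : ℝ) : sigma K m 0 θ = 0 := by simp [sigma]

lemma sigma_one_left {K m θ : ℝ} (hθ : 0 ≤ θ)
    (h : K / m * θ ^ 2 < Real.pi ^ 2) : sigma K m 1 θ = 1 := by
  rcases hθ.eq_or_lt with rfl | hθ
  · rw [sigma_zero_right]
  · rw [sigma_eq hθ, one_mul, div_self (sn_pos hθ h).ne']

lemma sigma_nonneg {K m t θ : ℝ} (ht : t ∈ Icc (0 : ℝ) 1) (hθ : 0 ≤ θ)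
    (h : K / m * θ ^ 2 < Real.pi ^ 2) : 0 ≤ sigma K m t θ := by
  rcases ht.1.eq_or_lt with rfl | h0
  · rw [sigma_zero_left]
  · exact (sigma_pos ⟨h0, ht.2⟩ hθ h).le

lemma sigma_monotone {K m t x y : ℝ} (ht : t ∈ Icc (0 : ℝ) 1) (hx : 0 ≤ x) (hxy : x ≤ y)
    (h : K / m * y ^ 2 < Real.pi ^ 2) :
    K / m * sigma K m t x ≤ K / m * sigma K m t y := by
  rcases hx.eq_or_lt with rfl | hx
  · rcases hxy.eq_or_lt with rfl | hy
    · rfl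
    · rw [sigma_zero_right, sigma_eq hy]
      exact sn_ratio_ge ht hy h
  · rw [sigma_eq hx, sigma_eq (hx.trans_le hxy)]
    exact sn_ratio_monotone ht hx hxy h

lemma sigma_eq_of_div_eq_zero {K m t x : ℝ} (h : K / m = 0) : sigma K m t x = t := by
  simp [sigma, h]

lemma sigma_le_sigma {K m t x y : ℝ} (hK : 0 ≤ K / m) (ht : t ∈ Icc (0 : ℝ) 1) (hx : 0 ≤ x)
    (hxy : x ≤ y) (h : K / m * y ^ 2 < Real.pi ^ 2) : sigma K m t x ≤ sigma K m t y := by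
  rcases hK.eq_or_lt with h0 | h0
  · rw [sigma_eq_of_div_eq_zero h0.symm, sigma_eq_of_div_eq_zero h0.symm]
  · exact le_of_mul_le_mul_left (sigma_monotone ht hx hxy h) h0

lemma sigma_ge_sigma {K m t x y : ℝ} (hK : K / m ≤ 0) (ht : t ∈ Icc (0 : ℝ) 1) (hx : 0 ≤ x)
    (hxy : x ≤ y) (h : K / m * y ^ 2 < Real.pi ^ 2) : sigma K m t y ≤ sigma K m t x := by
  rcases hK.eq_or_lt with h0 | h0
  · rw [sigma_eq_of_div_eq_zero h0, sigma_eq_of_div_eq_zero h0]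
  · have := sigma_monotone ht hx hxy h
    nlinarith

lemma continuousAt_sigma {K m t θ : ℝ} (hθ : 0 < θ) (h : K / m * θ ^ 2 < Real.pi ^ 2) :
    ContinuousAt (sigma K m t) θ := by
  have h1 : ContinuousAt (fun θ => sn (K / m) (t * θ) / sn (K / m) θ) θ :=
    (hasDerivAt_sn_ratio hθ h).continuousAt
  refine h1.congr ?_
  filter_upwards [Ioi_mem_nhds hθ] with y hy
  exact (sigma_eq hy).symm

lemma continuous_sigma_left {K m θ : ℝ} (hθ : 0 ≤ θ) : Continuous fun t => sigma K m t θ := by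
  rcases hθ.eq_or_lt with rfl | hθ
  · simpa [sigma_zero_right] using continuous_id'
  · simp only [sigma_eq hθ]
    have := continuous_sn (K / m)
    fun_prop

/-- On solutions of `y'' + δ y = 0` the `σ`-interpolation is exact. -/
lemma sigma_interp {K m A c x₀ x y t : ℝ}
    (h : K / m * (y - x) ^ 2 < Real.pi ^ 2) :
    A * cs (K / m) ((1 - t) * x + t * y - x₀) + c * sn (K / m) ((1 - t) * x + t * y - x₀) =
      sigma K m (1 - t) |y - x| * (A * cs (K / m) (x - x₀) + c * sn (K / m) (x - x₀)) +
      sigma K m t |y - x| * (A * cs (K / m) (y - x₀) + c * sn (K / m) (y - x₀)) := by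
  have key : ∀ x y t : ℝ, x < y → K / m * (y - x) ^ 2 < Real.pi ^ 2 →
    A * cs (K / m) ((1 - t) * x + t * y - x₀) + c * sn (K / m) ((1 - t) * x + t * y - x₀) =
      sigma K m (1 - t) |y - x| * (A * cs (K / m) (x - x₀) + c * sn (K / m) (x - x₀)) +
      sigma K m t |y - x| * (A * cs (K / m) (y - x₀) + c * sn (K / m) (y - x₀)) := by
    intro x y t hxy h
    have hd : 0 < y - x := sub_pos.2 hxy
    rw [abs_of_pos hd, sigma_eq hd, sigma_eq hd]
    have hs := sn_pos hd h
    set p := t * (y - x) with hp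
    set q := (1 - t) * (y - x) with hq
    set z := (1 - t) * x + t * y - x₀ with hz
    have e1 : x - x₀ = z + -p := by rw [hz, hp]; ring
    have e2 : y - x₀ = z + q := by rw [hz, hq]; ring
    have e3 : y - x = p + q := by rw [hp, hq]; ring
    have hs' : sn (K / m) (p + q) ≠ 0 := by rw [← e3]; exact hs.ne'
    rw [e1, e2, e3]
    field_simp
    simp only [sn_add, cs_add, sn_neg, cs_neg]
    ring
  rcases lt_trichotomy x y with hxy | rfl | hxy
  · exact key x y t hxy h
  · rw [sub_self, abs_zero, sigma_zero_right, sigma_zero_right,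
      show (1 - t) * x + t * x - x₀ = x - x₀ by ring]
    ring
  · have := key y x (1 - t) hxy (by rwa [← neg_sub, neg_sq])
    rw [abs_sub_comm, show (1 - t) * x + t * y - x₀ = (1 - (1 - t)) * y + (1 - t) * x - x₀ by ring,
      this, show 1 - (1 - t) = t by ring]
    ring

/-- Near `t = 0` the coefficient `σ^{(t)}` is at most linear in `t`. -/
lemma exists_sigma_le_mul {K m θ : ℝ} (hθ : 0 < θ) (h : K / m * θ ^ 2 < Real.pi ^ 2) :
    ∃ C > 0, ∃ t₀ ∈ Ioo (0 : ℝ) 1, ∀ t ∈ Ioc 0 t₀, sigma K m t θ ≤ C * t := by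
  have hs := sn_pos hθ h
  refine ⟨2 * θ / sn (K / m) θ, by positivity, ?_⟩
  have h1 : Tendsto (fun y => y⁻¹ * sn (K / m) (y * θ)) (𝓝[>] 0) (𝓝 θ) := by
    have hm : HasDerivAt (fun y : ℝ => y * θ) θ 0 := by
      simpa using (hasDerivAt_id (0 : ℝ)).mul_const θ
    have h3 : HasDerivAt (fun y => sn (K / m) (y * θ)) (cs (K / m) (0 * θ) * θ) 0 :=
      HasDerivAt.comp (h₂ := sn (K / m)) 0 (hasDerivAt_sn (K / m) (0 * θ)) hm
    have := h3.tendsto_slope_zero_right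
    simpa using this
  have h2 := h1.eventually (gt_mem_nhds (show θ < 2 * θ by linarith))
  obtain ⟨r, hr, hr'⟩ := (mem_nhdsGT_iff_exists_Ioo_subset).1 h2
  refine ⟨min (r / 2) (1 / 2), ⟨by have : 0 < r := hr; positivity, by
    have := min_le_right (r / 2) (1 / 2); linarith⟩, ?_⟩
  intro t ht
  have : t < r := by
    have h5 := ht.2.trans (min_le_left _ _)
    have : 0 < r := hr
    linarith
  have h4 : t⁻¹ * sn (K / m) (t * θ) < 2 * θ := hr' ⟨ht.1, this⟩
  rw [sigma_eq hθ, div_mul_eq_mul_div]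
  gcongr
  rw [inv_mul_lt_iff₀ ht.1] at h4
  linarith

/-! ### Potentials and the distorted mean -/

/-- The increasing function expressing a density through its potential: `exp u` for `N = ∞`,
`u₊ ^ (N - 1)` for `N > 1`, and `(-u) ^ (N - 1)` for `N ≤ 0`, where only `u < 0` is meaningful.
In potential coordinates all three families of distorted means are interpolations that increase
in each argument. -/
noncomputable def toDens (N : WithTop ℝ) (u : ℝ) : ℝ :=
  match N with
  | ⊤ => Real.exp u
  | (n : ℝ) => if 1 < n then (max u 0) ^ (n - 1) else (-u) ^ (n - 1)

/-- The potential of a positive density value, the inverse of `toDens`. -/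
noncomputable def toPot (N : WithTop ℝ) (a : ℝ) : ℝ :=
  match N with
  | ⊤ => Real.log a
  | (n : ℝ) => if 1 < n then a ^ (1 / (n - 1)) else -(a ^ (1 / (n - 1)))

/-- The potentials of positive density values. -/
def potDom (N : WithTop ℝ) : Set ℝ :=
  match N with
  | ⊤ => univ
  | (n : ℝ) => if 1 < n then Ioi 0 else Iio 0

/-- The interpolation of potentials at distance `d` and time `t` underlying the distorted mean. -/
noncomputable def potInterp (K : ℝ) (N : WithTop ℝ) (t d u v : ℝ) : ℝ :=
  match N with
  | ⊤ => (1 - t) * u + t * v + K * t * (1 - t) * d ^ 2 / 2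
  | (n : ℝ) => sigma K (n - 1) (1 - t) d * u + sigma K (n - 1) t d * v

/-- The distorted mean `M` of positive numbers at distances below `l_δ`, as a real number. -/
noncomputable def rmean (K : ℝ) (N : WithTop ℝ) (t d a b : ℝ) : ℝ :=
  toDens N (potInterp K N t d (toPot N a) (toPot N b))

lemma toDens_top (u : ℝ) : toDens ⊤ u = Real.exp u := rfl

lemma toDens_of_one_lt {n : ℝ} (h : 1 < n) (u : ℝ) :
    toDens (n : WithTop ℝ) u = (max u 0) ^ (n - 1) := if_pos h

lemma toDens_of_nonpos {n : ℝ} (h : n ≤ 0) (u : ℝ) :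
    toDens (n : WithTop ℝ) u = (-u) ^ (n - 1) := if_neg (by linarith)

lemma toPot_top (a : ℝ) : toPot ⊤ a = Real.log a := rfl

lemma toPot_of_one_lt {n : ℝ} (h : 1 < n) (a : ℝ) :
    toPot (n : WithTop ℝ) a = a ^ (1 / (n - 1)) := if_pos h

lemma toPot_of_nonpos {n : ℝ} (h : n ≤ 0) (a : ℝ) :
    toPot (n : WithTop ℝ) a = -(a ^ (1 / (n - 1))) := if_neg (by linarith)

lemma mem_potDom_top (u : ℝ) : u ∈ potDom ⊤ := mem_univ u

lemma mem_potDom_of_one_lt {n : ℝ} (h : 1 < n) {u : ℝ} : u ∈ potDom (n : WithTop ℝ) ↔ 0 < u := by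
  simp [potDom, h]

lemma mem_potDom_of_nonpos {n : ℝ} (h : n ≤ 0) {u : ℝ} : u ∈ potDom (n : WithTop ℝ) ↔ u < 0 := by
  have : ¬ 1 < n := by linarith
  simp [potDom, this]

lemma potInterp_top (K t d u v : ℝ) :
    potInterp K ⊤ t d u v = (1 - t) * u + t * v + K * t * (1 - t) * d ^ 2 / 2 := rfl

lemma potInterp_coe (K n t d u v : ℝ) : potInterp K (n : WithTop ℝ) t d u v =
    sigma K (n - 1) (1 - t) d * u + sigma K (n - 1) t d * v := rfl

lemma delta_coe (K n : ℝ) : delta K (n : WithTop ℝ) = K / (n - 1) := rfl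

lemma delta_top (K : ℝ) : delta K ⊤ = 0 := rfl

lemma admissible_cases {N : WithTop ℝ} (hN : N ≤ 0 ∨ 1 < N) :
    N = ⊤ ∨ (∃ n : ℝ, N = n ∧ 1 < n) ∨ ∃ n : ℝ, N = n ∧ n ≤ 0 := by
  induction N using WithTop.recTopCoe with
  | top => exact Or.inl rfl
  | coe n =>
    right
    rcases hN with h | h
    · exact Or.inr ⟨n, rfl, by exact_mod_cast h⟩
    · exact Or.inl ⟨n, rfl, by exact_mod_cast h⟩

lemma toDens_nonneg {N : WithTop ℝ} (hN : N ≤ 0 ∨ 1 < N) {u : ℝ} (hu : u ∈ potDom N ∨ 1 < N) :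
    0 ≤ toDens N u := by
  rcases admissible_cases hN with rfl | ⟨n, rfl, h⟩ | ⟨n, rfl, h⟩
  · exact (Real.exp_pos u).le
  · rw [toDens_of_one_lt h]; positivity
  · rw [toDens_of_nonpos h]
    rcases hu with hu | hu
    · rw [mem_potDom_of_nonpos h] at hu
      exact Real.rpow_nonneg (by linarith) _
    · have : (1 : ℝ) < n := by exact_mod_cast hu
      linarith

lemma toDens_pos {N : WithTop ℝ} (hN : N ≤ 0 ∨ 1 < N) {u : ℝ} (hu : u ∈ potDom N) :
    0 < toDens N u := by
  rcases admissible_cases hN with rfl | ⟨n, rfl, h⟩ | ⟨n, rfl, h⟩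
  · exact Real.exp_pos u
  · rw [mem_potDom_of_one_lt h] at hu
    rw [toDens_of_one_lt h, max_eq_left hu.le]; positivity
  · rw [mem_potDom_of_nonpos h] at hu
    rw [toDens_of_nonpos h]
    exact Real.rpow_pos_of_pos (by linarith) _

lemma toDens_mono {N : WithTop ℝ} (hN : N ≤ 0 ∨ 1 < N) {u v : ℝ} (huv : u ≤ v)
    (hv : v ∈ potDom N ∨ 1 < N) : toDens N u ≤ toDens N v := by
  rcases admissible_cases hN with rfl | ⟨n, rfl, h⟩ | ⟨n, rfl, h⟩
  · exact Real.exp_le_exp.2 huv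
  · rw [toDens_of_one_lt h, toDens_of_one_lt h]
    exact Real.rpow_le_rpow (le_max_right _ _) (max_le_max_right 0 huv) (by linarith)
  · rw [toDens_of_nonpos h, toDens_of_nonpos h]
    rcases hv with hv | hv
    · rw [mem_potDom_of_nonpos h] at hv
      exact Real.rpow_le_rpow_of_nonpos (by linarith) (by linarith) (by linarith)
    · have : (1 : ℝ) < n := by exact_mod_cast hv
      linarith

lemma toPot_mem {N : WithTop ℝ} (hN : N ≤ 0 ∨ 1 < N) {a : ℝ} (ha : 0 < a) :
    toPot N a ∈ potDom N := by
  rcases admissible_cases hN with rfl | ⟨n, rfl, h⟩ | ⟨n, rfl, h⟩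
  · exact mem_potDom_top _
  · rw [mem_potDom_of_one_lt h, toPot_of_one_lt h]; positivity
  · rw [mem_potDom_of_nonpos h, toPot_of_nonpos h, neg_lt_zero]; positivity

lemma toDens_toPot {N : WithTop ℝ} (hN : N ≤ 0 ∨ 1 < N) {a : ℝ} (ha : 0 < a) :
    toDens N (toPot N a) = a := by
  rcases admissible_cases hN with rfl | ⟨n, rfl, h⟩ | ⟨n, rfl, h⟩
  · exact Real.exp_log ha
  · rw [toPot_of_one_lt h, toDens_of_one_lt h, max_eq_left (by positivity), ← Real.rpow_mul ha.le,
      one_div_mul_cancel (by linarith), Real.rpow_one]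
  · rw [toPot_of_nonpos h, toDens_of_nonpos h, neg_neg, ← Real.rpow_mul ha.le,
      one_div_mul_cancel (by linarith), Real.rpow_one]

lemma toPot_toDens {N : WithTop ℝ} (hN : N ≤ 0 ∨ 1 < N) {u : ℝ} (hu : u ∈ potDom N) :
    toPot N (toDens N u) = u := by
  rcases admissible_cases hN with rfl | ⟨n, rfl, h⟩ | ⟨n, rfl, h⟩
  · exact Real.log_exp u
  · rw [mem_potDom_of_one_lt h] at hu
    rw [toPot_of_one_lt h, toDens_of_one_lt h, max_eq_left hu.le, ← Real.rpow_mul hu.le,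
      mul_one_div_cancel (by linarith), Real.rpow_one]
  · rw [mem_potDom_of_nonpos h] at hu
    rw [toPot_of_nonpos h, toDens_of_nonpos h, ← Real.rpow_mul (by linarith),
      mul_one_div_cancel (by linarith), Real.rpow_one, neg_neg]

lemma toPot_mono {N : WithTop ℝ} (hN : N ≤ 0 ∨ 1 < N) {a b : ℝ} (ha : 0 < a) (hab : a ≤ b) :
    toPot N a ≤ toPot N b := by
  rcases admissible_cases hN with rfl | ⟨n, rfl, h⟩ | ⟨n, rfl, h⟩
  · exact Real.log_le_log ha hab
  · rw [toPot_of_one_lt h, toPot_of_one_lt h]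
    have : 0 < n - 1 := by linarith
    exact Real.rpow_le_rpow ha.le hab (by positivity)
  · rw [toPot_of_nonpos h, toPot_of_nonpos h, neg_le_neg_iff]
    exact Real.rpow_le_rpow_of_nonpos ha hab (one_div_nonpos.2 (by linarith))

lemma toPot_lt {N : WithTop ℝ} (hN : N ≤ 0 ∨ 1 < N) {a b : ℝ} (ha : 0 < a) (hab : a < b) :
    toPot N a < toPot N b := by
  refine lt_of_le_of_ne (toPot_mono hN ha hab.le) fun h => hab.ne ?_
  rw [← toDens_toPot hN ha, h, toDens_toPot hN (ha.trans hab)]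

lemma toDens_lt {N : WithTop ℝ} (hN : N ≤ 0 ∨ 1 < N) {u v : ℝ} (huv : u < v)
    (hv : v ∈ potDom N) : toDens N u < toDens N v := by
  rcases admissible_cases hN with rfl | ⟨n, rfl, h⟩ | ⟨n, rfl, h⟩
  · exact Real.exp_lt_exp.2 huv
  · rw [mem_potDom_of_one_lt h] at hv
    rw [toDens_of_one_lt h, toDens_of_one_lt h]
    refine Real.rpow_lt_rpow (le_max_right _ _) ?_ (by linarith)
    rw [max_eq_left hv.le]
    exact max_lt huv hv
  · rw [mem_potDom_of_nonpos h] at hv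
    rw [toDens_of_nonpos h, toDens_of_nonpos h]
    exact Real.rpow_lt_rpow_of_neg (by linarith) (by linarith) (by linarith)

/-- Outside `potDom` the density of a potential below `potDom` vanishes; this happens only for
finite `N > 1`. -/
lemma mem_potDom_of_le {N : WithTop ℝ} (hN : N ≤ 0 ∨ 1 < N) {u v : ℝ} (huv : u ≤ v)
    (hv : v ∈ potDom N) : u ∈ potDom N ∨ (1 < N ∧ toDens N u = 0) := by
  rcases admissible_cases hN with rfl | ⟨n, rfl, h⟩ | ⟨n, rfl, h⟩
  · exact Or.inl (mem_potDom_top _)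
  · rcases lt_or_ge 0 u with h0 | h0
    · exact Or.inl ((mem_potDom_of_one_lt h).2 h0)
    · refine Or.inr ⟨by exact_mod_cast h, ?_⟩
      rw [toDens_of_one_lt h, max_eq_right h0, Real.zero_rpow (by linarith)]
  · left
    rw [mem_potDom_of_nonpos h] at hv ⊢
    linarith

lemma isOpen_potDom (N : WithTop ℝ) : IsOpen (potDom N) := by
  induction N using WithTop.recTopCoe with
  | top => exact isOpen_univ
  | coe n =>
    change IsOpen (if 1 < n then Ioi 0 else Iio 0)
    split_ifs
    · exact isOpen_Ioi
    · exact isOpen_Iio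

lemma one_sub_mem {t : ℝ} (ht : t ∈ Icc (0 : ℝ) 1) : 1 - t ∈ Icc (0 : ℝ) 1 :=
  ⟨by linarith [ht.2], by linarith [ht.1]⟩

lemma potInterp_mem {K : ℝ} {N : WithTop ℝ} (hN : N ≤ 0 ∨ 1 < N) {t d u v : ℝ}
    (ht : t ∈ Icc (0 : ℝ) 1) (hd : 0 ≤ d) (hr : delta K N * d ^ 2 < Real.pi ^ 2)
    (hu : u ∈ potDom N) (hv : v ∈ potDom N) : potInterp K N t d u v ∈ potDom N := by
  rcases admissible_cases hN with rfl | ⟨n, rfl, h⟩ | ⟨n, rfl, h⟩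
  · exact mem_potDom_top _
  all_goals
    rw [delta_coe] at hr
    rw [potInterp_coe]
    have s0 := sigma_nonneg (one_sub_mem ht) hd hr
    have s1 := sigma_nonneg ht hd hr
  · rw [mem_potDom_of_one_lt h] at *
    rcases ht.1.eq_or_lt with rfl | h0
    · rw [sub_zero, sigma_one_left hd hr, sigma_zero_left]; linarith
    · have := sigma_pos ⟨h0, ht.2⟩ hd hr
      positivity
  · rw [mem_potDom_of_nonpos h] at *
    rcases ht.1.eq_or_lt with rfl | h0
    · rw [sub_zero, sigma_one_left hd hr, sigma_zero_left]; linarith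
    · have := sigma_pos ⟨h0, ht.2⟩ hd hr
      nlinarith

lemma potInterp_mono {K : ℝ} {N : WithTop ℝ} {t d u v u' v' : ℝ}
    (ht : t ∈ Icc (0 : ℝ) 1) (hd : 0 ≤ d) (hr : delta K N * d ^ 2 < Real.pi ^ 2)
    (hu : u ≤ u') (hv : v ≤ v') : potInterp K N t d u v ≤ potInterp K N t d u' v' := by
  have ht' := one_sub_mem ht
  induction N using WithTop.recTopCoe with
  | top =>
    rw [potInterp_top, potInterp_top]
    have := ht.1; have := ht'.1
    gcongr
  | coe n =>
    rw [delta_coe] at hr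
    rw [potInterp_coe, potInterp_coe]
    have s0 := sigma_nonneg ht' hd hr
    have s1 := sigma_nonneg ht hd hr
    gcongr

lemma potInterp_swap (K : ℝ) (N : WithTop ℝ) (t d u v : ℝ) :
    potInterp K N (1 - t) d u v = potInterp K N t d v u := by
  induction N using WithTop.recTopCoe with
  | top => rw [potInterp_top, potInterp_top]; ring
  | coe n => rw [potInterp_coe, potInterp_coe, sub_sub_cancel]; ring

lemma potInterp_zero {K : ℝ} {N : WithTop ℝ} {d : ℝ} (hd : 0 ≤ d)
    (hr : delta K N * d ^ 2 < Real.pi ^ 2) (u v : ℝ) : potInterp K N 0 d u v = u := by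
  induction N using WithTop.recTopCoe with
  | top => rw [potInterp_top]; ring
  | coe n => rw [potInterp_coe, sub_zero, sigma_one_left hd hr, sigma_zero_left]; ring

lemma potInterp_one {K : ℝ} {N : WithTop ℝ} {d : ℝ} (hd : 0 ≤ d)
    (hr : delta K N * d ^ 2 < Real.pi ^ 2) (u v : ℝ) : potInterp K N 1 d u v = v := by
  rw [← sub_zero (1 : ℝ), potInterp_swap, potInterp_zero hd hr]

lemma continuous_potInterp_time {K : ℝ} {N : WithTop ℝ} {d : ℝ} (hd : 0 ≤ d) (u v : ℝ) :
    Continuous fun t => potInterp K N t d u v := by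
  induction N using WithTop.recTopCoe with
  | top => simp only [potInterp_top]; fun_prop
  | coe n =>
    simp only [potInterp_coe]
    have h := continuous_sigma_left (K := K) (m := n - 1) hd
    exact ((h.comp (continuous_const.sub continuous_id)).mul continuous_const).add
      (h.mul continuous_const)

lemma continuousAt_potInterp {K : ℝ} {N : WithTop ℝ} {t d : ℝ} (hd : 0 < d)
    (hr : delta K N * d ^ 2 < Real.pi ^ 2) (u v : ℝ) :
    ContinuousAt (fun d => potInterp K N t d u v) d := by
  induction N using WithTop.recTopCoe with
  | top => simp only [potInterp_top]; fun_prop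
  | coe n =>
    rw [delta_coe] at hr
    simp only [potInterp_coe]
    exact ((continuousAt_sigma hd hr).mul continuousAt_const).add
      ((continuousAt_sigma hd hr).mul continuousAt_const)

lemma delta_range_mono {K : ℝ} {N : WithTop ℝ} {x y : ℝ} (hx : 0 ≤ x) (hxy : x ≤ y)
    (h : delta K N * y ^ 2 < Real.pi ^ 2) : delta K N * x ^ 2 < Real.pi ^ 2 :=
  range_mono hx hxy h

/-- The interpolation increases with the distance if `K ≥ 0` and decreases if `K ≤ 0`. -/
lemma potInterp_dist_mono {K : ℝ} {N : WithTop ℝ} (hN : N ≤ 0 ∨ 1 < N) {t x y u v : ℝ}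
    (ht : t ∈ Icc (0 : ℝ) 1) (hx : 0 ≤ x) (hy : 0 ≤ y)
    (hxy : 0 ≤ K ∧ x ≤ y ∨ K ≤ 0 ∧ y ≤ x)
    (hrx : delta K N * x ^ 2 < Real.pi ^ 2) (hry : delta K N * y ^ 2 < Real.pi ^ 2)
    (hu : u ∈ potDom N) (hv : v ∈ potDom N) :
    potInterp K N t x u v ≤ potInterp K N t y u v := by
  have ht' := one_sub_mem ht
  rcases admissible_cases hN with rfl | ⟨n, rfl, h⟩ | ⟨n, rfl, h⟩
  · rw [potInterp_top, potInterp_top]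
    have : K * x ^ 2 ≤ K * y ^ 2 := by
      rcases hxy with ⟨hK, hxy⟩ | ⟨hK, hxy⟩
      · gcongr
      · exact mul_le_mul_of_nonpos_left (by gcongr) hK
    have h1 := mul_nonneg ht.1 ht'.1
    nlinarith
  · rw [mem_potDom_of_one_lt h] at *
    rw [delta_coe] at *
    have key : ∀ s ∈ Icc (0 : ℝ) 1, sigma K (n - 1) s x ≤ sigma K (n - 1) s y := by
      intro s hs
      have h0 : 0 < n - 1 := by linarith
      rcases hxy with ⟨hK, hxy⟩ | ⟨hK, hxy⟩
      · exact sigma_le_sigma (by positivity) hs hx hxy hry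
      · exact sigma_ge_sigma (div_nonpos_of_nonpos_of_nonneg hK h0.le) hs hy hxy hrx
    rw [potInterp_coe, potInterp_coe]
    have := key _ ht; have := key _ ht'
    gcongr
  · rw [mem_potDom_of_nonpos h] at *
    rw [delta_coe] at *
    have key : ∀ s ∈ Icc (0 : ℝ) 1, sigma K (n - 1) s y ≤ sigma K (n - 1) s x := by
      intro s hs
      have h0 : n - 1 ≤ 0 := by linarith
      rcases hxy with ⟨hK, hxy⟩ | ⟨hK, hxy⟩
      · exact sigma_ge_sigma (div_nonpos_of_nonneg_of_nonpos hK h0) hs hx hxy hry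
      · exact sigma_le_sigma (div_nonneg_of_nonpos hK h0) hs hy hxy hrx
    rw [potInterp_coe, potInterp_coe]
    have := key _ ht; have := key _ ht'
    nlinarith

lemma rmean_pos {K : ℝ} {N : WithTop ℝ} (hN : N ≤ 0 ∨ 1 < N) {t d a b : ℝ}
    (ht : t ∈ Icc (0 : ℝ) 1) (hd : 0 ≤ d) (hr : delta K N * d ^ 2 < Real.pi ^ 2)
    (ha : 0 < a) (hb : 0 < b) : 0 < rmean K N t d a b :=
  toDens_pos hN (potInterp_mem hN ht hd hr (toPot_mem hN ha) (toPot_mem hN hb))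

lemma rmean_mono {K : ℝ} {N : WithTop ℝ} (hN : N ≤ 0 ∨ 1 < N) {t d a b a' b' : ℝ}
    (ht : t ∈ Icc (0 : ℝ) 1) (hd : 0 ≤ d) (hr : delta K N * d ^ 2 < Real.pi ^ 2)
    (ha : 0 < a) (hb : 0 < b) (ha' : a ≤ a') (hb' : b ≤ b') :
    rmean K N t d a b ≤ rmean K N t d a' b' :=
  toDens_mono hN (potInterp_mono ht hd hr (toPot_mono hN ha ha') (toPot_mono hN hb hb'))
    (Or.inl (potInterp_mem hN ht hd hr (toPot_mem hN (ha.trans_le ha'))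
      (toPot_mem hN (hb.trans_le hb'))))

lemma rmean_dist_mono {K : ℝ} {N : WithTop ℝ} (hN : N ≤ 0 ∨ 1 < N) {t x y a b : ℝ}
    (ht : t ∈ Icc (0 : ℝ) 1) (hx : 0 ≤ x) (hy : 0 ≤ y)
    (hxy : 0 ≤ K ∧ x ≤ y ∨ K ≤ 0 ∧ y ≤ x)
    (hrx : delta K N * x ^ 2 < Real.pi ^ 2) (hry : delta K N * y ^ 2 < Real.pi ^ 2)
    (ha : 0 < a) (hb : 0 < b) : rmean K N t x a b ≤ rmean K N t y a b :=
  toDens_mono hN (potInterp_dist_mono hN ht hx hy hxy hrx hry (toPot_mem hN ha) (toPot_mem hN hb))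
    (Or.inl (potInterp_mem hN ht hy hry (toPot_mem hN ha) (toPot_mem hN hb)))

lemma rmean_zero {K : ℝ} {N : WithTop ℝ} (hN : N ≤ 0 ∨ 1 < N) {d a b : ℝ} (hd : 0 ≤ d)
    (hr : delta K N * d ^ 2 < Real.pi ^ 2) (ha : 0 < a) : rmean K N 0 d a b = a := by
  rw [rmean, potInterp_zero hd hr, toDens_toPot hN ha]

lemma rmean_one {K : ℝ} {N : WithTop ℝ} (hN : N ≤ 0 ∨ 1 < N) {d a b : ℝ} (hd : 0 ≤ d)
    (hr : delta K N * d ^ 2 < Real.pi ^ 2) (hb : 0 < b) : rmean K N 1 d a b = b := by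
  rw [rmean, potInterp_one hd hr, toDens_toPot hN hb]

lemma rmean_smul {K : ℝ} {N : WithTop ℝ} (hN : N ≤ 0 ∨ 1 < N) {t d a b c : ℝ}
    (ht : t ∈ Icc (0 : ℝ) 1) (hd : 0 ≤ d) (hr : delta K N * d ^ 2 < Real.pi ^ 2)
    (ha : 0 < a) (hb : 0 < b) (hc : 0 < c) :
    rmean K N t d (c * a) (c * b) = c * rmean K N t d a b := by
  have hm := potInterp_mem hN ht hd hr (toPot_mem hN ha) (toPot_mem hN hb)
  unfold rmean
  rcases admissible_cases hN with rfl | ⟨n, rfl, h⟩ | ⟨n, rfl, h⟩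
  · simp only [toDens_top, toPot_top, potInterp_top]
    rw [Real.log_mul hc.ne' ha.ne', Real.log_mul hc.ne' hb.ne']
    conv_rhs => rw [← Real.exp_log hc, ← Real.exp_add]
    congr 1; ring
  · rw [mem_potDom_of_one_lt h] at hm
    simp only [toDens_of_one_lt h, toPot_of_one_lt h, potInterp_coe] at hm ⊢
    rw [Real.mul_rpow hc.le ha.le, Real.mul_rpow hc.le hb.le, mul_left_comm, mul_left_comm _ _
      (b ^ _),
      ← mul_add, max_eq_left hm.le, max_eq_left (by positivity),
      Real.mul_rpow (by positivity) hm.le, ← Real.rpow_mul hc.le,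
      one_div_mul_cancel (by linarith), Real.rpow_one]
  · rw [mem_potDom_of_nonpos h] at hm
    simp only [toDens_of_nonpos h, toPot_of_nonpos h, potInterp_coe] at hm ⊢
    rw [Real.mul_rpow hc.le ha.le, Real.mul_rpow hc.le hb.le, ← mul_neg, ← mul_neg, mul_left_comm,
      mul_left_comm _ _ (-b ^ _), ← mul_add, ← mul_neg,
      Real.mul_rpow (by positivity) (by linarith), ← Real.rpow_mul hc.le,
      one_div_mul_cancel (by linarith), Real.rpow_one]

lemma continuousAt_toDens {N : WithTop ℝ} (hN : N ≤ 0 ∨ 1 < N) {u : ℝ}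
    (hu : u ∈ potDom N ∨ 1 < N) : ContinuousAt (toDens N) u := by
  rcases admissible_cases hN with rfl | ⟨n, rfl, h⟩ | ⟨n, rfl, h⟩
  · exact Real.continuous_exp.continuousAt
  · have : toDens (n : WithTop ℝ) = fun u => (max u 0) ^ (n - 1) :=
      funext fun u => toDens_of_one_lt h u
    rw [this]
    exact (continuous_id.max continuous_const).continuousAt.rpow_const (Or.inr (by linarith))
  · have : toDens (n : WithTop ℝ) = fun u => (-u) ^ (n - 1) :=
      funext fun u => toDens_of_nonpos h u
    rw [this]
    rcases hu with hu | hu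
    · rw [mem_potDom_of_nonpos h] at hu
      exact continuous_neg.continuousAt.rpow_const (Or.inl (by linarith))
    · have : (1 : ℝ) < n := by exact_mod_cast hu
      linarith

lemma continuousAt_rmean {K : ℝ} {N : WithTop ℝ} (hN : N ≤ 0 ∨ 1 < N) {t d a b : ℝ}
    (ht : t ∈ Icc (0 : ℝ) 1) (hd : 0 < d) (hr : delta K N * d ^ 2 < Real.pi ^ 2)
    (ha : 0 < a) (hb : 0 < b) : ContinuousAt (fun d => rmean K N t d a b) d :=
  ContinuousAt.comp (g := toDens N)
    (continuousAt_toDens hN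
      (Or.inl (potInterp_mem hN ht hd.le hr (toPot_mem hN ha) (toPot_mem hN hb))))
    (continuousAt_potInterp hd hr _ _)

lemma measurable_toDens (N : WithTop ℝ) : Measurable (toDens N) := by
  induction N using WithTop.recTopCoe with
  | top => exact Real.measurable_exp
  | coe n =>
    by_cases h : 1 < n
    · have : toDens (n : WithTop ℝ) = fun u => (max u 0) ^ (n - 1) :=
        funext fun u => toDens_of_one_lt h u
      rw [this]; fun_prop
    · have : toDens (n : WithTop ℝ) = fun u => (-u) ^ (n - 1) :=
        funext fun u => if_neg h
      rw [this]; fun_prop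

lemma measurable_toPot (N : WithTop ℝ) : Measurable (toPot N) := by
  induction N using WithTop.recTopCoe with
  | top => exact Real.measurable_log
  | coe n =>
    by_cases h : 1 < n
    · have : toPot (n : WithTop ℝ) = fun a => a ^ (1 / (n - 1)) :=
        funext fun u => toPot_of_one_lt h u
      rw [this]; fun_prop
    · have : toPot (n : WithTop ℝ) = fun a => -(a ^ (1 / (n - 1))) :=
        funext fun u => if_neg h
      rw [this]; fun_prop

lemma distMean_eq {K : ℝ} {N : WithTop ℝ} (hN : N ≤ 0 ∨ 1 < N) {t d a b : ℝ}
    (ht : t ∈ Icc (0 : ℝ) 1) (hd : 0 ≤ d) (hr : delta K N * d ^ 2 < Real.pi ^ 2)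
    (ha : 0 < a) (hb : 0 < b) : distMean K N t d a b = ENNReal.ofReal (rmean K N t d a b) := by
  have hm := potInterp_mem hN ht hd hr (toPot_mem hN ha) (toPot_mem hN hb)
  unfold rmean
  rcases admissible_cases hN with rfl | ⟨n, rfl, h⟩ | ⟨n, rfl, h⟩
  · change (if a * b = 0 then 0 else ENNReal.ofReal _) = _
    rw [if_neg (by positivity), toDens_top, potInterp_top, toPot_top, toPot_top,
      Real.rpow_def_of_pos ha, Real.rpow_def_of_pos hb, ← Real.exp_add, ← Real.exp_add]
    congr 3; ring
  · change (if a * b = 0 then 0 else if Real.pi ^ 2 ≤ K / (n - 1) * d ^ 2 then _ else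
      ENNReal.ofReal _) = _
    rw [delta_coe] at hr
    rw [mem_potDom_of_one_lt h] at hm
    rw [if_neg (by positivity), if_neg (not_le.2 hr), toDens_of_one_lt h, max_eq_left hm.le,
      potInterp_coe, toPot_of_one_lt h, toPot_of_one_lt h]
  · change (if a * b = 0 then 0 else if Real.pi ^ 2 ≤ K / (n - 1) * d ^ 2 then _ else
      ENNReal.ofReal _) = _
    rw [delta_coe] at hr
    rw [if_neg (by positivity), if_neg (not_le.2 hr), toDens_of_nonpos h,
      potInterp_coe, toPot_of_nonpos h, toPot_of_nonpos h]
    congr 2; ring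

lemma distMean_out_of_range {K : ℝ} {N : WithTop ℝ} {t d a b : ℝ}
    (hr : Real.pi ^ 2 ≤ delta K N * d ^ 2) (ha : 0 < a) (hb : 0 < b) :
    distMean K N t d a b = if 0 < K then ⊤ else 0 := by
  induction N using WithTop.recTopCoe with
  | top =>
    rw [delta_top, zero_mul] at hr
    have : 0 < Real.pi ^ 2 := by have := Real.pi_pos; positivity
    linarith
  | coe n =>
    change (if a * b = 0 then 0 else if Real.pi ^ 2 ≤ K / (n - 1) * d ^ 2 then _ else _) = _
    rw [delta_coe] at hr
    rw [if_neg (by positivity), if_pos hr]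

lemma distMeanTilde_out_of_range {K : ℝ} {N : WithTop ℝ} {t d a b : ℝ}
    (hr : Real.pi ^ 2 ≤ delta K N * d ^ 2) (ha : 0 < a) (hb : 0 < b) :
    distMeanTilde K N t d a b = if 0 < K then ⊤ else 0 := by
  induction N using WithTop.recTopCoe with
  | top =>
    rw [delta_top, zero_mul] at hr
    have : 0 < Real.pi ^ 2 := by have := Real.pi_pos; positivity
    linarith
  | coe n =>
    change (if a * b = 0 then 0 else if Real.pi ^ 2 ≤ K / (n - 1) * d ^ 2 then _ else _) = _
    rw [delta_coe] at hr
    rw [if_neg (by positivity), if_pos hr]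

/-! ### Convexity of powers: supporting hyperplanes, and comparison of the two distorted means -/

lemma rpow_jensen {p x y μ ν : ℝ} (hp : 1 ≤ p ∨ p < 0) (hx : 0 < x) (hy : 0 < y)
    (hμ : 0 ≤ μ) (hν : 0 ≤ ν) (h1 : μ + ν = 1) :
    (μ * x + ν * y) ^ p ≤ μ * x ^ p + ν * y ^ p := by
  rcases hp with hp | hp
  · exact (convexOn_rpow hp).2 hx.le hy.le hμ hν h1
  · have e1 := Real.geom_mean_le_arith_mean2_weighted hμ hν hx.le hy.le h1
    have e2 := Real.geom_mean_le_arith_mean2_weighted hμ hν (Real.rpow_nonneg hx.le p)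
      (Real.rpow_nonneg hy.le p) h1
    refine le_trans (Real.rpow_le_rpow_of_nonpos (by positivity) e1 hp.le) (le_of_eq_of_le ?_ e2)
    rw [Real.mul_rpow (by positivity) (by positivity), ← Real.rpow_mul hx.le, ← Real.rpow_mul hy.le,
      ← Real.rpow_mul hx.le, ← Real.rpow_mul hy.le, mul_comm μ, mul_comm ν]

/-- The tangent inequality for `x ↦ x ^ p` under a weighted sum. -/
lemma rpow_tangent {p s₀ s₁ u₀ u₁ v₀ v₁ : ℝ} (hp : 1 ≤ p ∨ p < 0) (hs₀ : 0 < s₀) (hs₁ : 0 < s₁)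
    (hu₀ : 0 < u₀) (hu₁ : 0 < u₁) (hv₀ : 0 < v₀) (hv₁ : 0 < v₁) :
    (s₀ * v₀ + s₁ * v₁) ^ p ≤
      ((s₀ * u₀ + s₁ * u₁) ^ p * (s₀ * u₀ / (s₀ * u₀ + s₁ * u₁)) / u₀ ^ p) * v₀ ^ p +
      ((s₀ * u₀ + s₁ * u₁) ^ p * (s₁ * u₁ / (s₀ * u₀ + s₁ * u₁)) / u₁ ^ p) * v₁ ^ p := by
  set S := s₀ * u₀ + s₁ * u₁ with hS
  have hS0 : 0 < S := by positivity
  have h := rpow_jensen hp (div_pos hv₀ hu₀) (div_pos hv₁ hu₁) (div_nonneg (by positivity) hS0.le)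
    (div_nonneg (by positivity) hS0.le)
    (show s₀ * u₀ / S + s₁ * u₁ / S = 1 by rw [← add_div, div_self hS0.ne'])
  have e : s₀ * v₀ + s₁ * v₁ = S * (s₀ * u₀ / S * (v₀ / u₀) + s₁ * u₁ / S * (v₁ / u₁)) := by
    field_simp
  rw [e, Real.mul_rpow hS0.le (by positivity)]
  refine (mul_le_mul_of_nonneg_left h (by positivity)).trans (le_of_eq ?_)
  rw [Real.div_rpow hv₀.le hu₀.le, Real.div_rpow hv₁.le hu₁.le]
  ring

/-- In density coordinates the interpolation is concave: at every pair of potentials it has a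
supporting hyperplane, which passes through the origin because the mean is homogeneous. For
`1 < N < 2` this fails, the power `N - 1` being smaller than `1`. -/
lemma exists_tangent {K : ℝ} {N : WithTop ℝ} (hN : N ≤ 0 ∨ 2 ≤ N) {t d u₀ u₁ : ℝ}
    (ht : t ∈ Ioo (0 : ℝ) 1) (hd : 0 ≤ d) (hr : delta K N * d ^ 2 < Real.pi ^ 2)
    (hu₀ : u₀ ∈ potDom N) (hu₁ : u₁ ∈ potDom N) :
    ∃ α β : ℝ,
      toDens N (potInterp K N t d u₀ u₁) = α * toDens N u₀ + β * toDens N u₁ ∧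
      ∀ v₀ ≤ u₀, ∀ v₁ ≤ u₁, toDens N (potInterp K N t d v₀ v₁) ≤
        α * toDens N v₀ + β * toDens N v₁ := by
  have ht' : 1 - t ∈ Ioc (0 : ℝ) 1 := ⟨by linarith [ht.2], by linarith [ht.1]⟩
  have htc : t ∈ Ioc (0 : ℝ) 1 := ⟨ht.1, ht.2.le⟩
  have hN' : N ≤ 0 ∨ 1 < N := hN.imp_right fun h => lt_of_lt_of_le (by norm_num) h
  rcases admissible_cases hN' with rfl | ⟨n, rfl, h⟩ | ⟨n, rfl, h⟩
  · set m := Real.exp (potInterp K ⊤ t d u₀ u₁) with hm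
    have hm0 : 0 < m := Real.exp_pos _
    have ht0 := ht'.1
    have ht1 := ht.1
    refine ⟨m * (1 - t) * Real.exp (-u₀), m * t * Real.exp (-u₁), ?_, ?_⟩
    · simp only [toDens_top]
      rw [mul_assoc, ← Real.exp_add, mul_assoc (m * t), ← Real.exp_add]
      simp [← hm]; ring
    · intro v₀ _ v₁ _
      simp only [toDens_top]
      rw [mul_assoc, ← Real.exp_add, mul_assoc (m * t), ← Real.exp_add]
      have e : potInterp K ⊤ t d v₀ v₁ =
          potInterp K ⊤ t d u₀ u₁ + ((1 - t) * (-u₀ + v₀) + t * (-u₁ + v₁)) := by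
        rw [potInterp_top, potInterp_top]; ring
      rw [e, Real.exp_add, ← hm, mul_assoc, mul_assoc, ← mul_add]
      gcongr
      exact convexOn_exp.2 (mem_univ _) (mem_univ _) ht0.le ht1.le (by ring)
  all_goals
    rw [delta_coe] at hr
    have s0 := sigma_pos ht' hd hr
    have s1 := sigma_pos htc hd hr
    simp only [potInterp_coe]
    set s₀ := sigma K (n - 1) (1 - t) d
    set s₁ := sigma K (n - 1) t d
  · have hn : 2 ≤ n := by
      rcases hN with hN | hN
      · have : n ≤ 0 := by exact_mod_cast hN
        linarith
      · rwa [← WithTop.coe_ofNat, WithTop.coe_le_coe] at hN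
    rw [mem_potDom_of_one_lt h] at hu₀ hu₁
    have hp : 1 ≤ n - 1 := by linarith
    set p := n - 1
    set S := s₀ * u₀ + s₁ * u₁ with hS
    have hS0 : 0 < S := by positivity
    refine ⟨S ^ p * (s₀ * u₀ / S) / u₀ ^ p, S ^ p * (s₁ * u₁ / S) / u₁ ^ p, ?_, ?_⟩
    · simp only [toDens_of_one_lt h]
      rw [max_eq_left hS0.le, max_eq_left hu₀.le, max_eq_left hu₁.le,
        div_mul_cancel₀ _ (by positivity), div_mul_cancel₀ _ (by positivity), ← mul_add, ← add_div,
        ← hS, div_self hS0.ne', mul_one]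
    · intro v₀ _ v₁ _
      simp only [toDens_of_one_lt h]
      -- the tangent inequality for nonnegative arguments follows by continuity
      have hmax : ∀ v₀ v₁ : ℝ, 0 ≤ v₀ → 0 ≤ v₁ → (s₀ * v₀ + s₁ * v₁) ^ p ≤
          S ^ p * (s₀ * u₀ / S) / u₀ ^ p * v₀ ^ p + S ^ p * (s₁ * u₁ / S) / u₁ ^ p * v₁ ^ p := by
        intro v₀ v₁ hv₀ hv₁
        have hp0 : 0 ≤ p := by linarith
        have c1 : Continuous fun ε : ℝ => (s₀ * (v₀ + ε) + s₁ * (v₁ + ε)) ^ p :=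
          Continuous.rpow_const (by fun_prop) fun _ => Or.inr hp0
        have c2 : Continuous fun ε : ℝ => S ^ p * (s₀ * u₀ / S) / u₀ ^ p * (v₀ + ε) ^ p +
            S ^ p * (s₁ * u₁ / S) / u₁ ^ p * (v₁ + ε) ^ p :=
          (continuous_const.mul (Continuous.rpow_const (by fun_prop) fun _ => Or.inr hp0)).add
            (continuous_const.mul (Continuous.rpow_const (by fun_prop) fun _ => Or.inr hp0))
        have h1 := (c1.tendsto 0).mono_left (nhdsWithin_le_nhds (s := Ioi 0))
        have h2 := (c2.tendsto 0).mono_left (nhdsWithin_le_nhds (s := Ioi 0))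
        have := le_of_tendsto_of_tendsto h1 h2 (by
          filter_upwards [self_mem_nhdsWithin] with ε hε
          have hε : 0 < ε := hε
          exact rpow_tangent (Or.inl hp) s0 s1 hu₀ hu₁ (by linarith) (by linarith))
        simpa using this
      refine le_trans ?_ (hmax _ _ (le_max_right v₀ 0) (le_max_right v₁ 0))
      refine Real.rpow_le_rpow (le_max_right _ _) (max_le ?_ (by positivity)) (by linarith)
      gcongr <;> exact le_max_left _ _
  · rw [mem_potDom_of_nonpos h] at hu₀ hu₁
    have hp : n - 1 < 0 := by linarith
    set p := n - 1
    have hu₀' : 0 < -u₀ := by linarith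
    have hu₁' : 0 < -u₁ := by linarith
    set S := s₀ * (-u₀) + s₁ * (-u₁) with hS
    have hS0 : 0 < S := by positivity
    refine ⟨S ^ p * (s₀ * (-u₀) / S) / (-u₀) ^ p, S ^ p * (s₁ * (-u₁) / S) / (-u₁) ^ p, ?_, ?_⟩
    · simp only [toDens_of_nonpos h]
      rw [div_mul_cancel₀ _ (by positivity), div_mul_cancel₀ _ (by positivity), ← mul_add,
        ← add_div, ← hS, div_self hS0.ne', mul_one]
      congr 1; rw [hS]; ring
    · intro v₀ hv₀ v₁ hv₁
      simp only [toDens_of_nonpos h]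
      rw [show -(s₀ * v₀ + s₁ * v₁) = s₀ * (-v₀) + s₁ * (-v₁) by ring]
      exact rpow_tangent (Or.inr hp) s0 s1 hu₀' hu₁' (by linarith) (by linarith)

lemma tau_mul_rpow {K n t θ r a : ℝ} (hn0 : n ≠ 0) (hn1 : n ≠ 1) (ht : 0 < t)
    (hs : 0 < sigma K (n - 1) t θ) (hr : 0 < r) (ha : 0 < a) :
    tau K n t θ * (r * a) ^ (1 / n) =
      sigma K (n - 1) t θ * a ^ (1 / (n - 1)) *
        (t * r / (sigma K (n - 1) t θ * a ^ (1 / (n - 1)))) ^ (1 / n) := by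
  unfold tau
  set s := sigma K (n - 1) t θ
  have hn1' : n - 1 ≠ 0 := sub_ne_zero.2 hn1
  have hα : 0 < s * a ^ (1 / (n - 1)) := by positivity
  rw [Real.div_rpow (by positivity) hα.le, mul_div_assoc', mul_comm (s * _) _, mul_div_assoc]
  rw [Real.mul_rpow ht.le hr.le, Real.mul_rpow hr.le ha.le]
  have e : s * a ^ (1 / (n - 1)) / (s * a ^ (1 / (n - 1))) ^ (1 / n) =
      s ^ (1 - 1 / n) * a ^ (1 / n) := by
    conv_lhs => rw [← Real.rpow_one (s * a ^ (1 / (n - 1))), ← Real.rpow_mul hα.le, one_mul]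
    rw [← Real.rpow_sub hα, Real.mul_rpow hs.le (by positivity), ← Real.rpow_mul ha.le]
    congr 2
    field_simp
  rw [e]; ring

lemma rmean_coe {K n t d a b : ℝ} (hN : (n : WithTop ℝ) ≤ 0 ∨ 1 < (n : WithTop ℝ))
    (ht : t ∈ Icc (0 : ℝ) 1) (hd : 0 ≤ d) (hr : K / (n - 1) * d ^ 2 < Real.pi ^ 2)
    (ha : 0 < a) (hb : 0 < b) :
    rmean K n t d a b = (sigma K (n - 1) (1 - t) d * a ^ (1 / (n - 1)) +
        sigma K (n - 1) t d * b ^ (1 / (n - 1))) ^ (n - 1) := by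
  have s0 := sigma_nonneg (one_sub_mem ht) hd hr
  have s1 := sigma_nonneg ht hd hr
  rcases hN with h | h
  · have h : n ≤ 0 := by exact_mod_cast h
    simp only [rmean, toDens_of_nonpos h, toPot_of_nonpos h, potInterp_coe]
    congr 1; ring
  · have h : 1 < n := by exact_mod_cast h
    simp only [rmean, toDens_of_one_lt h, toPot_of_one_lt h, potInterp_coe]
    rw [max_eq_left (by positivity)]

/-- Splitting masses as length times density, the mean of the masses is at most the interpolated
length times the mean of the densities. -/
lemma distMeanTilde_le {K : ℝ} {N : WithTop ℝ} (hN : N ≤ 0 ∨ 1 < N) {t θ r₀ r₁ a b : ℝ}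
    (ht : t ∈ Ioo (0 : ℝ) 1) (hθ : 0 ≤ θ) (hr : delta K N * θ ^ 2 < Real.pi ^ 2)
    (hr₀ : 0 < r₀) (hr₁ : 0 < r₁) (ha : 0 < a) (hb : 0 < b) :
    distMeanTilde K N t θ (r₀ * a) (r₁ * b) ≤
      ENNReal.ofReal (((1 - t) * r₀ + t * r₁) * rmean K N t θ a b) := by
  have ht' : 1 - t ∈ Ioc (0 : ℝ) 1 := ⟨by linarith [ht.2], by linarith [ht.1]⟩
  have htc : t ∈ Ioc (0 : ℝ) 1 := ⟨ht.1, ht.2.le⟩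
  have ht0 := ht'.1
  have ht1 := ht.1
  have ne : r₀ * a * (r₁ * b) ≠ 0 := by positivity
  induction N using WithTop.recTopCoe with
  | top =>
    rw [ENNReal.ofReal_mul (by positivity), ← distMean_eq hN (Ioo_subset_Icc_self ht) hθ hr ha hb]
    change (if r₀ * a * (r₁ * b) = 0 then 0 else ENNReal.ofReal _) ≤
      _ * (if a * b = 0 then 0 else ENNReal.ofReal _)
    rw [if_neg ne, if_neg (by positivity), ← ENNReal.ofReal_mul (by positivity)]
    apply ENNReal.ofReal_le_ofReal
    rw [Real.mul_rpow hr₀.le ha.le, Real.mul_rpow hr₁.le hb.le]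
    have := Real.geom_mean_le_arith_mean2_weighted ht0.le ht1.le hr₀.le hr₁.le (by ring)
    calc r₀ ^ (1 - t) * a ^ (1 - t) * (r₁ ^ t * b ^ t) * Real.exp (K * t * (1 - t) * θ ^ 2 / 2)
        = (r₀ ^ (1 - t) * r₁ ^ t) *
          (a ^ (1 - t) * b ^ t * Real.exp (K * t * (1 - t) * θ ^ 2 / 2)) := by ring
      _ ≤ _ := by gcongr
  | coe n =>
    rw [delta_coe] at hr
    have s0 := sigma_pos ht' hθ hr
    have s1 := sigma_pos htc hθ hr
    change (if r₀ * a * (r₁ * b) = 0 then 0 else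
      if Real.pi ^ 2 ≤ K / (n - 1) * θ ^ 2 then _ else _) ≤ _
    rw [if_neg ne, if_neg (not_le.2 hr)]
    have hα0 : 0 < sigma K (n - 1) (1 - t) θ * a ^ (1 / (n - 1)) := by positivity
    have hα1 : 0 < sigma K (n - 1) t θ * b ^ (1 / (n - 1)) := by positivity
    have hmean := rmean_coe hN (Ioo_subset_Icc_self ht) hθ hr ha hb
    rw [hmean]
    by_cases hn : n = 0
    · subst hn
      rw [if_pos rfl]
      apply ENNReal.ofReal_le_ofReal
      norm_num at hα0 hα1 s0 s1 ⊢
      simp only [Real.rpow_neg_one] at *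
      set s₀ := sigma K (-1) (1 - t) θ
      set s₁ := sigma K (-1) t θ
      set w := (1 - t) * r₀ + t * r₁ with hw
      by_contra! hc
      rw [← div_eq_mul_inv w, div_lt_iff₀ (by positivity),
        div_lt_iff₀ (by positivity)] at hc
      have e0 : (1 - t) * s₀⁻¹ * (r₀ * a) * (s₀ * a⁻¹ + s₁ * b⁻¹) =
        (1 - t) * r₀ * ((s₀ * a⁻¹ + s₁ * b⁻¹) / (s₀ * a⁻¹)) := by field_simp
      have e1 : t * s₁⁻¹ * (r₁ * b) * (s₀ * a⁻¹ + s₁ * b⁻¹) =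
        t * r₁ * ((s₀ * a⁻¹ + s₁ * b⁻¹) / (s₁ * b⁻¹)) := by field_simp
      rw [e0, e1, mul_div_assoc', mul_div_assoc', lt_div_iff₀ hα0, lt_div_iff₀ hα1] at hc
      nlinarith [hc.1, hc.2]
    · rw [if_neg hn]
      apply ENNReal.ofReal_le_ofReal
      have hn1 : n ≠ 1 := by
        rintro rfl
        rcases hN with h | h
        · exact absurd h (by norm_num)
        · exact absurd h (by norm_num)
      have hp : 1 ≤ n ∨ n < 0 := by
        rcases hN with h | h
        · exact Or.inr (lt_of_le_of_ne (by exact_mod_cast h) hn)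
        · exact Or.inl (le_of_lt (by exact_mod_cast h))
      rw [tau_mul_rpow hn hn1 ht0 s0 hr₀ ha, tau_mul_rpow hn hn1 ht1 s1 hr₁ hb]
      set α₀ := sigma K (n - 1) (1 - t) θ * a ^ (1 / (n - 1))
      set α₁ := sigma K (n - 1) t θ * b ^ (1 / (n - 1))
      have hS : 0 < α₀ + α₁ := by positivity
      have hx0 : 0 < (1 - t) * r₀ / α₀ := by positivity
      have hx1 : 0 < t * r₁ / α₁ := by positivity
      -- Jensen's inequality for the power `n` with weights proportional to `α₀` and `α₁`
      have hj := rpow_jensen hp (Real.rpow_pos_of_pos hx0 (1 / n)) (Real.rpow_pos_of_pos hx1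
        (1 / n))
        (div_nonneg hα0.le hS.le) (div_nonneg hα1.le hS.le) (by rw [← add_div, div_self hS.ne'])
      rw [← Real.rpow_mul hx0.le, ← Real.rpow_mul hx1.le, one_div_mul_cancel hn, Real.rpow_one,
        Real.rpow_one] at hj
      have e : α₀ * ((1 - t) * r₀ / α₀) ^ (1 / n) + α₁ * (t * r₁ / α₁) ^ (1 / n) =
        (α₀ + α₁) * (α₀ / (α₀ + α₁) * ((1 - t) * r₀ / α₀) ^ (1 / n) +
          α₁ / (α₀ + α₁) * (t * r₁ / α₁) ^ (1 / n)) := by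
        field_simp
      rw [e, Real.mul_rpow hS.le (by positivity)]
      refine (mul_le_mul_of_nonneg_left hj (by positivity)).trans (le_of_eq ?_)
      rw [Real.rpow_sub hS, Real.rpow_one]
      field_simp

/-- For balls whose radii are in the right proportion the comparison `distMeanTilde_le` is sharp;
the resulting lower bound is stable under enlarging the masses and moving the distance in the
favourable direction. -/
lemma exists_le_distMeanTilde {K : ℝ} {N : WithTop ℝ} (hN : N ≤ 0 ∨ 1 < N) {t θ c₀ c₁ : ℝ}
    (ht : t ∈ Ioo (0 : ℝ) 1) (hθ : 0 < θ) (hr : delta K N * θ ^ 2 < Real.pi ^ 2)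
    (hc₀ : 0 < c₀) (hc₁ : 0 < c₁) :
    ∃ ρ₀ > 0, ∃ ρ₁ > 0, ∀ ε > 0, ∀ A B θ' : ℝ, ε * ρ₀ * c₀ ≤ A → ε * ρ₁ * c₁ ≤ B → 0 < θ' →
      (0 ≤ K ∧ θ ≤ θ' ∨ K ≤ 0 ∧ θ' ≤ θ) →
      ENNReal.ofReal (ε * ((1 - t) * ρ₀ + t * ρ₁) * rmean K N t θ c₀ c₁) ≤
        distMeanTilde K N t θ' A B := by
  have ht' : 1 - t ∈ Ioc (0 : ℝ) 1 := ⟨by linarith [ht.2], by linarith [ht.1]⟩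
  have htc : t ∈ Ioc (0 : ℝ) 1 := ⟨ht.1, ht.2.le⟩
  have ht0 := ht'.1
  have ht1 := ht.1
  have hpi := Real.pi_pos
  induction N using WithTop.recTopCoe with
  | top =>
    refine ⟨1, one_pos, 1, one_pos, fun ε hε A B θ' hA hB hθ' hK => ?_⟩
    rw [mul_one] at hA hB
    have hA0 : 0 < A := lt_of_lt_of_le (by positivity) hA
    have hB0 : 0 < B := lt_of_lt_of_le (by positivity) hB
    rw [ENNReal.ofReal_mul (by positivity), ← distMean_eq hN (Ioo_subset_Icc_self ht)
      hθ.le hr hc₀ hc₁]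
    change _ * (if c₀ * c₁ = 0 then 0 else ENNReal.ofReal _) ≤
      (if A * B = 0 then 0 else ENNReal.ofReal _)
    rw [if_neg (by positivity), if_neg (by positivity), ← ENNReal.ofReal_mul (by positivity)]
    apply ENNReal.ofReal_le_ofReal
    have hK' : K * θ ^ 2 ≤ K * θ' ^ 2 := by
      rcases hK with ⟨hK, hxy⟩ | ⟨hK, hxy⟩
      · gcongr
      · exact mul_le_mul_of_nonpos_left (by gcongr) hK
    have hexp : K * t * (1 - t) * θ ^ 2 / 2 ≤ K * t * (1 - t) * θ' ^ 2 / 2 := by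
      have := mul_pos ht1 ht0
      nlinarith
    calc ε * ((1 - t) * 1 + t * 1) *
          (c₀ ^ (1 - t) * c₁ ^ t * Real.exp (K * t * (1 - t) * θ ^ 2 / 2))
        = (ε ^ (1 - t) * ε ^ t) * (c₀ ^ (1 - t) * c₁ ^ t *
          Real.exp (K * t * (1 - t) * θ ^ 2 / 2)) := by
          rw [← Real.rpow_add hε]; norm_num
      _ = (ε * c₀) ^ (1 - t) * (ε * c₁) ^ t * Real.exp (K * t * (1 - t) * θ ^ 2 / 2) := by
          rw [Real.mul_rpow hε.le hc₀.le, Real.mul_rpow hε.le hc₁.le]; ring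
      _ ≤ _ := by gcongr
  | coe n =>
    have hr0 := hr
    rw [delta_coe] at hr
    have s0 := sigma_pos ht' hθ.le hr
    have s1 := sigma_pos htc hθ.le hr
    have hα0 : 0 < sigma K (n - 1) (1 - t) θ * c₀ ^ (1 / (n - 1)) := by positivity
    have hα1 : 0 < sigma K (n - 1) t θ * c₁ ^ (1 / (n - 1)) := by positivity
    rw [rmean_coe hN (Ioo_subset_Icc_self ht) hθ.le hr hc₀ hc₁]
    -- the radii for which Jensen's inequality in `distMeanTilde_le` is an equality
    refine ⟨(sigma K (n - 1) (1 - t) θ * c₀ ^ (1 / (n - 1))) / (1 - t), div_pos hα0 ht0,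
      (sigma K (n - 1) t θ * c₁ ^ (1 / (n - 1))) / t, div_pos hα1 ht1,
      fun ε hε A B θ' hA hB hθ' hK => ?_⟩
    have hρ0 := div_pos hα0 ht0
    have hρ1 := div_pos hα1 ht1
    have hA0 : 0 < A := lt_of_lt_of_le (by positivity) hA
    have hB0 : 0 < B := lt_of_lt_of_le (by positivity) hB
    rcases le_or_gt (Real.pi ^ 2) (delta K n * θ' ^ 2) with h1 | hr'
    · rw [distMeanTilde_out_of_range h1 hA0 hB0]
      rcases hK with ⟨hK, hle⟩ | ⟨hK, hle⟩
      · rcases hK.eq_or_lt with rfl | hK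
        · rw [delta_coe, zero_div, zero_mul] at h1
          have : 0 < Real.pi ^ 2 := by positivity
          linarith
        · rw [if_pos hK]; exact le_top
      · exact absurd (delta_range_mono hθ'.le hle hr0) (not_lt.2 h1)
    rw [mul_div_cancel₀ _ ht0.ne', mul_div_cancel₀ _ ht1.ne']
    rw [delta_coe] at hr'
    have ne : A * B ≠ 0 := by positivity
    have s0' := sigma_pos ht' hθ'.le hr'
    have s1' := sigma_pos htc hθ'.le hr'
    change _ ≤ (if A * B = 0 then 0 else
      if Real.pi ^ 2 ≤ K / (n - 1) * θ' ^ 2 then _ else _)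
    rw [if_neg ne, if_neg (not_le.2 hr')]
    have hsig : n ≤ 0 → ∀ s ∈ Icc (0 : ℝ) 1, sigma K (n - 1) s θ' ≤ sigma K (n - 1) s θ := by
      intro hn s hs
      have h0 : n - 1 ≤ 0 := by linarith
      rcases hK with ⟨hK, hxy⟩ | ⟨hK, hxy⟩
      · exact sigma_ge_sigma (div_nonpos_of_nonneg_of_nonpos hK h0) hs hθ.le hxy hr'
      · exact sigma_le_sigma (div_nonneg_of_nonpos hK h0) hs hθ'.le hxy hr
    have hsig' : 1 < n → ∀ s ∈ Icc (0 : ℝ) 1, sigma K (n - 1) s θ ≤ sigma K (n - 1) s θ' := by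
      intro hn s hs
      have h0 : 0 ≤ n - 1 := by linarith
      rcases hK with ⟨hK, hxy⟩ | ⟨hK, hxy⟩
      · exact sigma_le_sigma (div_nonneg hK h0) hs hθ.le hxy hr'
      · exact sigma_ge_sigma (div_nonpos_of_nonpos_of_nonneg hK h0) hs hθ'.le hxy hr
    have hts := Ioc_subset_Icc_self htc
    have hts' := Ioc_subset_Icc_self ht'
    by_cases hn : n = 0
    · subst hn
      rw [if_pos rfl]
      apply ENNReal.ofReal_le_ofReal
      have q0 := hsig le_rfl _ hts'
      have q1 := hsig le_rfl _ hts
      norm_num at hα0 hα1 s0 s1 s0' s1' hA hB q0 q1 ⊢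
      simp only [Real.rpow_neg_one] at *
      have hSpos := add_pos hα0 hα1
      rw [mul_assoc, mul_inv_cancel₀ hSpos.ne', mul_one]
      constructor
      · refine le_trans (le_of_eq ?_) (mul_le_mul (mul_le_mul_of_nonneg_left
          (inv_anti₀ s0' q0) ht0.le) hA (by positivity) (by positivity))
        field_simp
      · refine le_trans (le_of_eq ?_) (mul_le_mul (mul_le_mul_of_nonneg_left
          (inv_anti₀ s1' q1) ht1.le) hB (by positivity) (by positivity))
        field_simp
    · rw [if_neg hn]
      apply ENNReal.ofReal_le_ofReal
      have hn1 : n ≠ 1 := by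
        rintro rfl
        rcases hN with h | h
        · exact absurd h (by norm_num)
        · exact absurd h (by norm_num)
      -- the terms at the sharp ratio of radii are `α_i ε ^ (1 / n)`
      have key : ∀ s c : ℝ, 0 < s → 0 < c → 0 < sigma K (n - 1) s θ →
          tau K n s θ * (ε * (sigma K (n - 1) s θ * c ^ (1 / (n - 1)) / s) * c) ^ (1 / n) =
            sigma K (n - 1) s θ * c ^ (1 / (n - 1)) * ε ^ (1 / n) := by
        intro s c hs hc hσ
        have hα : 0 < sigma K (n - 1) s θ * c ^ (1 / (n - 1)) := by positivity
        rw [tau_mul_rpow hn hn1 hs hσ (by positivity) hc]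
        congr 2
        field_simp
      have e : ε * (sigma K (n - 1) (1 - t) θ * c₀ ^ (1 / (n - 1)) +
          sigma K (n - 1) t θ * c₁ ^ (1 / (n - 1))) *
          (sigma K (n - 1) (1 - t) θ * c₀ ^ (1 / (n - 1)) +
          sigma K (n - 1) t θ * c₁ ^ (1 / (n - 1))) ^ (n - 1) =
          (tau K n (1 - t) θ * (ε * (sigma K (n - 1) (1 - t) θ * c₀ ^ (1 / (n - 1)) / (1 - t)) * c₀)
            ^ (1 / n) +
          tau K n t θ * (ε * (sigma K (n - 1) t θ * c₁ ^ (1 / (n - 1)) / t) * c₁) ^ (1 / n)) ^ n :=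
            by
        rw [key _ _ ht0 hc₀ s0, key _ _ ht1 hc₁ s1, ← add_mul,
          Real.mul_rpow (by positivity) (by positivity), ← Real.rpow_mul hε.le,
          one_div_mul_cancel hn, Real.rpow_one, Real.rpow_sub (by positivity), Real.rpow_one]
        have := add_pos hα0 hα1
        field_simp
      rw [e]
      have tpos : ∀ s θ : ℝ, 0 < s → 0 < sigma K (n - 1) s θ → 0 < tau K n s θ := by
        intro s θ h1 h2
        unfold tau; positivity
      have T0 := tpos _ _ ht0 s0
      have T1 := tpos _ _ ht1 s1
      have T0' := tpos _ _ ht0 s0'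
      have T1' := tpos _ _ ht1 s1'
      rcases lt_or_gt_of_ne hn1 with h | h
      · have hn0 : n < 0 := by
          rcases hN with hN | hN
          · exact lt_of_le_of_ne (by exact_mod_cast hN) hn
          · have : 1 < n := by exact_mod_cast hN
            linarith
        have hinv : 1 / n < 0 := one_div_neg.2 hn0
        have hle : ∀ s ∈ Ioc (0 : ℝ) 1, 0 < sigma K (n - 1) s θ' → tau K n s θ' ≤ tau K n s θ := by
          intro s hs hp
          unfold tau
          exact mul_le_mul_of_nonneg_left (Real.rpow_le_rpow hp.le
            (hsig hn0.le s (Ioc_subset_Icc_self hs)) (by linarith)) (Real.rpow_nonneg hs.1.le _)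
        refine Real.rpow_le_rpow_of_nonpos (by positivity) (add_le_add ?_ ?_) hn0.le
        · exact mul_le_mul (hle _ ht' s0') (Real.rpow_le_rpow_of_nonpos (by positivity) hA hinv.le)
            (by positivity) T0.le
        · exact mul_le_mul (hle _ htc s1') (Real.rpow_le_rpow_of_nonpos (by positivity) hB hinv.le)
            (by positivity) T1.le
      · have hinv : 0 < 1 / n := one_div_pos.2 (by linarith)
        have h1n : 0 ≤ 1 - 1 / n := by
          rw [sub_nonneg, div_le_one (by linarith)]; exact h.le
        have hle : ∀ s ∈ Ioc (0 : ℝ) 1, 0 < sigma K (n - 1) s θ → tau K n s θ ≤ tau K n s θ' := by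
          intro s hs hp
          unfold tau
          exact mul_le_mul_of_nonneg_left (Real.rpow_le_rpow hp.le
            (hsig' h s (Ioc_subset_Icc_self hs)) h1n) (Real.rpow_nonneg hs.1.le _)
        refine Real.rpow_le_rpow (by positivity) (add_le_add ?_ ?_) (by linarith)
        · exact mul_le_mul (hle _ ht' s0) (Real.rpow_le_rpow (by positivity) hA hinv.le)
            (by positivity) T0'.le
        · exact mul_le_mul (hle _ htc s1) (Real.rpow_le_rpow (by positivity) hB hinv.le)
            (by positivity) T1'.le

lemma distMeanTilde_zero_le {K : ℝ} {N : WithTop ℝ} {θ a b : ℝ} (hθ : 0 ≤ θ)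
    (hr : delta K N * θ ^ 2 < Real.pi ^ 2) (ha : 0 < a) (hb : 0 < b) :
    distMeanTilde K N 0 θ a b ≤ ENNReal.ofReal a := by
  have ne : a * b ≠ 0 := by positivity
  induction N using WithTop.recTopCoe with
  | top =>
    change (if a * b = 0 then 0 else ENNReal.ofReal _) ≤ _
    rw [if_neg ne]
    apply ENNReal.ofReal_le_ofReal
    simp
  | coe n =>
    rw [delta_coe] at hr
    change (if a * b = 0 then 0 else if Real.pi ^ 2 ≤ K / (n - 1) * θ ^ 2 then _ else _) ≤ _
    rw [if_neg ne, if_neg (not_le.2 hr)]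
    by_cases hn : n = 0
    · subst hn
      rw [if_pos rfl]
      exact ENNReal.ofReal_le_ofReal ((min_le_right _ _).trans (by simpa using ha.le))
    · rw [if_neg hn]
      apply ENNReal.ofReal_le_ofReal
      simp only [tau, sub_zero, sigma_one_left hθ hr, Real.one_rpow, one_mul]
      rw [Real.zero_rpow (one_div_ne_zero hn), zero_mul, zero_mul, add_zero, ← Real.rpow_mul ha.le,
        one_div_mul_cancel hn, Real.rpow_one]

lemma distMeanTilde_swap (K : ℝ) (N : WithTop ℝ) (t θ a b : ℝ) :
    distMeanTilde K N (1 - t) θ a b = distMeanTilde K N t θ b a := by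
  have hc : a * b = b * a := mul_comm a b
  induction N using WithTop.recTopCoe with
  | top =>
    change (if a * b = 0 then 0 else ENNReal.ofReal _) = (if b * a = 0 then 0 else ENNReal.ofReal _)
    rw [hc, sub_sub_cancel]
    congr 3
    · ring
    · congr 1; ring
  | coe n =>
    change (if a * b = 0 then 0 else if Real.pi ^ 2 ≤ K / (n - 1) * θ ^ 2 then _ else _) =
      (if b * a = 0 then 0 else if Real.pi ^ 2 ≤ K / (n - 1) * θ ^ 2 then _ else _)
    simp only [hc, sub_sub_cancel]
    rw [min_comm, add_comm]

/-! ### Concave densities -/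

/-- The measure on `ℝ` with density `J`. -/
noncomputable def densMeasure (J : ℝ → ℝ) : Measure ℝ :=
  volume.withDensity fun x => ENNReal.ofReal (J x)

/-- `J` is positive exactly on the interval `(a, b)`, whose length is at most `l_δ`, and satisfies
there the pointwise form of the synthetic inequality. -/
structure IsConcaveDensity (K : ℝ) (N : WithTop ℝ) (J : ℝ → ℝ) (a b : ℝ) : Prop where
  lt : a < b
  aemeasurable : AEMeasurable J
  pos : ∀ x ∈ Ioo a b, 0 < J x
  eq_zero : ∀ x ∉ Ioo a b, J x = 0
  range : delta K N * (b - a) ^ 2 ≤ Real.pi ^ 2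
  rmean_le : ∀ x ∈ Ioo a b, ∀ y ∈ Ioo a b, ∀ t ∈ Icc (0 : ℝ) 1,
    rmean K N t |y - x| (J x) (J y) ≤ J ((1 - t) * x + t * y)

lemma interp_mem_Ioo {a b x y t : ℝ} (hx : x ∈ Ioo a b) (hy : y ∈ Ioo a b)
    (ht : t ∈ Icc (0 : ℝ) 1) : (1 - t) * x + t * y ∈ Ioo a b :=
  convex_Ioo a b hx hy (one_sub_mem ht).1 ht.1 (by ring)

lemma range_lt_of_mem {δ a b x y : ℝ} (h : δ * (b - a) ^ 2 ≤ Real.pi ^ 2) (hx : x ∈ Ioo a b)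
    (hy : y ∈ Ioo a b) : δ * |y - x| ^ 2 < Real.pi ^ 2 := by
  have hpi : 0 < Real.pi ^ 2 := by have := Real.pi_pos; positivity
  rcases le_or_gt δ 0 with h0 | h0
  · exact lt_of_le_of_lt (mul_nonpos_of_nonpos_of_nonneg h0 (sq_nonneg _)) hpi
  · refine lt_of_lt_of_le ?_ h
    have : |y - x| < b - a := abs_lt.2 ⟨by linarith [hx.2, hy.1], by linarith [hx.1, hy.2]⟩
    gcongr

namespace IsConcaveDensity

variable {K : ℝ} {N : WithTop ℝ} {J : ℝ → ℝ} {a b : ℝ}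

lemma nonneg (h : IsConcaveDensity K N J a b) (x : ℝ) : 0 ≤ J x := by
  by_cases hx : x ∈ Ioo a b
  · exact (h.pos x hx).le
  · exact (h.eq_zero x hx).ge

lemma mem_of_pos (h : IsConcaveDensity K N J a b) {x : ℝ} (hx : 0 < J x) : x ∈ Ioo a b := by
  by_contra hc
  exact hx.ne' (h.eq_zero x hc)

lemma range_lt (h : IsConcaveDensity K N J a b) {x y : ℝ} (hx : x ∈ Ioo a b) (hy : y ∈ Ioo a b) :
    delta K N * |y - x| ^ 2 < Real.pi ^ 2 :=
  range_lt_of_mem h.range hx hy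

lemma smul (hN : N ≤ 0 ∨ 1 < N) (h : IsConcaveDensity K N J a b) {c : ℝ} (hc : 0 < c) :
    IsConcaveDensity K N (fun x => c * J x) a b where
  lt := h.lt
  aemeasurable := h.aemeasurable.const_mul c
  pos x hx := mul_pos hc (h.pos x hx)
  eq_zero x hx := by rw [h.eq_zero x hx, mul_zero]
  range := h.range
  rmean_le x hx y hy t ht := by
    rw [rmean_smul hN ht (abs_nonneg _) (h.range_lt hx hy) (h.pos x hx) (h.pos y hy) hc]
    exact mul_le_mul_of_nonneg_left (h.rmean_le x hx y hy t ht) hc.le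

lemma densMeasure_eq_zero_iff (h : IsConcaveDensity K N J a b) (s : Set ℝ) :
    densMeasure J s = 0 ↔ volume (s ∩ Ioo a b) = 0 := by
  unfold densMeasure
  rw [withDensity_apply_eq_zero' h.aemeasurable.ennreal_ofReal]
  have : {x | ENNReal.ofReal (J x) ≠ 0} = Ioo a b := by
    ext x
    simp only [ne_eq, ENNReal.ofReal_eq_zero, not_le, mem_ofPred_eq]
    exact ⟨h.mem_of_pos, h.pos x⟩
  rw [this, inter_comm]

lemma support_eq (h : IsConcaveDensity K N J a b) : (densMeasure J).support = Icc a b := by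
  apply Subset.antisymm
  · refine Measure.support_subset_of_isClosed isClosed_Icc ?_
    rw [mem_ae_iff, h.densMeasure_eq_zero_iff]
    have : (Icc a b)ᶜ ∩ Ioo a b = ∅ :=
      (disjoint_compl_left_iff_subset.2 Ioo_subset_Icc_self).inter_eq
    rw [this, measure_empty]
  · rw [← closure_Ioo h.lt.ne]
    refine closure_minimal ?_ Measure.isClosed_support
    intro x hx
    rw [Measure.support_eq_forall_isOpen]
    intro u hxu hu
    rw [pos_iff_ne_zero, Ne, h.densMeasure_eq_zero_iff]
    exact ((hu.inter isOpen_Ioo).measure_pos volume ⟨x, hxu, hx⟩).ne'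

lemma ne_zero (h : IsConcaveDensity K N J a b) : densMeasure J ≠ 0 := by
  intro h0
  have := h.support_eq
  rw [h0, Measure.support_zero] at this
  exact (nonempty_Icc.2 h.lt.le).ne_empty this.symm

end IsConcaveDensity

/-- Restricting to the interior of the positivity set turns a density satisfying the concavity
inequality into a concave density. -/
lemma exists_isConcaveDensity {K : ℝ} {N : WithTop ℝ} {J : ℝ → ℝ} {α β : ℝ}
    (hJ : AEMeasurable J) (h0 : ∀ x, 0 ≤ J x) (hsub : ∀ x, 0 < J x → x ∈ Icc α β)
    (hord : OrdConnected {x | 0 < J x})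
    (hrange : ∀ x y, 0 < J x → 0 < J y → delta K N * (y - x) ^ 2 ≤ Real.pi ^ 2)
    (hle : ∀ x y, 0 < J x → 0 < J y → delta K N * |y - x| ^ 2 < Real.pi ^ 2 →
      ∀ t ∈ Icc (0 : ℝ) 1, rmean K N t |y - x| (J x) (J y) ≤ J ((1 - t) * x + t * y))
    (hne : densMeasure J ≠ 0) :
    ∃ J' a b, IsConcaveDensity K N J' a b ∧ J' =ᵐ[volume] J ∧ (∀ x ∈ Ioo a b, J' x = J x) ∧
      Icc a b ⊆ Icc α β := by
  set P := {x | 0 < J x} with hP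
  have hvol : volume P ≠ 0 := by
    intro hz
    apply hne
    unfold densMeasure
    rw [withDensity_eq_zero_iff hJ.ennreal_ofReal]
    have : ∀ᵐ x, x ∉ P := measure_eq_zero_iff_ae_notMem.1 hz
    filter_upwards [this] with x hx
    simpa [P] using hx
  have hPne : P.Nonempty := nonempty_of_measure_ne_zero hvol
  have hbb : BddBelow P := ⟨α, fun x hx => (hsub x hx).1⟩
  have hba : BddAbove P := ⟨β, fun x hx => (hsub x hx).2⟩
  set a := sInf P
  set b := sSup P
  have hPsub : P ⊆ Icc a b := fun x hx => ⟨csInf_le hbb hx, le_csSup hba hx⟩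
  have hab : a < b := by
    by_contra! hc
    exact hvol (measure_mono_null hPsub (by simp [hc]))
  have hIP : Ioo a b ⊆ P := by
    intro x hx
    obtain ⟨y, hy, hyx⟩ := exists_lt_of_csInf_lt hPne hx.1
    obtain ⟨z, hz, hxz⟩ := exists_lt_of_lt_csSup hPne hx.2
    exact hord.out hy hz ⟨hyx.le, hxz.le⟩
  have hae : (Ioo a b).indicator J =ᵐ[volume] J := by
    filter_upwards [Measure.ae_ne volume a, Measure.ae_ne volume b] with x hxa hxb
    by_cases hxI : x ∈ Ioo a b
    · rw [indicator_of_mem hxI]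
    · rw [indicator_of_notMem hxI]
      refine le_antisymm (h0 x) ?_
      by_contra! hc
      have := hPsub hc
      exact hxI ⟨lt_of_le_of_ne this.1 hxa.symm, lt_of_le_of_ne this.2 hxb⟩
  have hrange' : delta K N * (b - a) ^ 2 ≤ Real.pi ^ 2 := by
    have hc : Continuous fun ε : ℝ => delta K N * (b - ε - (a + ε)) ^ 2 := by fun_prop
    have h1 := (hc.tendsto 0).mono_left (nhdsWithin_le_nhds (s := Ioi 0))
    refine le_of_tendsto (by simpa using h1) ?_
    filter_upwards [Ioo_mem_nhdsGT (show (0 : ℝ) < b - a by linarith)] with ε hε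
    exact hrange _ _ (hIP ⟨by linarith [hε.1], by linarith [hε.2]⟩)
      (hIP ⟨by linarith [hε.2], by linarith [hε.1]⟩)
  refine ⟨(Ioo a b).indicator J, a, b, ⟨hab, hJ.indicator measurableSet_Ioo, ?_, ?_, hrange', ?_⟩,
    hae, fun x hx => indicator_of_mem hx J, ?_⟩
  · intro x hx
    rw [indicator_of_mem hx]; exact hIP hx
  · intro x hx
    rw [indicator_of_notMem hx]
  · intro x hx y hy t ht
    rw [indicator_of_mem hx, indicator_of_mem hy, indicator_of_mem (interp_mem_Ioo hx hy ht)]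
    exact hle x y (hIP hx) (hIP hy) (range_lt_of_mem hrange' hx hy) t ht
  · exact Icc_subset_Icc (le_csInf hPne fun x hx => (hsub x hx).1)
      (csSup_le hPne fun x hx => (hsub x hx).2)

/-! ### Concave densities define synthetic measures -/

/-- The quantile function of a measure with density `J`, restricted to a compact set `A`. -/
lemma exists_quantile {J : ℝ → ℝ} (hJ : Integrable J) (h0 : ∀ x, 0 ≤ J x) {A : Set ℝ}
    (hA : IsCompact A) {c : ℝ} (hc : 0 < c) (hcA : ∫ x in A, J x = c) :
    ∃ q : ℝ → ℝ, (∀ s ∈ Ioo (0 : ℝ) 1, q s ∈ A) ∧ StrictMonoOn q (Ioo 0 1) ∧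
      ∀ᵐ s ∂(volume.restrict (Ioo (0 : ℝ) 1)), ∃ q', HasDerivAt q q' s ∧ q' * J (q s) = c := by
  set f := A.indicator J with hf
  have hfi : Integrable f := hJ.indicator hA.measurableSet
  have hf0 : ∀ x, 0 ≤ f x := fun x => indicator_nonneg (fun y _ => h0 y) x
  have hfc : ∫ x, f x = c := by rw [hf, integral_indicator hA.measurableSet, hcA]
  set F : ℝ → ℝ := fun x => ∫ y in Iic x, f y with hF
  have hFsub : ∀ x y, F y - F x = ∫ z in x..y, f z := fun x y =>
    intervalIntegral.integral_Iic_sub_Iic hfi.integrableOn hfi.integrableOn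
  have hFeq : F = fun x => F 0 + ∫ z in (0 : ℝ)..x, f z := by
    funext x; linarith [hFsub 0 x]
  have hFcont : Continuous F := by
    rw [hFeq]
    exact continuous_const.add (intervalIntegral.continuous_primitive
      (fun a b => hfi.intervalIntegrable) 0)
  have hFmono : Monotone F := fun x y hxy => by
    have : 0 ≤ ∫ z in x..y, f z := intervalIntegral.integral_nonneg hxy fun z _ => hf0 z
    linarith [hFsub x y]
  have hFderiv : ∀ᵐ x, HasDerivAt F (f x) x := by
    filter_upwards [LocallyIntegrable.ae_hasDerivAt_integral hfi.locallyIntegrable] with x hx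
    rw [hFeq]
    exact (hx 0).const_add (F 0)
  obtain ⟨m, hm⟩ := hA.bddBelow
  obtain ⟨M, hM⟩ := hA.bddAbove
  have hFm : ∀ x < m, F x = 0 := fun x hx => by
    refine setIntegral_eq_zero_of_forall_eq_zero fun y hy => ?_
    refine indicator_of_notMem (fun hyA => ?_) J
    have h1 := hm hyA
    have h2 : y ≤ x := hy
    linarith
  have hFM : F M = c := by
    rw [← hfc, hF]
    refine setIntegral_eq_integral_of_forall_compl_eq_zero fun y hy => ?_
    exact indicator_of_notMem (fun hyA => hy (hM hyA)) J
  have hFle : ∀ x, F x ≤ c := fun x => by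
    rw [← hfc]
    exact setIntegral_le_integral hfi (ae_of_all _ hf0)
  have hF0 : ∀ x, 0 ≤ F x := fun x => integral_nonneg hf0
  set S : ℝ → Set ℝ := fun s => {x | c * s ≤ F x} with hS
  set q : ℝ → ℝ := fun s => sInf (S s) with hq
  have hSne : ∀ s ∈ Ioo (0 : ℝ) 1, (S s).Nonempty := fun s hs => ⟨M, by
    simp only [hS, mem_ofPred_eq, hFM]; nlinarith [hs.2]⟩
  have hSbdd : ∀ s ∈ Ioo (0 : ℝ) 1, BddBelow (S s) := fun s hs => ⟨m, fun x hx => by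
    by_contra! hc'
    have h1 : c * s ≤ F x := hx
    rw [hFm x hc'] at h1
    have := mul_pos hc hs.1
    linarith⟩
  have hSclosed : ∀ s, IsClosed (S s) := fun s => isClosed_le continuous_const hFcont
  have hqmem : ∀ s ∈ Ioo (0 : ℝ) 1, c * s ≤ F (q s) := fun s hs =>
    (hSclosed s).csInf_mem (hSne s hs) (hSbdd s hs)
  have hlt : ∀ s ∈ Ioo (0 : ℝ) 1, ∀ x < q s, F x < c * s := fun s hs x hx => by
    by_contra! hc'
    exact absurd (csInf_le (hSbdd s hs) hc') (not_le.2 hx)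
  have hFq : ∀ s ∈ Ioo (0 : ℝ) 1, F (q s) = c * s := fun s hs => by
    refine le_antisymm ?_ (hqmem s hs)
    refine le_of_tendsto ((hFcont.tendsto (q s)).mono_left (nhdsWithin_le_nhds (s := Iio (q s)))) ?_
    filter_upwards [self_mem_nhdsWithin] with x hx
    exact (hlt s hs x hx).le
  have hqle : ∀ s ∈ Ioo (0 : ℝ) 1, ∀ x, q s ≤ x ↔ c * s ≤ F x := fun s hs x =>
    ⟨fun h => (hqmem s hs).trans (hFmono h), fun h => csInf_le (hSbdd s hs) h⟩
  have hqA : ∀ s ∈ Ioo (0 : ℝ) 1, q s ∈ A := fun s hs => by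
    by_contra hqA
    obtain ⟨ε, hε, hball⟩ := Metric.isOpen_iff.1 hA.isClosed.isOpen_compl (q s) hqA
    have h1 : ∫ z in (q s - ε / 2)..(q s), f z = 0 := by
      rw [intervalIntegral.integral_of_le (by linarith)]
      refine setIntegral_eq_zero_of_forall_eq_zero fun y hy => ?_
      refine indicator_of_notMem (hball ?_) J
      rw [Metric.mem_ball, Real.dist_eq, abs_lt]
      constructor <;> linarith [hy.1, hy.2]
    have h2 := hFsub (q s - ε / 2) (q s)
    have h3 := hlt s hs (q s - ε / 2) (by linarith)
    have h4 := hqmem s hs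
    linarith
  have hqmono : StrictMonoOn q (Ioo 0 1) := fun s hs s' hs' hss => by
    by_contra! hle
    have h1 := hFmono hle
    rw [hFq s hs, hFq s' hs'] at h1
    nlinarith
  refine ⟨q, hqA, hqmono, ?_⟩
  have hqae : AEMeasurable q (volume.restrict (Ioo (0 : ℝ) 1)) :=
    aemeasurable_restrict_of_monotoneOn measurableSet_Ioo hqmono.monotoneOn
  -- the law of the quantile function is the normalized measure on `A`
  have hmap : (volume.restrict (Ioo (0 : ℝ) 1)).map q =
      ENNReal.ofReal c⁻¹ • volume.withDensity (fun x => ENNReal.ofReal (f x)) := by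
    have : IsFiniteMeasure (volume.withDensity fun x => ENNReal.ofReal (f x)) :=
      isFiniteMeasure_withDensity_ofReal hfi.2
    have : IsFiniteMeasure ((volume.restrict (Ioo (0 : ℝ) 1)).map q) :=
      Measure.isFiniteMeasure_map _ _
    refine Measure.ext_of_Iic _ _ fun x => ?_
    rw [Measure.map_apply_of_aemeasurable hqae measurableSet_Iic, Measure.smul_apply,
      withDensity_apply _ measurableSet_Iic, ← ofReal_integral_eq_lintegral_ofReal hfi.integrableOn
      (ae_of_all _ hf0), smul_eq_mul, ← ENNReal.ofReal_mul (by positivity)]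
    rw [Measure.restrict_apply₀' measurableSet_Ioo.nullMeasurableSet]
    change volume (q ⁻¹' Iic x ∩ Ioo 0 1) = ENNReal.ofReal (c⁻¹ * F x)
    have hy1 : c⁻¹ * F x ≤ 1 := by
      rw [inv_mul_le_iff₀ hc, mul_one]; exact hFle x
    have hset : q ⁻¹' Iic x ∩ Ioo 0 1 = Iic (c⁻¹ * F x) ∩ Ioo 0 1 := by
      ext s
      constructor
      · rintro ⟨h1, h2⟩
        exact ⟨(le_inv_mul_iff₀ hc).2 ((hqle s h2 x).1 h1), h2⟩
      · rintro ⟨h1, h2⟩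
        exact ⟨(hqle s h2 x).2 ((le_inv_mul_iff₀ hc).1 h1), h2⟩
    rw [hset]
    apply le_antisymm
    · refine (measure_mono (t := Ioc 0 (c⁻¹ * F x)) fun s hs => ⟨hs.2.1, hs.1⟩).trans ?_
      simp
    · refine le_trans ?_ (measure_mono (s := Ioo 0 (c⁻¹ * F x)) fun s hs =>
        ⟨hs.2.le, hs.1, hs.2.trans_le hy1⟩)
      simp
  have hac : (volume.restrict (Ioo (0 : ℝ) 1)).map q ≪ volume := by
    rw [hmap]
    exact (withDensity_absolutelyContinuous _ _).smul_left _
  have h1 : ∀ᵐ s ∂(volume.restrict (Ioo (0 : ℝ) 1)), HasDerivAt F (f (q s)) (q s) :=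
    ae_of_ae_map hqae (hac.ae_le hFderiv)
  have h2 : ∀ᵐ s ∂(volume.restrict (Ioo (0 : ℝ) 1)), DifferentiableAt ℝ q s := by
    rw [ae_restrict_iff' measurableSet_Ioo]
    filter_upwards [hqmono.monotoneOn.ae_differentiableWithinAt_of_mem] with s hs hmem
    exact (hs hmem).differentiableAt (isOpen_Ioo.mem_nhds hmem)
  filter_upwards [h1, h2, ae_restrict_mem measurableSet_Ioo] with s hs1 hs2 hmem
  refine ⟨deriv q s, hs2.hasDerivAt, ?_⟩
  have h3 : HasDerivAt (F ∘ q) (f (q s) * deriv q s) s := hs1.comp s hs2.hasDerivAt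
  have h4 : HasDerivAt (F ∘ q) c s := by
    have : HasDerivAt (fun s : ℝ => c * s) c s := by simpa using (hasDerivAt_id s).const_mul c
    refine this.congr_of_eventuallyEq ?_
    filter_upwards [isOpen_Ioo.mem_nhds hmem] with s hs
    exact hFq s hs
  have h5 := h3.unique h4
  rw [hf, indicator_of_mem (hqA s hmem)] at h5
  linarith

lemma bddAbove_dist_image {A₀ A₁ : Set ℝ} (h₀ : IsCompact A₀) (h₁ : IsCompact A₁) :
    BddAbove (image2 (fun x y => |x - y|) A₀ A₁) := by
  rw [← image_prod]
  exact ((h₀.prod h₁).image (by fun_prop)).bddAbove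

lemma theta_nonneg (K : ℝ) (A₀ A₁ : Set ℝ) : 0 ≤ theta K A₀ A₁ := by
  have : ∀ z ∈ image2 (fun x y : ℝ => |x - y|) A₀ A₁, 0 ≤ z := by
    rintro _ ⟨x, _, y, _, rfl⟩
    exact abs_nonneg _
  unfold theta
  split_ifs
  · exact Real.sInf_nonneg this
  · exact Real.sSup_nonneg this

lemma theta_le {K : ℝ} (hK : 0 ≤ K) {A₀ A₁ : Set ℝ} {x y : ℝ} (hx : x ∈ A₀) (hy : y ∈ A₁) :
    theta K A₀ A₁ ≤ |y - x| := by
  rw [theta, if_pos hK, abs_sub_comm]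
  refine csInf_le ⟨0, ?_⟩ (mem_image2_of_mem hx hy)
  rintro _ ⟨x, _, y, _, rfl⟩
  exact abs_nonneg _

lemma le_theta {K : ℝ} (hK : K < 0) {A₀ A₁ : Set ℝ} (h₀ : IsCompact A₀) (h₁ : IsCompact A₁)
    {x y : ℝ} (hx : x ∈ A₀) (hy : y ∈ A₁) : |y - x| ≤ theta K A₀ A₁ := by
  rw [theta, if_neg (not_le.2 hK), abs_sub_comm]
  exact le_csSup (bddAbove_dist_image h₀ h₁) (mem_image2_of_mem hx hy)

lemma distMeanTilde_of_mul_eq_zero {K : ℝ} {N : WithTop ℝ} {t θ a b : ℝ} (h : a * b = 0) :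
    distMeanTilde K N t θ a b = 0 := by
  simp [distMeanTilde, h]

namespace IsConcaveDensity

variable {K : ℝ} {N : WithTop ℝ} {J : ℝ → ℝ} {a b : ℝ}

lemma real_densMeasure (h : IsConcaveDensity K N J a b) (s : Set ℝ)
    (hs : MeasurableSet s) : (densMeasure J).real s = ∫ x in s, J x := by
  rw [measureReal_def, densMeasure, withDensity_apply _ hs,
    integral_eq_lintegral_of_nonneg_ae (ae_of_all _ h.nonneg)
      h.aemeasurable.aestronglyMeasurable.restrict]

/-- Brunn–Minkowski inequality for concave densities: the quantile functions of the measure on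
`A₀` and `A₁` parametrize a part of `(1 - t) A₀ + t A₁`, and in this parametrization the
inequality holds pointwise under the integral. -/
lemma le_interp (hN : N ≤ 0 ∨ 1 < N) (h : IsConcaveDensity K N J a b) (hi : Integrable J)
    {A₀ A₁ : Set ℝ} (h₀ : IsCompact A₀) (h₁ : IsCompact A₁) {t : ℝ} (ht : t ∈ Ioo (0 : ℝ) 1)
    (hr : delta K N * theta K A₀ A₁ ^ 2 < Real.pi ^ 2)
    (hp₀ : 0 < (densMeasure J).real A₀) (hp₁ : 0 < (densMeasure J).real A₁) :
    distMeanTilde K N t (theta K A₀ A₁) ((densMeasure J).real A₀) ((densMeasure J).real A₁) ≤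
      densMeasure J (interp t A₀ A₁) := by
  have hr₀ := h.real_densMeasure A₀ h₀.measurableSet
  have hr₁ := h.real_densMeasure A₁ h₁.measurableSet
  set c₀ := (densMeasure J).real A₀
  set c₁ := (densMeasure J).real A₁
  set C := distMeanTilde K N t (theta K A₀ A₁) c₀ c₁ with hC
  obtain ⟨q₀, hqA₀, hqm₀, hqd₀⟩ := exists_quantile hi h.nonneg h₀ hp₀ hr₀.symm
  obtain ⟨q₁, hqA₁, hqm₁, hqd₁⟩ := exists_quantile hi h.nonneg h₁ hp₁ hr₁.symm
  obtain ⟨S, hSae, hSm, hS⟩ := ((hqd₀.and hqd₁).and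
    (ae_restrict_mem measurableSet_Ioo)).exists_measurable_mem
  have ht0 : 0 < 1 - t := by linarith [ht.2]
  have ht1 := ht.1
  set z : ℝ → ℝ := fun s => (1 - t) * q₀ s + t * q₁ s with hz
  have hzmono : StrictMonoOn z (Ioo 0 1) := fun s hs s' hs' hss => by
    have e0 := hqm₀ hs hs' hss
    have e1 := hqm₁ hs hs' hss
    simp only [hz]
    gcongr
  have hder : ∀ s ∈ S, ∃ z', HasDerivAt z z' s ∧
      C ≤ ENNReal.ofReal |z'| * ENNReal.ofReal (J (z s)) := by
    intro s hs
    obtain ⟨⟨⟨r₀, hd₀, he₀⟩, ⟨r₁, hd₁, he₁⟩⟩, hmem⟩ := hS s hs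
    refine ⟨(1 - t) * r₀ + t * r₁, (hd₀.const_mul (1 - t)).add (hd₁.const_mul t), ?_⟩
    have hJ₀ : 0 < J (q₀ s) := (h.nonneg _).lt_of_ne fun h0 => by
      rw [← h0, mul_zero] at he₀; exact hp₀.ne he₀
    have hJ₁ : 0 < J (q₁ s) := (h.nonneg _).lt_of_ne fun h0 => by
      rw [← h0, mul_zero] at he₁; exact hp₁.ne he₁
    have hr₀ : 0 < r₀ := pos_of_mul_pos_left (he₀ ▸ hp₀) hJ₀.le
    have hr₁ : 0 < r₁ := pos_of_mul_pos_left (he₁ ▸ hp₁) hJ₁.le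
    have hm₀ := h.mem_of_pos hJ₀
    have hm₁ := h.mem_of_pos hJ₁
    have htc := Ioo_subset_Icc_self ht
    have hdir : 0 ≤ K ∧ theta K A₀ A₁ ≤ |q₁ s - q₀ s| ∨ K ≤ 0 ∧ |q₁ s - q₀ s| ≤ theta K A₀ A₁ := by
      rcases le_or_gt 0 K with hK | hK
      · exact Or.inl ⟨hK, theta_le hK (hqA₀ s hmem) (hqA₁ s hmem)⟩
      · exact Or.inr ⟨hK.le, le_theta hK h₀ h₁ (hqA₀ s hmem) (hqA₁ s hmem)⟩
    rw [abs_of_pos (by positivity), ← ENNReal.ofReal_mul (by positivity), hC, ← he₀, ← he₁]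
    refine (distMeanTilde_le hN ht (theta_nonneg K A₀ A₁) hr hr₀ hr₁ hJ₀ hJ₁).trans ?_
    refine ENNReal.ofReal_le_ofReal (mul_le_mul_of_nonneg_left ?_ (by positivity))
    exact (rmean_dist_mono hN htc (theta_nonneg K A₀ A₁) (abs_nonneg _) hdir hr
      (h.range_lt hm₀ hm₁) hJ₀ hJ₁).trans (h.rmean_le _ hm₀ _ hm₁ t htc)
  choose! z' hz' hCz using hder
  have hSsub : S ⊆ Ioo 0 1 := fun s hs => (hS s hs).2
  have hvolS : volume S = 1 := by
    apply le_antisymm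
    · exact (measure_mono hSsub).trans (by simp)
    · have h1 : (volume.restrict (Ioo (0 : ℝ) 1)) Sᶜ = 0 := hSae
      rw [Measure.restrict_apply hSm.compl] at h1
      have h2 := measure_le_inter_add_sdiff volume (Ioo (0 : ℝ) 1) S
      rw [Real.volume_Ioo, sdiff_eq, inter_comm _ Sᶜ, h1, add_zero, sub_zero,
        ENNReal.ofReal_one] at h2
      exact h2.trans (measure_mono inter_subset_right)
  have himg : z '' S ⊆ interp t A₀ A₁ := by
    rintro _ ⟨s, hs, rfl⟩
    exact mem_image2_of_mem (hqA₀ s (hSsub hs)) (hqA₁ s (hSsub hs))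
  calc C = ∫⁻ _ in S, C := by rw [setLIntegral_const, hvolS, mul_one]
    _ ≤ ∫⁻ s in S, ENNReal.ofReal |z' s| * ENNReal.ofReal (J (z s)) :=
        setLIntegral_mono' hSm hCz
    _ = ∫⁻ x in z '' S, ENNReal.ofReal (J x) :=
        (lintegral_image_eq_lintegral_abs_deriv_mul hSm
          (fun s hs => (hz' s hs).hasDerivWithinAt) ((hzmono.mono hSsub).injOn)
          (fun x => ENNReal.ofReal (J x))).symm
    _ ≤ densMeasure J (z '' S) := withDensity_apply_le _ _
    _ ≤ densMeasure J (interp t A₀ A₁) := measure_mono himg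

lemma isFiniteMeasure (hi : Integrable J) : IsFiniteMeasure (densMeasure J) :=
  isFiniteMeasure_withDensity_ofReal hi.2

theorem isSynthetic (hN : N ≤ 0 ∨ 1 < N) (h : IsConcaveDensity K N J a b) (hi : Integrable J)
    {D : ℝ≥0∞} {I : Set ℝ} (hI : Icc a b ⊆ I) (hD : ENNReal.ofReal (b - a) ≤ D) :
    IsSynthetic K N D I (densMeasure J) where
  finite := isFiniteMeasure hi
  support_subset := h.support_eq ▸ hI
  diam_le := by rwa [h.support_eq, Real.ediam_Icc]
  distorted A₀ A₁ h₀ h₁ t ht := by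
    have := isFiniteMeasure hi
    rcases (measureReal_nonneg (μ := densMeasure J) (s := A₀)).eq_or_lt with e₀ | hp₀
    · rw [distMeanTilde_of_mul_eq_zero (by rw [← e₀, zero_mul])]; exact zero_le
    rcases (measureReal_nonneg (μ := densMeasure J) (s := A₁)).eq_or_lt with e₁ | hp₁
    · rw [distMeanTilde_of_mul_eq_zero (by rw [← e₁, mul_zero])]; exact zero_le
    have hex : ∀ A, IsCompact A → 0 < (densMeasure J).real A → ∃ x ∈ A, x ∈ Ioo a b := by
      intro A hA hp
      have h1 : densMeasure J A ≠ 0 := fun h0 => by simp [measureReal_def, h0] at hp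
      rw [Ne, h.densMeasure_eq_zero_iff] at h1
      obtain ⟨x, hx⟩ := nonempty_of_measure_ne_zero h1
      exact ⟨x, hx⟩
    obtain ⟨x, hxA, hx⟩ := hex A₀ h₀ hp₀
    obtain ⟨y, hyA, hy⟩ := hex A₁ h₁ hp₁
    rcases le_or_gt (Real.pi ^ 2) (delta K N * theta K A₀ A₁ ^ 2) with hr | hr
    · rw [distMeanTilde_out_of_range hr hp₀ hp₁]
      split_ifs with hK
      · exact absurd (delta_range_mono (theta_nonneg K A₀ A₁) (theta_le hK.le hxA hyA)
          (h.range_lt hx hy)) (not_lt.2 hr)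
      · exact zero_le
    rcases ht.1.eq_or_lt with rfl | h0
    · refine (distMeanTilde_zero_le (theta_nonneg K A₀ A₁) hr hp₀ hp₁).trans ?_
      rw [ofReal_measureReal]
      exact measure_mono fun w hw => ⟨w, hw, y, hyA, by simp⟩
    rcases ht.2.eq_or_lt with rfl | h1
    · rw [← sub_zero (1 : ℝ), distMeanTilde_swap]
      refine (distMeanTilde_zero_le (theta_nonneg K A₀ A₁) hr hp₁ hp₀).trans ?_
      rw [ofReal_measureReal]
      exact measure_mono fun w hw => ⟨x, hxA, w, hw, by simp⟩
    exact h.le_interp hN hi h₀ h₁ ⟨h0, h1⟩ hr hp₀ hp₁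

end IsConcaveDensity

/-! ### Synthetic measures are Dirac masses or have concave densities -/

/-- The lower symmetric derivative of a measure with respect to Lebesgue measure. It is defined at
every point, so that the synthetic inequality passes to it without exceptional sets. -/
noncomputable def lowerDens (ξ : Measure ℝ) (x : ℝ) : ℝ≥0∞ :=
  liminf (fun r => ξ (Metric.closedBall x r) / volume (Metric.closedBall x r)) (𝓝[>] 0)

lemma mem_support_of_lowerDens_pos {ξ : Measure ℝ} {x : ℝ} (h : 0 < lowerDens ξ x) :
    x ∈ ξ.support := by
  by_contra hx
  obtain ⟨U, hU, hU0⟩ := Measure.notMem_support_iff_exists.1 hx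
  obtain ⟨ε, hε, hball⟩ := Metric.mem_nhds_iff.1 hU
  have h1 := eventually_lt_of_lt_liminf h
  obtain ⟨r, hr, hr'⟩ := (h1.and (Ioo_mem_nhdsGT hε)).exists
  have : ξ (Metric.closedBall x r) = 0 :=
    measure_mono_null ((Metric.closedBall_subset_ball hr'.2).trans hball) hU0
  rw [this, ENNReal.zero_div] at hr
  exact lt_irrefl _ hr

lemma eventually_le_real_closedBall {ξ : Measure ℝ} [IsFiniteMeasure ξ] {x c : ℝ}
    (h : ENNReal.ofReal c < lowerDens ξ x) :
    ∀ᶠ r in 𝓝[>] 0, 2 * r * c ≤ ξ.real (Metric.closedBall x r) := by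
  filter_upwards [eventually_lt_of_lt_liminf h, self_mem_nhdsWithin] with r hr hr0
  have hr0 : 0 < r := hr0
  rw [Real.volume_closedBall] at hr
  have h2 := hr.le
  rw [ENNReal.le_div_iff_mul_le (Or.inl (by simpa using hr0)) (Or.inl ENNReal.ofReal_ne_top),
    mul_comm, ← ENNReal.ofReal_mul (by positivity)] at h2
  exact (ENNReal.ofReal_le_iff_le_toReal (measure_ne_top _ _)).1 h2

lemma interp_closedBall_subset {x y t r₀ r₁ : ℝ} (ht : t ∈ Icc (0 : ℝ) 1) :
    interp t (Metric.closedBall x r₀) (Metric.closedBall y r₁) ⊆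
      Metric.closedBall ((1 - t) * x + t * y) ((1 - t) * r₀ + t * r₁) := by
  rintro _ ⟨u, hu, v, hv, rfl⟩
  rw [Metric.mem_closedBall, Real.dist_eq, abs_le] at *
  have h0 := (one_sub_mem ht).1
  have h1 := ht.1
  constructor <;> nlinarith [hu.1, hu.2, hv.1, hv.2]

lemma le_theta_closedBall {K : ℝ} (hK : 0 ≤ K) {x y r₀ r₁ : ℝ} (hr₀ : 0 ≤ r₀) (hr₁ : 0 ≤ r₁) :
    |y - x| - (r₀ + r₁) ≤ theta K (Metric.closedBall x r₀) (Metric.closedBall y r₁) := by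
  rw [theta, if_pos hK]
  refine le_csInf ⟨_, mem_image2_of_mem (Metric.mem_closedBall_self hr₀)
    (Metric.mem_closedBall_self hr₁)⟩ ?_
  rintro _ ⟨u, hu, v, hv, rfl⟩
  rw [Metric.mem_closedBall, Real.dist_eq] at hu hv
  have e : y - x = -(u - v) + (u - x) - (v - y) := by ring
  have h1 : |y - x| ≤ |u - v| + |u - x| + |v - y| := by
    rw [e]
    exact (abs_sub _ _).trans (add_le_add_left ((abs_add_le _ _).trans (by rw [abs_neg])) _)
  linarith

lemma theta_closedBall_le {K : ℝ} (hK : K < 0) {x y r₀ r₁ : ℝ} (hr₀ : 0 ≤ r₀) (hr₁ : 0 ≤ r₁) :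
    theta K (Metric.closedBall x r₀) (Metric.closedBall y r₁) ≤ |y - x| + (r₀ + r₁) := by
  rw [theta, if_neg (not_le.2 hK)]
  refine csSup_le ⟨_, mem_image2_of_mem (Metric.mem_closedBall_self hr₀)
    (Metric.mem_closedBall_self hr₁)⟩ ?_
  rintro _ ⟨u, hu, v, hv, rfl⟩
  rw [Metric.mem_closedBall, Real.dist_eq] at hu hv
  have e : u - v = -(y - x) + (u - x) - (v - y) := by ring
  have h1 : |u - v| ≤ |y - x| + |u - x| + |v - y| := by
    rw [e]
    exact (abs_sub _ _).trans (add_le_add_left ((abs_add_le _ _).trans (by rw [abs_neg])) _)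
  linarith

section

variable {K : ℝ} {N : WithTop ℝ} {D : ℝ≥0∞} {I : Set ℝ} {ξ : Measure ℝ}

/-- The synthetic inequality on small balls of the right proportion gives the pointwise inequality
for the lower densities, at distances slightly on the favourable side. -/
lemma IsSynthetic.le_lowerDens (hN : N ≤ 0 ∨ 1 < N) (h : IsSynthetic K N D I ξ)
    {x y c₀ c₁ t θ : ℝ} (hc₀ : 0 < c₀) (hc₁ : 0 < c₁) (hx : ENNReal.ofReal c₀ < lowerDens ξ x)
    (hy : ENNReal.ofReal c₁ < lowerDens ξ y) (ht : t ∈ Ioo (0 : ℝ) 1) (hxy : x ≠ y) (hθ : 0 < θ)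
    (hr : delta K N * θ ^ 2 < Real.pi ^ 2) (hd : 0 ≤ K ∧ θ < |y - x| ∨ K < 0 ∧ |y - x| < θ) :
    ENNReal.ofReal (rmean K N t θ c₀ c₁) ≤ lowerDens ξ ((1 - t) * x + t * y) := by
  have := h.finite
  have htc := Ioo_subset_Icc_self ht
  obtain ⟨ρ₀, hρ₀, ρ₁, hρ₁, hρ⟩ := exists_le_distMeanTilde hN ht hθ hr hc₀ hc₁
  have ht0 : 0 < 1 - t := by linarith [ht.2]
  have ht1 := ht.1
  have hdpos : 0 < |y - x| := abs_pos.2 (sub_ne_zero.2 hxy.symm)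
  set ρ := (1 - t) * ρ₀ + t * ρ₁ with hρdef
  have hρpos : 0 < ρ := by positivity
  have hscale : ∀ κ : ℝ, 0 < κ → Tendsto (fun R : ℝ => R / ρ * κ) (𝓝[>] 0) (𝓝[>] 0) := by
    intro κ hκ
    refine tendsto_nhdsWithin_iff.2 ⟨?_, ?_⟩
    · have : Continuous fun R : ℝ => R / ρ * κ := by fun_prop
      simpa using (this.tendsto 0).mono_left (nhdsWithin_le_nhds (s := Ioi 0))
    · filter_upwards [self_mem_nhdsWithin] with R hR
      have : 0 < R := hR
      exact mem_Ioi.2 (by positivity)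
  have hgap : ∀ᶠ R in 𝓝[>] (0 : ℝ), R / ρ * (ρ₀ + ρ₁) < |(|y - x| - θ)| := by
    have h1 := (hscale (ρ₀ + ρ₁) (by positivity)).mono_right nhdsWithin_le_nhds
    refine h1.eventually (gt_mem_nhds (abs_pos.2 (sub_ne_zero.2 ?_)))
    rcases hd with hd | hd
    · exact hd.2.ne'
    · exact hd.2.ne
  unfold lowerDens
  refine le_liminf_of_le (by isBoundedDefault) ?_
  filter_upwards [(hscale ρ₀ hρ₀).eventually (eventually_le_real_closedBall hx),
    (hscale ρ₁ hρ₁).eventually (eventually_le_real_closedBall hy), hgap, self_mem_nhdsWithin]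
    with R h0 h1 h2 hR
  have hR : 0 < R := hR
  set r₀ := R / ρ * ρ₀ with hr₀
  set r₁ := R / ρ * ρ₁ with hr₁
  have hr₀p : 0 < r₀ := by positivity
  have hr₁p : 0 < r₁ := by positivity
  have hsum : R / ρ * (ρ₀ + ρ₁) = r₀ + r₁ := by rw [hr₀, hr₁]; ring
  rw [hsum] at h2
  have hrt : (1 - t) * r₀ + t * r₁ = R := by
    have : (1 - t) * r₀ + t * r₁ = R / ρ * ρ := by rw [hr₀, hr₁, hρdef]; ring
    rw [this, div_mul_cancel₀ _ hρpos.ne']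
  have hside : 0 < theta K (Metric.closedBall x r₀) (Metric.closedBall y r₁) ∧
      (0 ≤ K ∧ θ ≤ theta K (Metric.closedBall x r₀) (Metric.closedBall y r₁) ∨
        K ≤ 0 ∧ theta K (Metric.closedBall x r₀) (Metric.closedBall y r₁) ≤ θ) := by
    rcases hd with ⟨hK, hd⟩ | ⟨hK, hd⟩
    · rw [abs_of_pos (by linarith)] at h2
      have := le_theta_closedBall hK (x := x) (y := y) hr₀p.le hr₁p.le
      exact ⟨by linarith, Or.inl ⟨hK, by linarith⟩⟩
    · rw [abs_of_neg (by linarith)] at h2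
      have := theta_closedBall_le hK (x := x) (y := y) hr₀p.le hr₁p.le
      have h5 := le_theta hK (isCompact_closedBall x r₀) (isCompact_closedBall y r₁)
        (Metric.mem_closedBall_self hr₀p.le) (Metric.mem_closedBall_self hr₁p.le)
      exact ⟨by linarith, Or.inr ⟨hK.le, by linarith⟩⟩
  -- a ball of radius `r` has length `2 * r`, whence the factor `2`
  have key := (hρ (2 * (R / ρ)) (by positivity) _ _ _ (by rw [mul_assoc 2]; exact h0)
    (by rw [mul_assoc 2]; exact h1) hside.1 hside.2).trans
    (h.distorted _ _ (isCompact_closedBall x r₀) (isCompact_closedBall y r₁) t htc)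
  have key2 := key.trans (measure_mono (interp_closedBall_subset htc))
  rw [hrt, mul_assoc 2, div_mul_cancel₀ _ hρpos.ne'] at key2
  rw [Real.volume_closedBall, ENNReal.le_div_iff_mul_le (Or.inl (by simpa using hR))
    (Or.inl ENNReal.ofReal_ne_top), mul_comm, ← ENNReal.ofReal_mul (by positivity)]
  exact key2

lemma delta_mul_sq_lt_of_edist {δ x y : ℝ} (hδ : 0 < δ)
    (h : ENNReal.ofReal |y - x| < ENNReal.ofReal (Real.pi / √δ)) :
    δ * (y - x) ^ 2 < Real.pi ^ 2 := by
  have hs := Real.sqrt_pos.2 hδ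
  have h1 := (ENNReal.ofReal_lt_ofReal_iff (div_pos Real.pi_pos hs)).1 h
  rw [lt_div_iff₀ hs] at h1
  have h2 : (|y - x| * √δ) ^ 2 < Real.pi ^ 2 :=
    pow_lt_pow_left₀ h1 (by positivity) two_ne_zero
  rw [mul_pow, Real.sq_sqrt hδ.le, sq_abs] at h2
  linarith

lemma IsSynthetic.range_of_neg (h : IsSynthetic K N D I ξ)
    (hD : 0 < delta K N → K < 0 → D < ell K N) (hK : K < 0) {x y : ℝ} (hx : x ∈ ξ.support)
    (hy : y ∈ ξ.support) : delta K N * (y - x) ^ 2 < Real.pi ^ 2 := by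
  rcases le_or_gt (delta K N) 0 with h0 | h0
  · have : 0 < Real.pi ^ 2 := by have := Real.pi_pos; positivity
    exact lt_of_le_of_lt (mul_nonpos_of_nonpos_of_nonneg h0 (sq_nonneg _)) this
  · have h1 := hD h0 hK
    rw [ell, if_pos h0] at h1
    refine delta_mul_sq_lt_of_edist h0 (lt_of_le_of_lt ?_ (h.diam_le.trans_lt h1))
    rw [← Real.dist_eq, ← edist_dist]
    exact Metric.edist_le_ediam_of_mem hy hx

/-- The support has diameter at most `l_δ`: for `K > 0` the synthetic inequality would otherwise
force infinite mass, and for `K < 0` this follows from the bound on `D`. -/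
lemma IsSynthetic.range (h : IsSynthetic K N D I ξ)
    (hD : 0 < delta K N → K < 0 → D < ell K N) {x y : ℝ} (hx : x ∈ ξ.support)
    (hy : y ∈ ξ.support) : delta K N * (y - x) ^ 2 ≤ Real.pi ^ 2 := by
  have := h.finite
  rcases lt_trichotomy K 0 with hK | hK | hK
  · exact (h.range_of_neg hD hK hx hy).le
  · have : delta K N = 0 := by
      induction N using WithTop.recTopCoe with
      | top => rfl
      | coe n => rw [delta_coe, hK, zero_div]
    rw [this, zero_mul]; positivity
  · by_contra! hc
    have hδ : 0 < delta K N := by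
      by_contra! h0
      have := mul_nonpos_of_nonpos_of_nonneg h0 (sq_nonneg (y - x))
      have : 0 ≤ Real.pi ^ 2 := by positivity
      linarith
    have hs := Real.sqrt_pos.2 hδ
    set l := Real.pi / √(delta K N) with hl
    have hl2 : delta K N * l ^ 2 = Real.pi ^ 2 := by
      rw [hl, div_pow, Real.sq_sqrt hδ.le]; field_simp
    have hl0 : 0 < l := div_pos Real.pi_pos hs
    have hlt : l < |y - x| := by
      refine lt_of_pow_lt_pow_left₀ 2 (abs_nonneg _) ?_
      rw [sq_abs]
      exact lt_of_mul_lt_mul_left (hl2.trans_lt hc) hδ.le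
    set r := (|y - x| - l) / 2 with hr
    have hr0 : 0 < r := by rw [hr]; linarith
    have hpos : ∀ z ∈ ξ.support, 0 < ξ.real (Metric.closedBall z r) := fun z hz =>
      ENNReal.toReal_pos ((Measure.mem_support_iff_forall z).1 hz _
        (Metric.closedBall_mem_nhds z hr0)).ne' (measure_ne_top _ _)
    have h1 := h.distorted _ _ (isCompact_closedBall x r) (isCompact_closedBall y r) (1 / 2)
      ⟨by norm_num, by norm_num⟩
    have h2 := le_theta_closedBall hK.le (x := x) (y := y) hr0.le hr0.le
    rw [distMeanTilde_out_of_range _ (hpos x hx) (hpos y hy), if_pos hK] at h1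
    · exact measure_ne_top _ _ (top_le_iff.1 h1)
    · rw [← hl2]
      have : l ≤ theta K (Metric.closedBall x r) (Metric.closedBall y r) := by
        rw [hr] at h2 ⊢; linarith
      gcongr

/-- There is a distance on the favourable side of `|y - x|` at which the pointwise inequality
applies. -/
lemma IsSynthetic.exists_dist (h : IsSynthetic K N D I ξ)
    (hD : 0 < delta K N → K < 0 → D < ell K N) {x y : ℝ} (hx : x ∈ ξ.support)
    (hy : y ∈ ξ.support) (hxy : x ≠ y) :
    ∃ θ > 0, delta K N * θ ^ 2 < Real.pi ^ 2 ∧ (0 ≤ K ∧ θ < |y - x| ∨ K < 0 ∧ |y - x| < θ) := by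
  have hdpos : 0 < |y - x| := abs_pos.2 (sub_ne_zero.2 hxy.symm)
  rcases le_or_gt 0 K with hK | hK
  · refine ⟨|y - x| / 2, by positivity, ?_, Or.inl ⟨hK, by linarith⟩⟩
    have := h.range hD hx hy
    have hpi : 0 < Real.pi ^ 2 := by have := Real.pi_pos; positivity
    rw [div_pow, sq_abs]
    linarith
  · have h1 := h.range_of_neg hD hK hx hy
    rw [← sq_abs] at h1
    have hc : ContinuousAt (fun θ : ℝ => delta K N * θ ^ 2) |y - x| := by fun_prop
    have h2 := (hc.eventually (gt_mem_nhds h1)).filter_mono (nhdsWithin_le_nhds (s := Ioi |y - x|))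
    obtain ⟨θ, hθ, hθ'⟩ := (h2.and self_mem_nhdsWithin).exists
    have hθ' : |y - x| < θ := hθ'
    exact ⟨θ, hdpos.trans hθ', hθ, Or.inr ⟨hK, hθ'⟩⟩

lemma exists_ofReal_lt {a : ℝ≥0∞} (h : 0 < a) : ∃ c : ℝ, 0 < c ∧ ENNReal.ofReal c < a := by
  obtain ⟨c, hc0, hc⟩ := ENNReal.lt_iff_exists_nnreal_btwn.1 h
  exact ⟨c, by exact_mod_cast hc0, by rwa [ENNReal.ofReal_coe_nnreal]⟩

lemma IsSynthetic.lowerDens_pos (hN : N ≤ 0 ∨ 1 < N) (h : IsSynthetic K N D I ξ)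
    (hD : 0 < delta K N → K < 0 → D < ell K N) {x y t : ℝ} (hx : 0 < lowerDens ξ x)
    (hy : 0 < lowerDens ξ y) (ht : t ∈ Icc (0 : ℝ) 1) :
    0 < lowerDens ξ ((1 - t) * x + t * y) := by
  rcases eq_or_ne x y with rfl | hxy
  · rwa [← add_mul, sub_add_cancel, one_mul]
  rcases ht.1.eq_or_lt with rfl | h0
  · simpa using hx
  rcases ht.2.eq_or_lt with rfl | h1
  · simpa using hy
  obtain ⟨θ, hθ, hr, hd⟩ := h.exists_dist hD (mem_support_of_lowerDens_pos hx)
    (mem_support_of_lowerDens_pos hy) hxy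
  obtain ⟨c₀, hc₀, hx'⟩ := exists_ofReal_lt hx
  obtain ⟨c₁, hc₁, hy'⟩ := exists_ofReal_lt hy
  exact lt_of_lt_of_le (ENNReal.ofReal_pos.2 (rmean_pos hN ht hθ.le hr hc₀ hc₁))
    (h.le_lowerDens hN hc₀ hc₁ hx' hy' ⟨h0, h1⟩ hxy hθ hr hd)

lemma IsSynthetic.rmean_le_lowerDens (hN : N ≤ 0 ∨ 1 < N) (h : IsSynthetic K N D I ξ)
    {x y t : ℝ} (hx : 0 < lowerDens ξ x) (hx' : lowerDens ξ x ≠ ⊤)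
    (hy : 0 < lowerDens ξ y) (hy' : lowerDens ξ y ≠ ⊤) (ht : t ∈ Ioo (0 : ℝ) 1) (hxy : x ≠ y)
    (hr : delta K N * |y - x| ^ 2 < Real.pi ^ 2) :
    ENNReal.ofReal (rmean K N t |y - x| (lowerDens ξ x).toReal (lowerDens ξ y).toReal) ≤
      lowerDens ξ ((1 - t) * x + t * y) := by
  have htc := Ioo_subset_Icc_self ht
  have hdpos : 0 < |y - x| := abs_pos.2 (sub_ne_zero.2 hxy.symm)
  set a := (lowerDens ξ x).toReal with ha
  set b := (lowerDens ξ y).toReal with hb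
  have ha0 : 0 < a := ENNReal.toReal_pos hx.ne' hx'
  have hb0 : 0 < b := ENNReal.toReal_pos hy.ne' hy'
  have hcont := continuousAt_rmean hN htc hdpos hr ha0 hb0
  -- scaling both densities by `c < 1` allows to apply the strict version
  have step : ∀ c ∈ Ioo (0 : ℝ) 1, ENNReal.ofReal (c * rmean K N t |y - x| a b) ≤
      lowerDens ξ ((1 - t) * x + t * y) := by
    intro c hc
    have hlt : ∀ z, z ≠ ⊤ → 0 < z.toReal → ENNReal.ofReal (c * z.toReal) < z := by
      intro z hz hz0
      conv_rhs => rw [← ENNReal.ofReal_toReal hz]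
      rw [ENNReal.ofReal_lt_ofReal_iff hz0]
      nlinarith [hc.2]
    have main : ∀ θ > 0, delta K N * θ ^ 2 < Real.pi ^ 2 →
        (0 ≤ K ∧ θ < |y - x| ∨ K < 0 ∧ |y - x| < θ) →
        ENNReal.ofReal (c * rmean K N t θ a b) ≤ lowerDens ξ ((1 - t) * x + t * y) := by
      intro θ hθ hθr hd
      rw [← rmean_smul hN htc hθ.le hθr ha0 hb0 hc.1]
      exact h.le_lowerDens hN (mul_pos hc.1 ha0) (mul_pos hc.1 hb0) (hlt _ hx' ha0)
        (hlt _ hy' hb0) ht hxy hθ hθr hd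
    have hcont' : ContinuousAt (fun θ => ENNReal.ofReal (c * rmean K N t θ a b)) |y - x| :=
      ENNReal.continuous_ofReal.continuousAt.comp (hcont.const_mul c)
    have hrange : ∀ᶠ θ in 𝓝 |y - x|, 0 < θ ∧ delta K N * θ ^ 2 < Real.pi ^ 2 := by
      have hc : ContinuousAt (fun θ : ℝ => delta K N * θ ^ 2) |y - x| := by fun_prop
      exact (lt_mem_nhds hdpos).and (hc.eventually (gt_mem_nhds hr))
    rcases le_or_gt 0 K with hK | hK
    · refine le_of_tendsto (hcont'.tendsto.mono_left (nhdsWithin_le_nhds (s := Iio |y - x|))) ?_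
      filter_upwards [hrange.filter_mono nhdsWithin_le_nhds, self_mem_nhdsWithin] with θ h1 h2
      exact main θ h1.1 h1.2 (Or.inl ⟨hK, h2⟩)
    · refine le_of_tendsto (hcont'.tendsto.mono_left (nhdsWithin_le_nhds (s := Ioi |y - x|))) ?_
      filter_upwards [hrange.filter_mono nhdsWithin_le_nhds, self_mem_nhdsWithin] with θ h1 h2
      exact main θ h1.1 h1.2 (Or.inr ⟨hK, h2⟩)
  have hcc : Continuous fun c : ℝ => ENNReal.ofReal (c * rmean K N t |y - x| a b) :=
    ENNReal.continuous_ofReal.comp (by fun_prop)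
  have hlim := (hcc.tendsto 1).mono_left (nhdsWithin_le_nhds (s := Iio 1))
  rw [one_mul] at hlim
  refine le_of_tendsto hlim ?_
  filter_upwards [Ioo_mem_nhdsLT (show (0 : ℝ) < 1 by norm_num)] with c hc
  exact step c hc

/-- If the first density value is large, then the mean at time `t` is at least of order `1 / t`. -/
lemma exists_div_le_rmean (hN : N ≤ 0 ∨ 1 < N) {θ c₁ : ℝ} (hθ : 0 < θ)
    (hr : delta K N * θ ^ 2 < Real.pi ^ 2) (hc₁ : 0 < c₁) :
    ∃ κ > 0, ∃ t₀ ∈ Ioo (0 : ℝ) 1, ∀ t ∈ Ioc 0 t₀, ∃ c₀ > 0, κ / t ≤ rmean K N t θ c₀ c₁ := by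
  rcases admissible_cases hN with rfl | ⟨n, rfl, h⟩ | ⟨n, rfl, h⟩
  · refine ⟨1, one_pos, 1 / 2, ⟨by norm_num, by norm_num⟩, fun t ht => ?_⟩
    have ht1 : 0 < 1 - t := by linarith [ht.2]
    refine ⟨Real.exp ((Real.log (1 / t) - t * Real.log c₁ - K * t * (1 - t) * θ ^ 2 / 2) / (1 - t)),
      Real.exp_pos _, ?_⟩
    have ht0 := ht.1
    rw [rmean, toDens_top, potInterp_top, toPot_top, toPot_top, Real.log_exp,
      mul_div_cancel₀ _ ht1.ne']
    ring_nf
    rw [Real.exp_log (by positivity)]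
  · rw [delta_coe] at hr
    refine ⟨1, one_pos, 1 / 2, ⟨by norm_num, by norm_num⟩, fun t ht => ?_⟩
    have ht0 := ht.1
    have htc : t ∈ Icc (0 : ℝ) 1 := ⟨ht.1.le, by linarith [ht.2]⟩
    have s0 := sigma_pos (K := K) (m := n - 1) (t := 1 - t) (θ := θ)
      ⟨by linarith [ht.2], by linarith [ht.1]⟩ hθ.le hr
    have s1 := sigma_nonneg htc hθ.le hr
    have hn : 0 < n - 1 := by linarith
    refine ⟨1 / t / sigma K (n - 1) (1 - t) θ ^ (n - 1), by positivity, ?_⟩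
    rw [rmean_coe hN htc hθ.le hr (by positivity) hc₁]
    have e : 1 / t = (sigma K (n - 1) (1 - t) θ *
        (1 / t / sigma K (n - 1) (1 - t) θ ^ (n - 1)) ^ (1 / (n - 1))) ^ (n - 1) := by
      rw [Real.mul_rpow s0.le (by positivity), ← Real.rpow_mul (by positivity),
        one_div_mul_cancel hn.ne', Real.rpow_one, mul_div_cancel₀ _ (by positivity)]
    conv_lhs => rw [e]
    refine Real.rpow_le_rpow (by positivity) ?_ hn.le
    have : 0 ≤ sigma K (n - 1) t θ * c₁ ^ (1 / (n - 1)) := by positivity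
    linarith
  · rw [delta_coe] at hr
    obtain ⟨C, hC, t₀, ht₀, hσ⟩ := exists_sigma_le_mul hθ hr
    set C' := C * (1 + c₁ ^ (1 / (n - 1))) with hC'
    have hC'0 : 0 < C' := by positivity
    have ht₀0 := ht₀.1
    refine ⟨1 / C', by positivity, min t₀ (1 / C'), ⟨by positivity,
      (min_le_left _ _).trans_lt ht₀.2⟩,
      fun t ht => ?_⟩
    have ht0 := ht.1
    have htt : t ≤ t₀ := ht.2.trans (min_le_left _ _)
    have htC : C' * t ≤ 1 := by
      have := ht.2.trans (min_le_right _ _)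
      rwa [le_div_iff₀ hC'0, mul_comm] at this
    have htc : t ∈ Icc (0 : ℝ) 1 := ⟨ht.1.le, by linarith [ht₀.2]⟩
    have s0 := sigma_pos (K := K) (m := n - 1) (t := 1 - t) (θ := θ)
      ⟨by linarith [ht₀.2], by linarith [ht.1]⟩ hθ.le hr
    have s1 := sigma_pos (K := K) (m := n - 1) (t := t) (θ := θ) ⟨ht0, htc.2⟩ hθ.le hr
    have hn : n - 1 < 0 := by linarith
    refine ⟨(C * t / sigma K (n - 1) (1 - t) θ) ^ (n - 1), by positivity, ?_⟩
    rw [rmean_coe hN htc hθ.le hr (by positivity) hc₁, ← Real.rpow_mul (by positivity),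
      mul_one_div_cancel hn.ne, Real.rpow_one, mul_div_cancel₀ _ s0.ne']
    have hle : C * t + sigma K (n - 1) t θ * c₁ ^ (1 / (n - 1)) ≤ C' * t := by
      have := mul_le_mul_of_nonneg_right (hσ t ⟨ht0, htt⟩)
        (show 0 ≤ c₁ ^ (1 / (n - 1)) by positivity)
      rw [hC']; linarith
    refine le_trans ?_ (Real.rpow_le_rpow_of_nonpos (by positivity) hle hn.le)
    -- `N - 1 ≤ -1`, which makes the power non-integrable at `0`
    refine le_trans (le_of_eq ?_) (Real.rpow_le_rpow_of_exponent_ge (by positivity) htC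
      (show n - 1 ≤ -1 by linarith))
    rw [Real.rpow_neg_one, mul_inv, div_div, one_div, mul_inv]

lemma ae_rnDeriv_eq_lowerDens (ξ : Measure ℝ) [IsFiniteMeasure ξ] :
    ξ.rnDeriv volume =ᵐ[volume] lowerDens ξ := by
  filter_upwards [Besicovitch.ae_tendsto_rnDeriv ξ volume] with x hx
  exact hx.liminf_eq.symm

/-- A point of infinite lower density excludes other points of positive lower density. -/
lemma IsSynthetic.lowerDens_eq_zero (hN : N ≤ 0 ∨ 1 < N) (h : IsSynthetic K N D I ξ)
    (hD : 0 < delta K N → K < 0 → D < ell K N) {x y : ℝ} (hx : lowerDens ξ x = ⊤) (hxy : x ≠ y) :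
    lowerDens ξ y = 0 := by
  have := h.finite
  by_contra hy
  have hy := pos_iff_ne_zero.2 hy
  obtain ⟨c₁, hc₁, hy'⟩ := exists_ofReal_lt hy
  obtain ⟨θ, hθ, hr, hd⟩ := h.exists_dist hD
    (mem_support_of_lowerDens_pos (x := x) (by rw [hx]; exact ENNReal.zero_lt_top))
    (mem_support_of_lowerDens_pos hy) hxy
  obtain ⟨κ, hκ, t₀, ht₀, hmain⟩ := exists_div_le_rmean hN hθ hr hc₁
  -- at distance of order `t` from `x` the lower density is at least of order `1 / t`
  have hlow : ∀ t ∈ Ioc 0 t₀, ENNReal.ofReal (κ / t) ≤ lowerDens ξ ((1 - t) * x + t * y) := by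
    intro t ht
    obtain ⟨c₀, hc₀, hle⟩ := hmain t ht
    exact (ENNReal.ofReal_le_ofReal hle).trans (h.le_lowerDens hN hc₀ hc₁
      (by rw [hx]; exact ENNReal.ofReal_lt_top) hy' ⟨ht.1, ht.2.trans_lt ht₀.2⟩ hxy hθ hr hd)
  have hfin : ∫⁻ z, lowerDens ξ z < ⊤ := by
    rw [← lintegral_congr_ae (ae_rnDeriv_eq_lowerDens ξ)]
    exact Measure.lintegral_rnDeriv_lt_top ξ volume
  set g : ℝ → ℝ := fun t => (1 - t) * x + t * y with hg
  have hgd : ∀ t, HasDerivAt g (y - x) t := by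
    intro t
    have h1 : HasDerivAt (fun t : ℝ => (1 - t) * x) (-1 * x) t :=
      ((hasDerivAt_id t).const_sub 1).mul_const x
    have h2 : HasDerivAt (fun t : ℝ => t * y) (1 * y) t := (hasDerivAt_id t).mul_const y
    exact (h1.add h2).congr_deriv (by ring)
  have hginj : Function.Injective g := by
    intro s t hst
    have h1 : (s - t) * (y - x) = 0 := by simp only [hg] at hst; linarith
    rcases mul_eq_zero.1 h1 with h2 | h2
    · linarith
    · exact absurd (sub_eq_zero.1 h2).symm hxy
  have hdpos : 0 < |y - x| := abs_pos.2 (sub_ne_zero.2 hxy.symm)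
  have hint : ∫⁻ t in Ioc 0 t₀, ENNReal.ofReal (|y - x| * (κ / t)) < ⊤ := by
    calc ∫⁻ t in Ioc 0 t₀, ENNReal.ofReal (|y - x| * (κ / t))
        ≤ ∫⁻ t in Ioc 0 t₀, ENNReal.ofReal |y - x| * lowerDens ξ (g t) := by
          refine setLIntegral_mono' measurableSet_Ioc fun t ht => ?_
          rw [ENNReal.ofReal_mul hdpos.le]
          gcongr
          exact hlow t ht
      _ = ∫⁻ z in g '' Ioc 0 t₀, lowerDens ξ z :=
          (lintegral_image_eq_lintegral_abs_deriv_mul measurableSet_Ioc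
            (fun t _ => (hgd t).hasDerivWithinAt) hginj.injOn _).symm
      _ ≤ ∫⁻ z, lowerDens ξ z := setLIntegral_le_lintegral _ _
      _ < ⊤ := hfin
  have hii : IntegrableOn (fun t : ℝ => |y - x| * (κ / t)) (Ioc 0 t₀) := by
    refine ⟨Measurable.aestronglyMeasurable (by fun_prop), ?_⟩
    rw [hasFiniteIntegral_iff_ofReal]
    · exact hint
    · filter_upwards [ae_restrict_mem measurableSet_Ioc] with t ht
      have := ht.1
      positivity
  have hinv : IntervalIntegrable (fun t : ℝ => t⁻¹) volume 0 t₀ := by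
    rw [intervalIntegrable_iff_integrableOn_Ioc_of_le ht₀.1.le]
    refine (hii.const_mul (|y - x| * κ)⁻¹).congr (ae_of_all _ fun t => ?_)
    simp only [div_eq_mul_inv]
    rw [← mul_assoc |y - x|, inv_mul_cancel_left₀ (by positivity)]
  rw [intervalIntegrable_inv_iff] at hinv
  rcases hinv with h0 | h0
  · exact ht₀.1.ne h0
  · exact h0 left_mem_uIcc

/-- Where Lebesgue measure has derivative `0` with respect to `ξ`, the lower density is infinite. -/
lemma ae_lowerDens_eq_top (ξ : Measure ℝ) [IsFiniteMeasure ξ] :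
    ∀ᵐ x ∂ξ, volume.rnDeriv ξ x = 0 → lowerDens ξ x = ⊤ := by
  filter_upwards [Besicovitch.ae_tendsto_rnDeriv volume ξ] with x hx h0
  rw [h0] at hx
  have h1 := ((continuous_inv (G := ℝ≥0∞)).tendsto 0).comp hx
  rw [ENNReal.inv_zero] at h1
  refine Tendsto.liminf_eq (h1.congr' ?_)
  filter_upwards [self_mem_nhdsWithin] with r hr
  have hr : 0 < r := hr
  rw [Function.comp_apply, ENNReal.inv_div (Or.inl (measure_ne_top _ _))]
  right
  rw [Real.volume_closedBall]
  simpa using hr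

lemma rmean_self {t a : ℝ} (hN : N ≤ 0 ∨ 1 < N) (ha : 0 < a) : rmean K N t 0 a a = a := by
  have : potInterp K N t 0 (toPot N a) (toPot N a) = toPot N a := by
    induction N using WithTop.recTopCoe with
    | top => rw [potInterp_top]; ring
    | coe n => rw [potInterp_coe, sigma_zero_right, sigma_zero_right]; ring
  rw [rmean, this, toDens_toPot hN ha]

theorem IsSynthetic.eq_dirac_or_eq_densMeasure (hN : N ≤ 0 ∨ 1 < N) (h : IsSynthetic K N D I ξ)
    [IsProbabilityMeasure ξ] (hD : 0 < delta K N → K < 0 → D < ell K N) {α β : ℝ}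
    (hI : I ⊆ Icc α β) :
    (∃ x, ξ = Measure.dirac x) ∨
      ∃ J a b, IsConcaveDensity K N J a b ∧ Integrable J ∧ ξ = densMeasure J := by
  by_cases htop : ∃ x, lowerDens ξ x = ⊤
  · -- then the density of `ξ` vanishes, so that `ξ` is singular and lives on `lowerDens = ∞`
    obtain ⟨x, hx⟩ := htop
    left
    have hz : ξ.rnDeriv volume =ᵐ[volume] 0 := by
      filter_upwards [ae_rnDeriv_eq_lowerDens ξ, Measure.ae_ne volume x] with y hy hyx
      rw [hy, Pi.zero_apply]
      exact h.lowerDens_eq_zero hN hD hx hyx.symm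
    have hs : volume ⟂ₘ ξ := ((Measure.rnDeriv_eq_zero ξ volume).1 hz).symm
    have hae : ∀ᵐ y ∂ξ, y = x := by
      filter_upwards [ae_lowerDens_eq_top ξ, (Measure.rnDeriv_eq_zero volume ξ).2 hs] with y hy hy0
      by_contra hyx
      have h1 := hy hy0
      rw [h.lowerDens_eq_zero hN hD hx (Ne.symm hyx)] at h1
      exact ENNReal.zero_ne_top h1
    refine ⟨x, Measure.ext fun s hs => ?_⟩
    rw [Measure.dirac_apply' x hs]
    by_cases hxs : x ∈ s
    · rw [indicator_of_mem hxs, Pi.one_apply, ← prob_compl_eq_zero_iff hs, ← mem_ae_iff]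
      filter_upwards [hae] with y hy
      exact hy ▸ hxs
    · rw [indicator_of_notMem hxs, measure_eq_zero_iff_ae_notMem]
      filter_upwards [hae] with y hy
      exact hy ▸ hxs
  · push Not at htop
    right
    -- a singular part of `ξ` would live on points of infinite lower density
    have hac : ξ ≪ volume := by
      intro s hs
      have h1 : ∫⁻ y in s, volume.rnDeriv ξ y ∂ξ = 0 :=
        le_antisymm ((Measure.setLIntegral_rnDeriv_le s).trans hs.le) zero_le
      rw [lintegral_eq_zero_iff (Measure.measurable_rnDeriv _ _)] at h1
      have h2 : ∀ᵐ y ∂(ξ.restrict s), False := by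
        filter_upwards [h1, ae_restrict_of_ae (ae_lowerDens_eq_top ξ)] with y hy hy'
        exact htop y (hy' hy)
      rw [eventually_false_iff_eq_bot, ae_eq_bot, Measure.restrict_eq_zero] at h2
      exact h2
    have hwd : ξ = volume.withDensity (lowerDens ξ) := by
      rw [← withDensity_congr_ae (ae_rnDeriv_eq_lowerDens ξ),
        Measure.withDensity_rnDeriv_eq _ _ hac]
    set J : ℝ → ℝ := fun x => (lowerDens ξ x).toReal with hJ
    have hJofReal : ∀ x, ENNReal.ofReal (J x) = lowerDens ξ x := fun x =>
      ENNReal.ofReal_toReal (htop x)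
    have hdens : ξ = densMeasure J := by
      unfold densMeasure
      simp only [hJofReal]
      exact hwd
    have hlae : AEMeasurable (lowerDens ξ) :=
      (Measure.measurable_rnDeriv ξ volume).aemeasurable.congr (ae_rnDeriv_eq_lowerDens ξ)
    have hJae : AEMeasurable J := hlae.ennreal_toReal
    have hJpos : ∀ x, 0 < J x ↔ 0 < lowerDens ξ x := fun x => by
      rw [← hJofReal, ENNReal.ofReal_pos]
    obtain ⟨J', a, b, hJ', hae, -, -⟩ := exists_isConcaveDensity (K := K) (N := N) (J := J)
      (α := α) (β := β) hJae (fun x => ENNReal.toReal_nonneg)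
      (fun x hx => hI (h.support_subset (mem_support_of_lowerDens_pos ((hJpos x).1 hx))))
      (by
        refine (convex_iff_ordConnected).1 fun x hx y hy s t hs ht hst => ?_
        have e : s = 1 - t := by linarith
        subst e
        exact (hJpos _).2 (h.lowerDens_pos hN hD ((hJpos x).1 hx) ((hJpos y).1 hy)
          ⟨ht, by linarith⟩))
      (fun x y hx hy => h.range hD (mem_support_of_lowerDens_pos ((hJpos x).1 hx))
        (mem_support_of_lowerDens_pos ((hJpos y).1 hy)))
      (by
        intro x y hx hy hr t ht
        rcases eq_or_ne x y with rfl | hxy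
        · rw [sub_self, abs_zero, rmean_self hN hx, ← add_mul, sub_add_cancel, one_mul]
        rcases ht.1.eq_or_lt with rfl | h0
        · rw [rmean_zero hN (abs_nonneg _) hr hx]; simp
        rcases ht.2.eq_or_lt with rfl | h1
        · rw [rmean_one hN (abs_nonneg _) hr hy]; simp
        have := h.rmean_le_lowerDens hN ((hJpos x).1 hx) (htop x) ((hJpos y).1 hy) (htop y)
          ⟨h0, h1⟩ hxy hr
        exact (ENNReal.ofReal_le_iff_le_toReal (htop _)).1 this)
      (hdens ▸ IsProbabilityMeasure.ne_zero ξ)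
    have hdens' : ξ = densMeasure J' := by
      rw [hdens]
      exact withDensity_congr_ae (hae.fun_comp ENNReal.ofReal).symm
    refine ⟨J', a, b, hJ', ⟨hJ'.aemeasurable.aestronglyMeasurable, ?_⟩, hdens'⟩
    rw [hasFiniteIntegral_iff_ofReal (ae_of_all _ hJ'.nonneg)]
    have : densMeasure J' univ < ⊤ := by rw [← hdens']; exact measure_lt_top _ _
    rwa [densMeasure, withDensity_apply _ MeasurableSet.univ, setLIntegral_univ] at this

end

/-! ### Decompositions of an extreme measure -/

lemma densMeasure_congr {f g : ℝ → ℝ} (h : f =ᵐ[volume] g) : densMeasure f = densMeasure g :=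
  withDensity_congr_ae (h.fun_comp ENNReal.ofReal)

lemma densMeasure_smul {c : ℝ} (hc : 0 ≤ c) (f : ℝ → ℝ) :
    densMeasure (fun x => c * f x) = c.toNNReal • densMeasure f := by
  unfold densMeasure
  rw [ENNReal.smul_def, ← withDensity_smul' _ _ ENNReal.coe_ne_top]
  congr 1
  funext x
  rw [ENNReal.ofReal_mul hc]; rfl

lemma densMeasure_add {f g : ℝ → ℝ} (hf : AEMeasurable f) (hf0 : ∀ x, 0 ≤ f x)
    (hg0 : ∀ x, 0 ≤ g x) :
    densMeasure (fun x => f x + g x) = densMeasure f + densMeasure g := by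
  refine Measure.ext fun s hs => ?_
  unfold densMeasure
  rw [withDensity_apply _ hs, Measure.add_apply, withDensity_apply _ hs, withDensity_apply _ hs,
    ← lintegral_add_left' hf.ennreal_ofReal.restrict]
  simp only [ENNReal.ofReal_add (hf0 _) (hg0 _)]

lemma integral_densMeasure {f : ℝ → ℝ} (hf : AEMeasurable f) (hf0 : ∀ x, 0 ≤ f x) (h : ℝ → ℝ) :
    ∫ x, h x ∂(densMeasure f) = ∫ x, f x * h x := by
  unfold densMeasure
  rw [integral_withDensity_eq_integral_toReal_smul₀ hf.ennreal_ofReal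
    (ae_of_all _ fun _ => ENNReal.ofReal_lt_top)]
  simp only [ENNReal.toReal_ofReal (hf0 _), smul_eq_mul]

lemma setIntegral_densMeasure {f : ℝ → ℝ} (hf : AEMeasurable f) (hf0 : ∀ x, 0 ≤ f x) (h : ℝ → ℝ)
    {s : Set ℝ} (hs : MeasurableSet s) :
    ∫ x in s, h x ∂(densMeasure f) = ∫ x in s, f x * h x := by
  unfold densMeasure
  rw [setIntegral_withDensity_eq_setIntegral_toReal_smul₀ hf.ennreal_ofReal.restrict
    (ae_of_all _ fun _ => ENNReal.ofReal_lt_top) _ hs]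
  simp only [ENNReal.toReal_ofReal (hf0 _), smul_eq_mul]

lemma densMeasure_univ {f : ℝ → ℝ} (hf : Integrable f) (hf0 : ∀ x, 0 ≤ f x) :
    densMeasure f univ = ENNReal.ofReal (∫ x, f x) := by
  rw [densMeasure, withDensity_apply _ MeasurableSet.univ, setLIntegral_univ,
    ofReal_integral_eq_lintegral_ofReal hf (ae_of_all _ hf0)]

lemma integral_eq_one {f : ℝ → ℝ} (hf : Integrable f) (hf0 : ∀ x, 0 ≤ f x)
    [IsProbabilityMeasure (densMeasure f)] : ∫ x, f x = 1 := by
  have h1 := densMeasure_univ hf hf0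
  rw [measure_univ, eq_comm, ENNReal.ofReal_eq_one] at h1
  exact h1

lemma isProbabilityMeasure_densMeasure {f : ℝ → ℝ} (hf : Integrable f) (hf0 : ∀ x, 0 ≤ f x)
    (h1 : ∫ x, f x = 1) : IsProbabilityMeasure (densMeasure f) :=
  ⟨by rw [densMeasure_univ hf hf0, h1, ENNReal.ofReal_one]⟩

lemma densMeasure_eq_iff {f g : ℝ → ℝ} (hf : Integrable f) (hg : AEMeasurable g)
    (hf0 : ∀ x, 0 ≤ f x) (hg0 : ∀ x, 0 ≤ g x) :
    densMeasure f = densMeasure g ↔ f =ᵐ[volume] g := by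
  unfold densMeasure
  rw [withDensity_eq_iff hf.aemeasurable.ennreal_ofReal hg.ennreal_ofReal
    (by
      rw [← ofReal_integral_eq_lintegral_ofReal hf (ae_of_all _ hf0)]
      exact ENNReal.ofReal_ne_top)]
  constructor
  · intro h
    filter_upwards [h] with x hx
    exact (ENNReal.ofReal_eq_ofReal_iff (hf0 x) (hg0 x)).1 hx
  · exact fun h => h.fun_comp ENNReal.ofReal

lemma IsConcaveDensity.integral_pos {K : ℝ} {N : WithTop ℝ} {J : ℝ → ℝ} {a b : ℝ}
    (h : IsConcaveDensity K N J a b) (hi : Integrable J) : 0 < ∫ x, J x := by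
  refine (integral_nonneg h.nonneg).lt_of_ne fun h0 => h.ne_zero ?_
  rw [← Measure.measure_univ_eq_zero, densMeasure_univ hi h.nonneg, ← h0, ENNReal.ofReal_zero]

lemma IsConcaveDensity.restrict {K : ℝ} {N : WithTop ℝ} {J : ℝ → ℝ} {a b a' b' : ℝ}
    (h : IsConcaveDensity K N J a b) (ha : a ≤ a') (hab : a' < b') (hb : b' ≤ b) :
    IsConcaveDensity K N ((Ioo a' b').indicator J) a' b' where
  lt := hab
  aemeasurable := h.aemeasurable.indicator measurableSet_Ioo
  pos x hx := by
    rw [indicator_of_mem hx]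
    exact h.pos x (Ioo_subset_Ioo ha hb hx)
  eq_zero x hx := indicator_of_notMem hx J
  range := by
    have hpi : 0 ≤ Real.pi ^ 2 := by positivity
    rcases le_or_gt (delta K N) 0 with h0 | h0
    · exact (mul_nonpos_of_nonpos_of_nonneg h0 (sq_nonneg _)).trans hpi
    · refine le_trans ?_ h.range
      have : 0 ≤ b' - a' := by linarith
      gcongr
  rmean_le x hx y hy t ht := by
    rw [indicator_of_mem hx, indicator_of_mem hy, indicator_of_mem (interp_mem_Ioo hx hy ht)]
    exact h.rmean_le x (Ioo_subset_Ioo ha hb hx) y (Ioo_subset_Ioo ha hb hy) t ht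

section

variable {K : ℝ} {N : WithTop ℝ} {D : ℝ≥0∞} {h : ℝ → ℝ}

lemma integrable_mul_of_bounded {f : ℝ → ℝ} (hf : Integrable f) (hm : Measurable h) {C : ℝ}
    (hC : ∀ x, |h x| ≤ C) : Integrable fun x => f x * h x :=
  hf.mul_bdd (c := C) hm.aestronglyMeasurable (ae_of_all _ hC)

/-- A splitting of an extreme measure into concave densities that both satisfy the linear
constraint is a trivial one. -/
lemma eq_smul_of_mem_extremePoints (hN : N ≤ 0 ∨ 1 < N) (hm : Measurable h) {C : ℝ}
    (hC : ∀ x, |h x| ≤ C) {f g g' r' : ℝ → ℝ} {a b a₀ b₀ a₁ b₁ : ℝ}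
    (hext : densMeasure f ∈ extremePoints ℝ≥0 (synthProb K N D h))
    (hf : IsConcaveDensity K N f a b) (hfi : Integrable f)
    (hg' : IsConcaveDensity K N g' a₀ b₀) (hr' : IsConcaveDensity K N r' a₁ b₁)
    (hgg' : g' =ᵐ[volume] g) (hrr' : r' =ᵐ[volume] fun x => f x - g x)
    (hs₀ : Icc a₀ b₀ ⊆ Icc a b) (hs₁ : Icc a₁ b₁ ⊆ Icc a b)
    (hg : ∫ x, g x * h x = 0) :
    ∃ c ∈ Ioo (0 : ℝ) 1, g =ᵐ[volume] fun x => c * f x := by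
  obtain ⟨⟨hprob, hsyn, hzero⟩, hmax⟩ := hext
  have hgle : ∀ᵐ x, |g' x| ≤ f x := by
    filter_upwards [hgg', hrr'] with x h1 h2
    rw [abs_of_nonneg (hg'.nonneg x), h1]
    linarith [hr'.nonneg x]
  have hg'i : Integrable g' := hfi.mono' hg'.aemeasurable.aestronglyMeasurable hgle
  have hgi : Integrable g := hg'i.congr hgg'
  have hr'i : Integrable r' := (hfi.sub hgi).congr hrr'.symm
  have hf1 : ∫ x, f x = 1 := integral_eq_one hfi hf.nonneg
  have hsum : (∫ x, g' x) + ∫ x, r' x = 1 := by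
    rw [integral_congr_ae hgg', integral_congr_ae hrr', integral_sub hfi hgi, hf1]; ring
  have hgpos := hg'.integral_pos hg'i
  have hrpos := hr'.integral_pos hr'i
  set c := ∫ x, g' x with hc
  set d := ∫ x, r' x with hd
  have hsupp : Icc a b ⊆ hullSupport h := hf.support_eq ▸ hsyn.support_subset
  have hdiam : ENNReal.ofReal (b - a) ≤ D := by
    have := hsyn.diam_le
    rwa [hf.support_eq, Real.ediam_Icc] at this
  have hsub : ∀ a' b' : ℝ, a' < b' → Icc a' b' ⊆ Icc a b → ENNReal.ofReal (b' - a') ≤ D := by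
    intro a' b' hab hs
    rw [Icc_subset_Icc_iff hab.le] at hs
    exact (ENNReal.ofReal_le_ofReal (by linarith [hs.1, hs.2])).trans hdiam
  have hfh : ∫ x, f x * h x = 0 := by
    rw [← integral_densMeasure hf.aemeasurable hf.nonneg]; exact hzero
  have hmem : ∀ (k : ℝ → ℝ) (a' b' : ℝ), IsConcaveDensity K N k a' b' → Integrable k →
      Icc a' b' ⊆ Icc a b → ∫ x, k x * h x = 0 → 0 < ∫ x, k x →
      densMeasure (fun x => (∫ x, k x)⁻¹ * k x) ∈ synthProb K N D h := by
    intro k a' b' hk hki hs hkh hpos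
    have hk' := hk.smul hN (inv_pos.2 hpos)
    have hki' := hki.const_mul (∫ x, k x)⁻¹
    refine ⟨isProbabilityMeasure_densMeasure hki' hk'.nonneg ?_,
      hk'.isSynthetic hN hki' (hs.trans hsupp) (hsub _ _ hk.lt hs), ?_⟩
    · rw [integral_const_mul, inv_mul_cancel₀ hpos.ne']
    · rw [integral_densMeasure hk'.aemeasurable hk'.nonneg]
      simp only [mul_assoc, integral_const_mul, hkh, mul_zero]
  have hg'h : ∫ x, g' x * h x = 0 := by
    rw [← hg]
    refine integral_congr_ae ?_
    filter_upwards [hgg'] with x hx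
    rw [hx]
  have hr'h : ∫ x, r' x * h x = 0 := by
    have : ∫ x, r' x * h x = ∫ x, (f x * h x - g x * h x) := by
      refine integral_congr_ae ?_
      filter_upwards [hrr'] with x hx
      rw [hx]; ring
    rw [this, integral_sub (integrable_mul_of_bounded hfi hm hC)
      (integrable_mul_of_bounded hgi hm hC), hfh, hg, sub_zero]
  have h0 := hmem g' _ _ hg' hg'i hs₀ hg'h hgpos
  have h1 := hmem r' _ _ hr' hr'i hs₁ hr'h hrpos
  have hinv : ∀ (k : ℝ → ℝ) (e : ℝ), 0 < e → e.toNNReal • densMeasure (fun x => e⁻¹ * k x) =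
      densMeasure k := by
    intro k e he
    rw [← densMeasure_smul he.le]
    simp only [mul_inv_cancel_left₀ he.ne']
  have heq := hmax h0 h1 ⟨c.toNNReal, d.toNNReal, Real.toNNReal_pos.2 hgpos,
    Real.toNNReal_pos.2 hrpos, by
      rw [← Real.toNNReal_add hgpos.le hrpos.le, hsum, Real.toNNReal_one], by
      rw [hinv g' c hgpos, hinv r' d hrpos,
        ← densMeasure_add hg'.aemeasurable hg'.nonneg hr'.nonneg]
      refine densMeasure_congr ?_
      filter_upwards [hgg', hrr'] with x h1 h2
      rw [h1, h2]; ring⟩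
  rw [densMeasure_eq_iff (hg'i.const_mul _) hf.aemeasurable
    (hg'.smul hN (inv_pos.2 hgpos)).nonneg hf.nonneg] at heq
  refine ⟨c, ⟨hgpos, by linarith⟩, ?_⟩
  filter_upwards [heq, hgg'] with x h1 h2
  rw [← h1, ← h2, mul_inv_cancel_left₀ hgpos.ne']

/-- For an extreme measure the primitive of the constraint does not vanish inside the support,
since otherwise the measure can be cut at a zero. -/
lemma setIntegral_Iic_ne_zero (hN : N ≤ 0 ∨ 1 < N) (hm : Measurable h) {C : ℝ}
    (hC : ∀ x, |h x| ≤ C) {f : ℝ → ℝ} {a b x₀ : ℝ}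
    (hext : densMeasure f ∈ extremePoints ℝ≥0 (synthProb K N D h))
    (hf : IsConcaveDensity K N f a b) (hfi : Integrable f) (hx₀ : x₀ ∈ Ioo a b) :
    ∫ x in Iic x₀, f x * h x ≠ 0 := by
  intro hzero
  have hr : (Ioo x₀ b).indicator f =ᵐ[volume] fun x => f x - (Ioo a x₀).indicator f x := by
    filter_upwards [Measure.ae_ne volume x₀] with x hx
    by_cases h1 : x ∈ Ioo a x₀
    · rw [indicator_of_mem h1, indicator_of_notMem (fun h2 => by linarith [h1.2, h2.1]), sub_self]
    · rw [indicator_of_notMem h1, sub_zero]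
      by_cases h2 : x ∈ Ioo x₀ b
      · rw [indicator_of_mem h2]
      · rw [indicator_of_notMem h2, hf.eq_zero x]
        intro h3
        rcases lt_or_gt_of_ne hx with h4 | h4
        · exact h1 ⟨h3.1, h4⟩
        · exact h2 ⟨h4, h3.2⟩
  have hgz : ∫ x, (Ioo a x₀).indicator f x * h x = 0 := by
    rw [← hzero, ← integral_indicator measurableSet_Iic]
    refine integral_congr_ae ?_
    filter_upwards [Measure.ae_ne volume x₀] with x hx
    by_cases h1 : x ∈ Ioo a x₀
    · rw [indicator_of_mem h1, indicator_of_mem (show x ∈ Iic x₀ from h1.2.le)]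
    · rw [indicator_of_notMem h1, zero_mul]
      by_cases h2 : x ∈ Iic x₀
      · rw [indicator_of_mem h2, hf.eq_zero x, zero_mul]
        exact fun h3 => h1 ⟨h3.1, lt_of_le_of_ne h2 hx⟩
      · rw [indicator_of_notMem h2]
  obtain ⟨c, hc, hcf⟩ := eq_smul_of_mem_extremePoints hN hm hC hext hf hfi
    (hf.restrict le_rfl hx₀.1 hx₀.2.le) (hf.restrict hx₀.1.le hx₀.2 le_rfl) EventuallyEq.rfl hr
    (Icc_subset_Icc le_rfl hx₀.2.le) (Icc_subset_Icc hx₀.1.le le_rfl) hgz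
  have hne : volume (Ioo x₀ b) ≠ 0 := by simpa using hx₀.2
  apply hne
  rw [measure_eq_zero_iff_ae_notMem]
  filter_upwards [hcf] with x hx hxI
  rw [indicator_of_notMem (fun h2 => by linarith [h2.2, hxI.1])] at hx
  exact (mul_pos hc.1 (hf.pos x ⟨hx₀.1.trans hxI.1, hxI.2⟩)).ne hx

end

/-! ### Model potentials and the cut-off of a concave density -/

/-- The potential with value `A` and slope `c` at `x₀` whose interpolation is exact: a solution of
`y'' + δ y = 0`, or of `y'' = -K` if `N = ∞`. -/
noncomputable def modelPot (K : ℝ) (N : WithTop ℝ) (A c x₀ x : ℝ) : ℝ :=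
  match N with
  | ⊤ => A + c * (x - x₀) - K * (x - x₀) ^ 2 / 2
  | (n : ℝ) => A * cs (K / (n - 1)) (x - x₀) + c * sn (K / (n - 1)) (x - x₀)

lemma modelPot_top (K A c x₀ x : ℝ) :
    modelPot K ⊤ A c x₀ x = A + c * (x - x₀) - K * (x - x₀) ^ 2 / 2 := rfl

lemma modelPot_coe (K n A c x₀ x : ℝ) : modelPot K (n : WithTop ℝ) A c x₀ x =
    A * cs (K / (n - 1)) (x - x₀) + c * sn (K / (n - 1)) (x - x₀) := rfl

lemma modelPot_self (K : ℝ) (N : WithTop ℝ) (A c x₀ : ℝ) : modelPot K N A c x₀ x₀ = A := by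
  induction N using WithTop.recTopCoe with
  | top => rw [modelPot_top]; simp
  | coe n => rw [modelPot_coe]; simp

lemma modelPot_interp {K : ℝ} {N : WithTop ℝ} {A c x₀ x y t : ℝ}
    (hr : delta K N * |y - x| ^ 2 < Real.pi ^ 2) :
    modelPot K N A c x₀ ((1 - t) * x + t * y) =
      potInterp K N t |y - x| (modelPot K N A c x₀ x) (modelPot K N A c x₀ y) := by
  induction N using WithTop.recTopCoe with
  | top => simp only [modelPot_top, potInterp_top, sq_abs]; ring
  | coe n =>
    rw [delta_coe, sq_abs] at hr
    simp only [modelPot_coe, potInterp_coe]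
    exact sigma_interp hr

lemma continuous_modelPot (K : ℝ) (N : WithTop ℝ) (A c x₀ : ℝ) :
    Continuous (modelPot K N A c x₀) := by
  induction N using WithTop.recTopCoe with
  | top =>
    have : modelPot K ⊤ A c x₀ = fun x => A + c * (x - x₀) - K * (x - x₀) ^ 2 / 2 := rfl
    rw [this]; fun_prop
  | coe n =>
    have : modelPot K n A c x₀ =
      fun x => A * cs (K / (n - 1)) (x - x₀) + c * sn (K / (n - 1)) (x - x₀) := rfl
    rw [this]
    have h1 := continuous_sn (K / (n - 1))
    have h2 := continuous_cs (K / (n - 1))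
    fun_prop

/-- The potential depends on the slope affinely, with a coefficient that changes sign at `x₀`. -/
lemma exists_modelPot_slope {K : ℝ} {N : WithTop ℝ} {x₀ x : ℝ} (A : ℝ)
    (hr : delta K N * |x - x₀| ^ 2 < Real.pi ^ 2) :
    ∃ p q : ℝ, (∀ c, modelPot K N A c x₀ x = p + q * c) ∧ (x₀ < x → 0 < q) ∧ (x < x₀ → q < 0) := by
  induction N using WithTop.recTopCoe with
  | top =>
    refine ⟨A - K * (x - x₀) ^ 2 / 2, x - x₀, fun c => ?_, fun h => by linarith,
      fun h => by linarith⟩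
    rw [modelPot_top]; ring
  | coe n =>
    rw [delta_coe, sq_abs] at hr
    refine ⟨A * cs (K / (n - 1)) (x - x₀), sn (K / (n - 1)) (x - x₀), fun c => ?_, fun h => ?_,
      fun h => ?_⟩
    · rw [modelPot_coe]; ring
    · exact sn_pos (by linarith) hr
    · have h1 := sn_pos (δ := K / (n - 1)) (x := -(x - x₀)) (by linarith) (by rwa [neg_sq])
      rw [sn_neg] at h1
      linarith

lemma tendsto_toDens_atBot {N : WithTop ℝ} (hN : N ≤ 0 ∨ 1 < N) :
    Tendsto (toDens N) atBot (𝓝 0) := by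
  rcases admissible_cases hN with rfl | ⟨n, rfl, h⟩ | ⟨n, rfl, h⟩
  · exact Real.tendsto_exp_atBot
  · refine tendsto_const_nhds.congr' ?_
    filter_upwards [eventually_le_atBot 0] with u hu
    rw [toDens_of_one_lt h, max_eq_right hu, Real.zero_rpow (by linarith)]
  · have h1 := (tendsto_rpow_neg_atTop (show 0 < -(n - 1) by linarith)).comp tendsto_neg_atBot_atTop
    refine h1.congr fun u => ?_
    rw [toDens_of_nonpos h, Function.comp_apply, neg_neg]

lemma toPot_rmean {K : ℝ} {N : WithTop ℝ} (hN : N ≤ 0 ∨ 1 < N) {t d a b : ℝ}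
    (ht : t ∈ Icc (0 : ℝ) 1) (hd : 0 ≤ d) (hr : delta K N * d ^ 2 < Real.pi ^ 2)
    (ha : 0 < a) (hb : 0 < b) :
    toPot N (rmean K N t d a b) = potInterp K N t d (toPot N a) (toPot N b) :=
  toPot_toDens hN (potInterp_mem hN ht hd hr (toPot_mem hN ha) (toPot_mem hN hb))

/-- The part of the density `f` below the model density with potential `ℓ`. -/
noncomputable def cutoff (N : WithTop ℝ) (f ℓ : ℝ → ℝ) (a b : ℝ) : ℝ → ℝ :=
  (Ioo a b).indicator fun x => toDens N (min (toPot N (f x)) (ℓ x))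

section

variable {K : ℝ} {N : WithTop ℝ} {f ℓ : ℝ → ℝ} {a b : ℝ}

lemma cutoff_of_mem {x : ℝ} (hx : x ∈ Ioo a b) :
    cutoff N f ℓ a b x = toDens N (min (toPot N (f x)) (ℓ x)) := indicator_of_mem hx _

lemma cutoff_of_notMem {x : ℝ} (hx : x ∉ Ioo a b) : cutoff N f ℓ a b x = 0 :=
  indicator_of_notMem hx _

lemma IsConcaveDensity.cutoff_nonneg (hN : N ≤ 0 ∨ 1 < N) (hf : IsConcaveDensity K N f a b)
    (ℓ : ℝ → ℝ) (x : ℝ) : 0 ≤ cutoff N f ℓ a b x := by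
  by_cases hx : x ∈ Ioo a b
  · rw [cutoff_of_mem hx]
    exact toDens_nonneg hN ((mem_potDom_of_le hN (min_le_left _ _)
      (toPot_mem hN (hf.pos x hx))).imp_right And.left)
  · rw [cutoff_of_notMem hx]

lemma IsConcaveDensity.cutoff_le (hN : N ≤ 0 ∨ 1 < N) (hf : IsConcaveDensity K N f a b)
    (ℓ : ℝ → ℝ) (x : ℝ) : cutoff N f ℓ a b x ≤ f x := by
  by_cases hx : x ∈ Ioo a b
  · rw [cutoff_of_mem hx]
    refine (toDens_mono hN (min_le_left _ _) (Or.inl (toPot_mem hN (hf.pos x hx)))).trans ?_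
    rw [toDens_toPot hN (hf.pos x hx)]
  · rw [cutoff_of_notMem hx]; exact hf.nonneg x

lemma IsConcaveDensity.aemeasurable_cutoff (hf : IsConcaveDensity K N f a b) (hℓ : Measurable ℓ) :
    AEMeasurable (cutoff N f ℓ a b) :=
  ((measurable_toDens N).comp_aemeasurable
    (((measurable_toPot N).comp_aemeasurable hf.aemeasurable).min hℓ.aemeasurable)).indicator
    measurableSet_Ioo

lemma IsConcaveDensity.le_toPot (hN : N ≤ 0 ∨ 1 < N) (hf : IsConcaveDensity K N f a b) {x y t : ℝ}
    (hx : x ∈ Ioo a b) (hy : y ∈ Ioo a b) (ht : t ∈ Icc (0 : ℝ) 1) :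
    potInterp K N t |y - x| (toPot N (f x)) (toPot N (f y)) ≤
      toPot N (f ((1 - t) * x + t * y)) := by
  have hr := hf.range_lt hx hy
  rw [← toPot_rmean hN ht (abs_nonneg _) hr (hf.pos x hx) (hf.pos y hy)]
  exact toPot_mono hN (rmean_pos hN ht (abs_nonneg _) hr (hf.pos x hx) (hf.pos y hy))
    (hf.rmean_le x hx y hy t ht)

lemma densMeasure_ne_zero_of_pos {J : ℝ → ℝ} (hJ : AEMeasurable J) {p q : ℝ} (hpq : p < q)
    (hpos : ∀ x ∈ Ioo p q, 0 < J x) : densMeasure J ≠ 0 := by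
  intro h0
  rw [densMeasure, withDensity_eq_zero_iff hJ.ennreal_ofReal] at h0
  have h1 : volume (Ioo p q) = 0 := by
    rw [measure_eq_zero_iff_ae_notMem]
    filter_upwards [h0] with x hx hxI
    rw [Pi.zero_apply, ENNReal.ofReal_eq_zero] at hx
    exact absurd (hpos x hxI) (not_lt.2 hx)
  rw [Real.volume_Ioo, ENNReal.ofReal_eq_zero] at h1
  linarith

/-- The cut-off of a concave density by a model density is concave, as a minimum of concave
potentials. -/
lemma IsConcaveDensity.exists_cutoff (hN : N ≤ 0 ∨ 1 < N) (hf : IsConcaveDensity K N f a b)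
    {A c x₀ : ℝ} (hx₀ : x₀ ∈ Ioo a b) (hA : A ∈ potDom N) :
    ∃ g' a' b', IsConcaveDensity K N g' a' b' ∧
      g' =ᵐ[volume] cutoff N f (modelPot K N A c x₀) a b ∧ Icc a' b' ⊆ Icc a b := by
  set ℓ := modelPot K N A c x₀ with hℓ
  set g := cutoff N f ℓ a b with hg
  set v : ℝ → ℝ := fun x => min (toPot N (f x)) (ℓ x) with hv
  have hℓc : Continuous ℓ := continuous_modelPot K N A c x₀
  have hmem : ∀ x, 0 < g x → x ∈ Ioo a b ∧ v x ∈ potDom N := by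
    intro x hx
    by_cases hxI : x ∈ Ioo a b
    · refine ⟨hxI, ?_⟩
      rcases mem_potDom_of_le hN (min_le_left _ (ℓ x)) (toPot_mem hN (hf.pos x hxI)) with h1 | h1
      · exact h1
      · rw [hg, cutoff_of_mem hxI, h1.2] at hx
        exact absurd hx (lt_irrefl _)
    · rw [hg, cutoff_of_notMem hxI] at hx
      exact absurd hx (lt_irrefl _)
  have hmain : ∀ x y, 0 < g x → 0 < g y → ∀ t ∈ Icc (0 : ℝ) 1,
      rmean K N t |y - x| (g x) (g y) ≤ g ((1 - t) * x + t * y) := by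
    intro x y hx hy t ht
    obtain ⟨hxI, hvx⟩ := hmem x hx
    obtain ⟨hyI, hvy⟩ := hmem y hy
    have hzI := interp_mem_Ioo hxI hyI ht
    have hr := hf.range_lt hxI hyI
    rw [hg, cutoff_of_mem hxI, cutoff_of_mem hyI, cutoff_of_mem hzI, rmean, toPot_toDens hN hvx,
      toPot_toDens hN hvy]
    refine toDens_mono hN (le_min ?_ ?_) ((mem_potDom_of_le hN (min_le_left _ _)
      (toPot_mem hN (hf.pos _ hzI))).imp_right And.left)
    · exact (potInterp_mono ht (abs_nonneg _) hr (min_le_left _ _) (min_le_left _ _)).trans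
        (hf.le_toPot hN hxI hyI ht)
    · rw [hℓ, modelPot_interp hr]
      exact potInterp_mono ht (abs_nonneg _) hr (min_le_right _ _) (min_le_right _ _)
  have hne : densMeasure g ≠ 0 := by
    have h1 : ∀ᶠ x in 𝓝 x₀, x ∈ Ioo a b ∧ ℓ x ∈ potDom N :=
      (isOpen_Ioo.eventually_mem hx₀).and (hℓc.continuousAt.eventually
        ((isOpen_potDom N).eventually_mem (by rwa [hℓ, modelPot_self])))
    obtain ⟨ε, hε, hball⟩ := Metric.mem_nhds_iff.1 h1
    rw [Real.ball_eq_Ioo] at hball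
    refine densMeasure_ne_zero_of_pos (hf.aemeasurable_cutoff hℓc.measurable)
      (show x₀ - ε < x₀ + ε by linarith) fun x hx => ?_
    obtain ⟨hxI, hℓx⟩ := hball hx
    rw [hg, cutoff_of_mem hxI]
    refine toDens_pos hN ?_
    rcases min_choice (toPot N (f x)) (ℓ x) with h2 | h2 <;> rw [h2]
    · exact toPot_mem hN (hf.pos x hxI)
    · exact hℓx
  obtain ⟨g', a', b', h1, h2, -, h3⟩ := exists_isConcaveDensity (K := K) (N := N) (J := g)
    (α := a) (β := b) (hf.aemeasurable_cutoff hℓc.measurable) (hf.cutoff_nonneg hN ℓ)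
    (fun x hx => Ioo_subset_Icc_self (hmem x hx).1)
    (by
      refine convex_iff_ordConnected.1 fun x hx y hy s t hs ht hst => ?_
      have e : s = 1 - t := by linarith
      subst e
      have htc : t ∈ Icc (0 : ℝ) 1 := ⟨ht, by linarith⟩
      exact (rmean_pos hN htc (abs_nonneg _) (hf.range_lt (hmem x hx).1 (hmem y hy).1)
        hx hy).trans_le
        (hmain x y hx hy t htc))
    (fun x y hx hy => by
      rw [← sq_abs]; exact (hf.range_lt (hmem x hx).1 (hmem y hy).1).le)
    (fun x y hx hy _ t ht => hmain x y hx hy t ht) hne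
  exact ⟨g', a', b', h1, h2, h3⟩

/-- The rest after a cut-off by a model density is concave: the model density interpolates exactly
and the mean of densities lies below its tangent hyperplanes. -/
lemma IsConcaveDensity.exists_sub_cutoff (hN : N ≤ 0 ∨ 2 ≤ N) (hf : IsConcaveDensity K N f a b)
    {A c x₀ : ℝ} (hx₀ : x₀ ∈ Ioo a b) (hA : A < toPot N (f x₀)) :
    ∃ r' a' b', IsConcaveDensity K N r' a' b' ∧
      r' =ᵐ[volume] (fun x => f x - cutoff N f (modelPot K N A c x₀) a b x) ∧
      Icc a' b' ⊆ Icc a b := by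
  have hN' : N ≤ 0 ∨ 1 < N := hN.imp_right fun h => lt_of_lt_of_le (by norm_num) h
  set ℓ := modelPot K N A c x₀ with hℓ
  set g := cutoff N f ℓ a b with hg
  set r : ℝ → ℝ := fun x => f x - g x with hr
  have hℓc : Continuous ℓ := continuous_modelPot K N A c x₀
  have hmem : ∀ x, 0 < r x → x ∈ Ioo a b ∧ ℓ x < toPot N (f x) := by
    intro x hx
    by_cases hxI : x ∈ Ioo a b
    · refine ⟨hxI, ?_⟩
      by_contra! hle
      simp only [hr, hg, cutoff_of_mem hxI, min_eq_left hle, toDens_toPot hN' (hf.pos x hxI),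
        sub_self, lt_irrefl] at hx
    · simp only [hr, hg, cutoff_of_notMem hxI, hf.eq_zero x hxI, sub_self, lt_irrefl] at hx
  have hpos : ∀ x ∈ Ioo a b, ℓ x < toPot N (f x) → 0 < r x := by
    intro x hxI hlt
    simp only [hr, hg, cutoff_of_mem hxI, min_eq_right hlt.le]
    have h1 := toDens_lt hN' hlt (toPot_mem hN' (hf.pos x hxI))
    rw [toDens_toPot hN' (hf.pos x hxI)] at h1
    linarith
  -- Evaluate the tangent hyperplane at the potentials of `f` at those of `r` and of `f - r`, and
  -- add: the interpolation is exact on `f - r`, which equals the model density at `x`, `y` and at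
  -- the point in between.
  have hmain' : ∀ x y, 0 < r x → 0 < r y → ∀ t ∈ Ioo (0 : ℝ) 1,
      rmean K N t |y - x| (r x) (r y) ≤ r ((1 - t) * x + t * y) := by
    intro x y hx hy t ht
    have htc := Ioo_subset_Icc_self ht
    obtain ⟨hxI, hℓx⟩ := hmem x hx
    obtain ⟨hyI, hℓy⟩ := hmem y hy
    have hzI := interp_mem_Ioo hxI hyI htc
    have hrg := hf.range_lt hxI hyI
    obtain ⟨α, β, heq, hle⟩ := exists_tangent (K := K) (d := |y - x|) hN ht (abs_nonneg _) hrg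
      (toPot_mem hN' (hf.pos x hxI)) (toPot_mem hN' (hf.pos y hyI))
    have hrle : ∀ z, r z ≤ f z := fun z => by
      have := hf.cutoff_nonneg hN' ℓ z
      simp only [hr]; linarith
    have e1 := hle _ (toPot_mono hN' hx (hrle x)) _ (toPot_mono hN' hy (hrle y))
    have e2 := hle _ hℓx.le _ hℓy.le
    have e3 := hf.rmean_le x hxI y hyI t htc
    rw [rmean, heq] at e3
    have hℓz : ℓ ((1 - t) * x + t * y) = potInterp K N t |y - x| (ℓ x) (ℓ y) := modelPot_interp hrg
    have hℓz' : ℓ ((1 - t) * x + t * y) ≤ toPot N (f ((1 - t) * x + t * y)) := by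
      rw [hℓz]
      exact (potInterp_mono htc (abs_nonneg _) hrg hℓx.le hℓy.le).trans
        (hf.le_toPot hN' hxI hyI htc)
    have gx : g x = toDens N (ℓ x) := by rw [hg, cutoff_of_mem hxI, min_eq_right hℓx.le]
    have gy : g y = toDens N (ℓ y) := by rw [hg, cutoff_of_mem hyI, min_eq_right hℓy.le]
    have gz : g ((1 - t) * x + t * y) = toDens N (potInterp K N t |y - x| (ℓ x) (ℓ y)) := by
      rw [hg, cutoff_of_mem hzI, min_eq_right hℓz', hℓz]
    rw [toDens_toPot hN' (hf.pos x hxI), toDens_toPot hN' (hf.pos y hyI)] at e3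
    rw [toDens_toPot hN' hx, toDens_toPot hN' hy] at e1
    rw [← gx, ← gy, ← gz] at e2
    have rx : r x = f x - g x := rfl
    have ry : r y = f y - g y := rfl
    have rz : r ((1 - t) * x + t * y) = f ((1 - t) * x + t * y) - g ((1 - t) * x + t * y) := rfl
    rw [rmean]
    rw [rz]
    rw [rx, ry] at e1 ⊢
    linarith
  have hmain : ∀ x y, 0 < r x → 0 < r y → ∀ t ∈ Icc (0 : ℝ) 1,
      rmean K N t |y - x| (r x) (r y) ≤ r ((1 - t) * x + t * y) := by
    intro x y hx hy t ht
    have hrg := hf.range_lt (hmem x hx).1 (hmem y hy).1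
    rcases ht.1.eq_or_lt with rfl | h0
    · rw [rmean_zero hN' (abs_nonneg _) hrg hx]; simp
    rcases ht.2.eq_or_lt with rfl | h1
    · rw [rmean_one hN' (abs_nonneg _) hrg hy]; simp
    exact hmain' x y hx hy t ⟨h0, h1⟩
  have hrm : AEMeasurable r := hf.aemeasurable.sub (hf.aemeasurable_cutoff hℓc.measurable)
  have hne : densMeasure r ≠ 0 := by
    -- near `x₀` on the right the potential of `f` stays above `ℓ`, by lower semicontinuity
    obtain ⟨y, hy⟩ := exists_between hx₀.2
    have hyI : y ∈ Ioo a b := ⟨hx₀.1.trans hy.1, hy.2⟩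
    have hrg := hf.range_lt hx₀ hyI
    have hcont : Continuous fun t => potInterp K N t |y - x₀| (toPot N (f x₀)) (toPot N (f y)) -
        ℓ ((1 - t) * x₀ + t * y) :=
      (continuous_potInterp_time (abs_nonneg _) _ _).sub (hℓc.comp (by fun_prop))
    have h0 : 0 < potInterp K N 0 |y - x₀| (toPot N (f x₀)) (toPot N (f y)) -
        ℓ ((1 - 0) * x₀ + 0 * y) := by
      rw [potInterp_zero (abs_nonneg _) hrg, sub_zero, one_mul, zero_mul, add_zero, hℓ,
        modelPot_self]
      linarith
    have h1 : ∀ᶠ t in 𝓝[>] (0 : ℝ), 0 < potInterp K N t |y - x₀| (toPot N (f x₀)) (toPot N (f y)) -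
        ℓ ((1 - t) * x₀ + t * y) :=
      ((hcont.tendsto 0).eventually (lt_mem_nhds h0)).filter_mono nhdsWithin_le_nhds
    obtain ⟨ε, hε, hsub⟩ := mem_nhdsGT_iff_exists_Ioo_subset.1 (h1.and
      (Ioo_mem_nhdsGT (show (0 : ℝ) < 1 by norm_num)))
    have hε : 0 < ε := hε
    have hd : 0 < y - x₀ := by linarith [hy.1]
    refine densMeasure_ne_zero_of_pos hrm (show x₀ < x₀ + ε * (y - x₀) by
      have := mul_pos hε hd; linarith) fun x hx => ?_
    set t := (x - x₀) / (y - x₀) with ht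
    have htε : t ∈ Ioo 0 ε := ⟨div_pos (by linarith [hx.1]) hd, by
      rw [ht, div_lt_iff₀ hd]; linarith [hx.2]⟩
    have ex : x = (1 - t) * x₀ + t * y := by
      have : t * (y - x₀) = x - x₀ := div_mul_cancel₀ _ hd.ne'
      linarith
    obtain ⟨h2, h3⟩ := hsub htε
    have htc := Ioo_subset_Icc_self h3
    rw [ex]
    refine hpos _ (interp_mem_Ioo hx₀ hyI htc) ?_
    have := hf.le_toPot hN' hx₀ hyI htc
    linarith
  obtain ⟨r', a', b', h1, h2, -, h3⟩ := exists_isConcaveDensity (K := K) (N := N) (J := r)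
    (α := a) (β := b) hrm (fun x => sub_nonneg.2 (hf.cutoff_le hN' ℓ x))
    (fun x hx => Ioo_subset_Icc_self (hmem x hx).1)
    (by
      refine convex_iff_ordConnected.1 fun x hx y hy s t hs ht hst => ?_
      have e : s = 1 - t := by linarith
      subst e
      have htc : t ∈ Icc (0 : ℝ) 1 := ⟨ht, by linarith⟩
      exact (rmean_pos hN' htc (abs_nonneg _) (hf.range_lt (hmem x hx).1 (hmem y hy).1)
        hx hy).trans_le
        (hmain x y hx hy t htc))
    (fun x y hx hy => by
      rw [← sq_abs]; exact (hf.range_lt (hmem x hx).1 (hmem y hy).1).le)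
    (fun x y hx hy _ t ht => hmain x y hx hy t ht) hne
  exact ⟨r', a', b', h1, h2, h3⟩

end

/-! ### Extreme measures are models -/

section

variable {K : ℝ} {N : WithTop ℝ} {D : ℝ≥0∞} {f h : ℝ → ℝ} {a b : ℝ}

lemma IsConcaveDensity.continuous_cutoff_slope (hN : N ≤ 0 ∨ 1 < N)
    (hf : IsConcaveDensity K N f a b) {A x₀ : ℝ} (hx₀ : x₀ ∈ Ioo a b) (x : ℝ) :
    Continuous fun c => cutoff N f (modelPot K N A c x₀) a b x := by
  by_cases hx : x ∈ Ioo a b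
  · simp only [cutoff_of_mem hx]
    obtain ⟨p, q, hpq, -, -⟩ := exists_modelPot_slope A (hf.range_lt hx₀ hx)
    simp only [hpq]
    refine continuous_iff_continuousAt.2 fun c => ?_
    refine ContinuousAt.comp (g := toDens N) (continuousAt_toDens hN
      ((mem_potDom_of_le hN (min_le_left _ _) (toPot_mem hN (hf.pos x hx))).imp_right And.left)) ?_
    fun_prop
  · simp only [cutoff_of_notMem hx]
    exact continuous_const

/-- As the slope tends to `∞` (to `-∞`) the cut-offs fill the right (left) side of `x₀` and leave
the other. -/
lemma IsConcaveDensity.tendsto_cutoff (hN : N ≤ 0 ∨ 1 < N)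
    (hf : IsConcaveDensity K N f a b) {A x₀ x : ℝ} (hx₀ : x₀ ∈ Ioo a b) (hx : x ≠ x₀) :
    Tendsto (fun c => cutoff N f (modelPot K N A c x₀) a b x) atTop
      (𝓝 ((Ioi x₀).indicator f x)) ∧
    Tendsto (fun c => cutoff N f (modelPot K N A c x₀) a b x) atBot
      (𝓝 ((Iic x₀).indicator f x)) := by
  by_cases hxI : x ∈ Ioo a b
  · simp only [cutoff_of_mem hxI]
    obtain ⟨p, q, hpq, hq1, hq2⟩ := exists_modelPot_slope A (hf.range_lt hx₀ hxI)
    simp only [hpq]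
    set u := toPot N (f x) with hu
    have hfull : ∀ l : Filter ℝ, Tendsto (fun c => p + q * c) l atTop →
        Tendsto (fun c => toDens N (min u (p + q * c))) l (𝓝 (f x)) := by
      intro l hl
      refine tendsto_const_nhds.congr' ?_
      filter_upwards [hl.eventually_ge_atTop u] with c hc
      rw [min_eq_left hc, hu, toDens_toPot hN (hf.pos x hxI)]
    have hnone : ∀ l : Filter ℝ, Tendsto (fun c => p + q * c) l atBot →
        Tendsto (fun c => toDens N (min u (p + q * c))) l (𝓝 0) := fun l hl =>
      (tendsto_toDens_atBot hN).comp (tendsto_atBot_mono (fun c => min_le_right _ _) hl)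
    rcases lt_or_gt_of_ne hx with hlt | hlt
    · have hq := hq2 hlt
      rw [indicator_of_notMem (by simpa using hlt.le), indicator_of_mem
        (show x ∈ Iic x₀ from hlt.le)]
      exact ⟨hnone _ (tendsto_atBot_add_const_left _ _ (tendsto_id.const_mul_atTop_of_neg hq)),
        hfull _ (tendsto_atTop_add_const_left _ _ (tendsto_id.const_mul_atBot_of_neg hq))⟩
    · have hq := hq1 hlt
      rw [indicator_of_mem (show x ∈ Ioi x₀ from hlt), indicator_of_notMem (by simpa using hlt)]
      exact ⟨hfull _ (tendsto_atTop_add_const_left _ _ (tendsto_id.const_mul_atTop hq)),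
        hnone _ (tendsto_atBot_add_const_left _ _ (tendsto_id.const_mul_atBot hq))⟩
  · have h0 := hf.eq_zero x hxI
    simp only [cutoff_of_notMem hxI]
    have h1 : (Ioi x₀).indicator f x = 0 := by simp [indicator, h0]
    have h2 : (Iic x₀).indicator f x = 0 := by simp [indicator, h0]
    rw [h1, h2]
    exact ⟨tendsto_const_nhds, tendsto_const_nhds⟩

/-- Some cut-off satisfies the linear constraint, by the intermediate value theorem in the slope. -/
lemma IsConcaveDensity.exists_slope (hN : N ≤ 0 ∨ 1 < N)
    (hf : IsConcaveDensity K N f a b) (hfi : Integrable f) (hm : Measurable h) {C : ℝ}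
    (hC : ∀ x, |h x| ≤ C) {A x₀ : ℝ} (hx₀ : x₀ ∈ Ioo a b) (hfh : ∫ x, f x * h x = 0)
    (hne : ∫ x in Iic x₀, f x * h x ≠ 0) :
    ∃ c, ∫ x, cutoff N f (modelPot K N A c x₀) a b x * h x = 0 := by
  set g : ℝ → ℝ → ℝ := fun c => cutoff N f (modelPot K N A c x₀) a b with hg
  have hmeas : ∀ c, AEStronglyMeasurable (fun x => g c x * h x) := fun c =>
    ((hf.aemeasurable_cutoff (continuous_modelPot K N A c x₀).measurable).mul
      hm.aemeasurable).aestronglyMeasurable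
  have hbound : ∀ c, ∀ x, ‖g c x * h x‖ ≤ f x * C := fun c x => by
    rw [norm_mul, Real.norm_eq_abs, Real.norm_eq_abs, abs_of_nonneg (hf.cutoff_nonneg hN _ x)]
    exact mul_le_mul (hf.cutoff_le hN _ x) (hC x) (abs_nonneg _) (hf.nonneg x)
  have hcont : Continuous fun c => ∫ x, g c x * h x :=
    continuous_of_dominated hmeas (fun c => ae_of_all _ (hbound c)) (hfi.mul_const C)
      (ae_of_all _ fun x => (hf.continuous_cutoff_slope hN hx₀ x).mul continuous_const)
  have hlim : ∀ (l : Filter ℝ) [l.IsCountablyGenerated] (S : Set ℝ), MeasurableSet S →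
      (∀ x, x ≠ x₀ → Tendsto (fun c => g c x) l (𝓝 (S.indicator f x))) →
      Tendsto (fun c => ∫ x, g c x * h x) l (𝓝 (∫ x in S, f x * h x)) := by
    intro l _ S hS hl
    have h1 : ∫ x in S, f x * h x = ∫ x, S.indicator f x * h x := by
      rw [← integral_indicator hS]
      congr 1
      funext x
      by_cases hx : x ∈ S <;> simp [hx]
    rw [h1]
    refine tendsto_integral_filter_of_dominated_convergence (fun x => f x * C)
      (Eventually.of_forall hmeas) (Eventually.of_forall fun c => ae_of_all _ (hbound c))
      (hfi.mul_const C) ?_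
    filter_upwards [Measure.ae_ne volume x₀] with x hx
    exact (hl x hx).mul tendsto_const_nhds
  have hT := hlim atTop (Ioi x₀) measurableSet_Ioi fun x hx => (hf.tendsto_cutoff hN hx₀ hx).1
  have hB := hlim atBot (Iic x₀) measurableSet_Iic fun x hx => (hf.tendsto_cutoff hN hx₀ hx).2
  have hsum : (∫ x in Iic x₀, f x * h x) + ∫ x in Ioi x₀, f x * h x = 0 := by
    rw [← compl_Iic, integral_add_compl measurableSet_Iic (integrable_mul_of_bounded hfi hm hC),
      hfh]
  set G := ∫ x in Iic x₀, f x * h x with hG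
  have hI : ∫ x in Ioi x₀, f x * h x = -G := by linarith
  rw [hI] at hT
  have : (0 : ℝ) ∈ Set.range fun c => ∫ x, g c x * h x := by
    rcases lt_or_gt_of_ne hne with h0 | h0
    · obtain ⟨c₁, h1⟩ := (hB.eventually (gt_mem_nhds h0)).exists
      obtain ⟨c₂, h2⟩ := (hT.eventually (lt_mem_nhds (show 0 < -G by linarith))).exists
      exact mem_range_of_exists_le_of_exists_ge hcont ⟨c₁, h1.le⟩ ⟨c₂, h2.le⟩
    · obtain ⟨c₁, h1⟩ := (hB.eventually (lt_mem_nhds h0)).exists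
      obtain ⟨c₂, h2⟩ := (hT.eventually (gt_mem_nhds (show -G < 0 by linarith))).exists
      exact mem_range_of_exists_le_of_exists_ge hcont ⟨c₂, h2.le⟩ ⟨c₁, h1.le⟩
  obtain ⟨c, hc⟩ := this
  exact ⟨c, hc⟩

lemma exists_mem_Ioo_of_ae {P : ℝ → Prop} (hP : ∀ᵐ x, x ∈ Ioo a b → P x) {p q : ℝ} (hpq : p < q)
    (hp : a ≤ p) (hq : q ≤ b) : ∃ x ∈ Ioo p q, P x := by
  by_contra! hc
  have : volume (Ioo p q) = 0 := by
    rw [measure_eq_zero_iff_ae_notMem]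
    filter_upwards [hP] with x hx hxI
    exact hc x hxI (hx (Ioo_subset_Ioo hp hq hxI))
  rw [Real.volume_Ioo, ENNReal.ofReal_eq_zero] at this
  linarith

/-- A concave density that coincides up to a factor with a model density below it defines a
model measure. -/
lemma IsConcaveDensity.isModel (hN : N ≤ 0 ∨ 1 < N) (hf : IsConcaveDensity K N f a b)
    {I : Set ℝ} (hsyn : IsSynthetic K N D I (densMeasure f)) {A x₀ c k : ℝ}
    (hk : k ∈ Ioo (0 : ℝ) 1)
    (heq : cutoff N f (modelPot K N A c x₀) a b =ᵐ[volume] fun x => k * f x) :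
    IsModel K N D I (densMeasure f) := by
  set ℓ := modelPot K N A c x₀ with hℓ
  have hℓc : Continuous ℓ := continuous_modelPot K N A c x₀
  have hae : ∀ᵐ x, x ∈ Ioo a b → ℓ x ∈ potDom N ∧ f x = k⁻¹ * toDens N (ℓ x) := by
    filter_upwards [heq] with x hx hxI
    have hfx := hf.pos x hxI
    rw [cutoff_of_mem hxI] at hx
    -- where the model density is above `f` the cut-off equals `f`, not `k f`
    have hlt : ℓ x < toPot N (f x) := by
      by_contra! hle
      rw [min_eq_left hle, toDens_toPot hN hfx] at hx
      nlinarith [hk.2]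
    rw [min_eq_right hlt.le] at hx
    refine ⟨?_, by rw [hx, inv_mul_cancel_left₀ hk.1.ne']⟩
    rcases mem_potDom_of_le hN hlt.le (toPot_mem hN hfx) with h1 | h1
    · exact h1
    · rw [h1.2] at hx
      exact absurd hx (mul_pos hk.1 hfx).ne
  have hdom : ∀ z ∈ Ioo a b, ℓ z ∈ potDom N := by
    intro z hz
    obtain ⟨x, hx, hx', -⟩ := exists_mem_Ioo_of_ae hae hz.1 le_rfl hz.2.le
    obtain ⟨y, hy, hy', -⟩ := exists_mem_Ioo_of_ae hae hz.2 hz.1.le le_rfl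
    have hxI : x ∈ Ioo a b := ⟨hx.1, hx.2.trans hz.2⟩
    have hyI : y ∈ Ioo a b := ⟨hz.1.trans hy.1, hy.2⟩
    have hd : 0 < y - x := by linarith [hx.2, hy.1]
    set t := (z - x) / (y - x) with ht
    have htc : t ∈ Icc (0 : ℝ) 1 := ⟨div_nonneg (by linarith [hx.2]) hd.le, by
      rw [ht, div_le_one hd]; linarith [hy.1]⟩
    have ez : z = (1 - t) * x + t * y := by
      have : t * (y - x) = z - x := div_mul_cancel₀ _ hd.ne'
      linarith
    have hr := hf.range_lt hxI hyI
    rw [ez, hℓ, modelPot_interp hr]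
    exact potInterp_mem hN htc (abs_nonneg _) hr hx' hy'
  set J : ℝ → ℝ := (Ioo a b).indicator fun x => k⁻¹ * toDens N (ℓ x) with hJ
  have hJmem : ∀ x ∈ Ioo a b, J x = k⁻¹ * toDens N (ℓ x) := fun x hx => indicator_of_mem hx _
  have hJpos : ∀ x ∈ Ioo a b, 0 < J x := fun x hx => by
    rw [hJmem x hx]
    exact mul_pos (inv_pos.2 hk.1) (toDens_pos hN (hdom x hx))
  refine ⟨hsyn.finite, hf.ne_zero, hsyn.support_subset, ?_, ⟨J, ?_, ?_, ?_, ?_⟩, hsyn.diam_le⟩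
  · rw [hf.support_eq]; exact ordConnected_Icc
  · exact (((measurable_toDens N).comp hℓc.measurable).const_mul _).indicator measurableSet_Ioo
  · intro x
    by_cases hx : x ∈ Ioo a b
    · exact (hJpos x hx).le
    · rw [hJ, indicator_of_notMem hx]
  · refine densMeasure_congr ?_
    filter_upwards [hae] with x hx
    by_cases hxI : x ∈ Ioo a b
    · rw [hJmem x hxI, (hx hxI).2]
    · rw [hJ, indicator_of_notMem hxI, hf.eq_zero x hxI]
  · rw [hf.support_eq, interior_Icc]
    intro x hx y hy t ht
    have hr := hf.range_lt hx hy
    rw [distMean_eq hN ht (abs_nonneg _) hr (hJpos x hx) (hJpos y hy), hJmem _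
      (interp_mem_Ioo hx hy ht),
      hJmem x hx, hJmem y hy, rmean_smul hN ht (abs_nonneg _) hr (toDens_pos hN (hdom x hx))
        (toDens_pos hN (hdom y hy)) (inv_pos.2 hk.1), rmean, toPot_toDens hN (hdom x hx),
      toPot_toDens hN (hdom y hy), hℓ, modelPot_interp hr]

theorem mem_modelProb_of_mem_extremePoints (hN : N ≤ 0 ∨ 2 ≤ N) (hm : Measurable h) {C : ℝ}
    (hC : ∀ x, |h x| ≤ C) (hext : densMeasure f ∈ extremePoints ℝ≥0 (synthProb K N D h))
    (hf : IsConcaveDensity K N f a b) (hfi : Integrable f) :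
    densMeasure f ∈ modelProb K N D h := by
  have hN' : N ≤ 0 ∨ 1 < N := hN.imp_right fun h => lt_of_lt_of_le (by norm_num) h
  obtain ⟨hprob, hsyn, hzero⟩ := hext.1
  have hcut : ∀ x ∈ Ioo a b, ∫ y in Iic x, f y * h y ≠ 0 := fun x hx =>
    setIntegral_Iic_ne_zero hN' hm hC hext hf hfi hx
  refine ⟨hprob, ?_, hzero, ?_⟩
  · obtain ⟨x₀, hx₀⟩ := exists_between hf.lt
    have hx₀ : x₀ ∈ Ioo a b := hx₀
    have hfx := hf.pos x₀ hx₀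
    -- any height strictly between `0` and `f x₀` makes both parts of `f` nonzero
    set A := toPot N (f x₀ / 2) with hA
    have hAmem : A ∈ potDom N := toPot_mem hN' (half_pos hfx)
    have hAlt : A < toPot N (f x₀) := toPot_lt hN' (half_pos hfx) (half_lt_self hfx)
    rw [integral_densMeasure hf.aemeasurable hf.nonneg] at hzero
    obtain ⟨c, hc⟩ := hf.exists_slope hN' hfi hm hC (A := A) hx₀ hzero (hcut x₀ hx₀)
    obtain ⟨g', a₀, b₀, hg', hgg', hs₀⟩ := hf.exists_cutoff (c := c) hN' hx₀ hAmem
    obtain ⟨r', a₁, b₁, hr', hrr', hs₁⟩ := hf.exists_sub_cutoff (c := c) hN hx₀ hAlt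
    obtain ⟨k, hk, hkf⟩ := eq_smul_of_mem_extremePoints hN' hm hC hext hf hfi hg' hr' hgg' hrr'
      hs₀ hs₁ hc
    exact hf.isModel hN' hsyn hk hkf
  · rw [hf.support_eq, interior_Icc]
    intro x hx
    rw [setIntegral_densMeasure hf.aemeasurable hf.nonneg h measurableSet_Iic]
    exact hcut x hx

end

/-! ### Monotone weights and a primitive of constant sign -/

/-- Layer-cake argument: the integral of `g Ψ` is an average of the integrals of `g` over the
superlevel sets of `Ψ`, which are half-lines. -/
lemma eq_of_integral_mul_monotone_eq_zero {g Ψ : ℝ → ℝ} {a b C : ℝ} (hg : Integrable g)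
    (hΨ : Monotone Ψ) (h0 : ∀ x, 0 ≤ Ψ x) (hC : ∀ x, Ψ x ≤ C)
    (hG : ∀ x, 0 ≤ ∫ y in Iic x, g y) (hpos : ∀ x ∈ Ioo a b, 0 < ∫ y in Iic x, g y)
    (htot : ∫ x, g x = 0) (hz : ∫ x, g x * Ψ x = 0) {x y : ℝ} (hx : x ∈ Ioo a b)
    (hy : y ∈ Ioo a b) (hxy : x ≤ y) : Ψ x = Ψ y := by
  refine (hΨ hxy).antisymm ?_
  by_contra! hlt
  set I : ℝ → ℝ := fun c => ∫ z in {z | c < Ψ z}, g z with hI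
  have hmeasU : ∀ c, MeasurableSet {z | c < Ψ z} := fun c =>
    measurableSet_lt measurable_const hΨ.measurable
  have htail : ∀ q, ∫ z in Ioi q, g z = -∫ z in Iic q, g z := fun q => by
    have := integral_add_compl (measurableSet_Iic (a := q)) hg
    rw [htot, compl_Iic] at this
    linarith
  -- up to a null set a superlevel set of `Ψ` is a half-line
  have hcases : ∀ c, {z | c < Ψ z}.Nonempty → BddBelow {z | c < Ψ z} →
      I c = -∫ z in Iic (sInf {z | c < Ψ z}), g z := by
    intro c hne hbd
    rw [← htail, hI]
    refine setIntegral_congr_set ?_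
    filter_upwards [Measure.ae_ne volume (sInf {z | c < Ψ z})] with z hzq
    refine propext ⟨fun h => lt_of_le_of_ne (csInf_le hbd h) (Ne.symm hzq), fun h => ?_⟩
    obtain ⟨w, hw, hwz⟩ := exists_lt_of_csInf_lt hne h
    exact lt_of_lt_of_le hw (hΨ hwz.le)
  have hnonpos : ∀ c, I c ≤ 0 := by
    intro c
    rcases eq_empty_or_nonempty {z | c < Ψ z} with he | hne
    · simp only [hI, he, setIntegral_empty, le_refl]
    by_cases hbd : BddBelow {z | c < Ψ z}
    · rw [hcases c hne hbd]
      linarith [hG (sInf {z | c < Ψ z})]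
    · have : {z | c < Ψ z} = univ := by
        refine eq_univ_of_forall fun z => ?_
        obtain ⟨w, hw, hwz⟩ := not_bddBelow_iff.1 hbd z
        exact lt_of_lt_of_le hw (hΨ hwz.le)
      simp only [hI, this, setIntegral_univ, htot, le_refl]
  have hneg : ∀ c ∈ Ioo (Ψ x) (Ψ y), I c < 0 := by
    intro c hc
    have hlow : ∀ z ∈ {z | c < Ψ z}, x ≤ z := fun z hz => by
      by_contra! hzx
      exact absurd (hΨ hzx.le) (not_le.2 (hc.1.trans hz))
    have hne : {z | c < Ψ z}.Nonempty := ⟨y, hc.2⟩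
    rw [hcases c hne ⟨x, hlow⟩]
    have := hpos (sInf {z | c < Ψ z}) ⟨hx.1.trans_le (le_csInf hne hlow),
      (csInf_le ⟨x, hlow⟩ (show y ∈ {z | c < Ψ z} from hc.2)).trans_lt hy.2⟩
    linarith
  -- write `Ψ z` as the length of `{c ∈ (0, C] | c < Ψ z}` and exchange the integrals
  have hfub : Integrable (Function.uncurry fun (z c : ℝ) => {z | c < Ψ z}.indicator g z)
      (volume.prod (volume.restrict (Ioc 0 C))) := by
    have h1 : Integrable (fun p : ℝ × ℝ => g p.1 * 1)
        (volume.prod (volume.restrict (Ioc 0 C))) := hg.mul_prod (integrable_const 1)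
    simp only [mul_one] at h1
    have hm : MeasurableSet {p : ℝ × ℝ | p.2 < Ψ p.1} :=
      measurableSet_lt measurable_snd (hΨ.measurable.comp measurable_fst)
    refine (h1.indicator hm).congr (ae_of_all _ fun p => ?_)
    simp only [Function.uncurry, indicator, mem_ofPred_eq]
  have hinner : ∀ z, ∫ c in Ioc 0 C, {z | c < Ψ z}.indicator g z = g z * Ψ z := by
    intro z
    have e : (fun c => {z | c < Ψ z}.indicator g z) = (Iio (Ψ z)).indicator fun _ => g z := by
      funext c
      simp only [indicator, mem_ofPred_eq, mem_Iio]
    rw [e, setIntegral_indicator measurableSet_Iio, setIntegral_const]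
    have e2 : volume.real (Ioc 0 C ∩ Iio (Ψ z)) = Ψ z := by
      have : Ioc 0 C ∩ Iio (Ψ z) = Ioo 0 (Ψ z) := by
        ext c
        simp only [mem_inter_iff, mem_Ioc, mem_Iio, mem_Ioo]
        exact ⟨fun h => ⟨h.1.1, h.2⟩, fun h => ⟨⟨h.1, h.2.le.trans (hC z)⟩, h.2⟩⟩
      rw [this, Real.volume_real_Ioo_of_le (h0 z), sub_zero]
    rw [e2, smul_eq_mul, mul_comm]
  have hswap := integral_integral_swap hfub
  simp only [hinner, hz] at hswap
  have hII : ∀ c, ∫ z, {z | c < Ψ z}.indicator g z = I c := fun c => integral_indicator (hmeasU c)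
  simp only [hII] at hswap
  have hint : IntegrableOn I (Ioc 0 C) := by
    have := hfub.integral_prod_right
    simp only [Function.uncurry, hII] at this
    exact this
  have hae : (fun c => -I c) =ᵐ[volume.restrict (Ioc 0 C)] 0 := by
    rw [← integral_eq_zero_iff_of_nonneg (fun c => neg_nonneg.2 (hnonpos c)) hint.neg,
      integral_neg, ← hswap, neg_zero]
  have hv : volume (Ioo (Ψ x) (Ψ y)) = 0 := by
    rw [measure_eq_zero_iff_ae_notMem]
    filter_upwards [(ae_restrict_iff' measurableSet_Ioc).1 hae] with c hc hcI
    have h1 := hc ⟨(h0 x).trans_lt hcI.1, hcI.2.le.trans (hC y)⟩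
    have h2 := hneg c hcI
    simp only [Pi.zero_apply] at h1
    linarith
  rw [Real.volume_Ioo, ENNReal.ofReal_eq_zero] at hv
  linarith

/-- A nowhere vanishing primitive on an interval has constant sign. -/
lemma setIntegral_Iic_sign {g : ℝ → ℝ} {a b : ℝ} (hg : Integrable g)
    (hne : ∀ x ∈ Ioo a b, ∫ y in Iic x, g y ≠ 0) :
    (∀ x ∈ Ioo a b, 0 < ∫ y in Iic x, g y) ∨ ∀ x ∈ Ioo a b, ∫ y in Iic x, g y < 0 := by
  have hcont : Continuous fun x => ∫ y in Iic x, g y := by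
    have h1 := (intervalIntegral.continuous_primitive (fun p q => hg.intervalIntegrable) 0).add
      (continuous_const (y := ∫ y in Iic 0, g y))
    refine h1.congr fun x => ?_
    simp only [Pi.add_apply]
    rw [← intervalIntegral.integral_Iic_sub_Iic hg.integrableOn hg.integrableOn, sub_add_cancel]
  by_contra! hc
  obtain ⟨⟨x, hx, hx0⟩, y, hy, hy0⟩ := hc
  obtain ⟨z, hz, hz0⟩ := isPreconnected_Ioo.intermediate_value hx hy hcont.continuousOn
    (show (0 : ℝ) ∈ Icc _ _ from ⟨hx0, hy0⟩)
  exact hne z hz hz0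

/-- If the ratio of two densities `f₀` and `f` is monotone and both satisfy a linear constraint
whose primitive against `f` does not vanish, the ratio is constant. -/
lemma ae_eq_of_monotoneOn_ratio {f f₀ h : ℝ → ℝ} {a b C : ℝ} {Z : Set ℝ} (hZ : Z ⊆ Ioo a b)
    (hZae : ∀ᵐ x, x ∈ Ioo a b → x ∈ Z) (hfpos : ∀ x ∈ Ioo a b, 0 < f x)
    (hf0 : ∀ x ∉ Ioo a b, f x = 0) (hf₀0 : ∀ᵐ x, x ∉ Ioo a b → f₀ x = 0)
    (hf₀ : ∀ x, 0 ≤ f₀ x) (hC : ∀ x ∈ Z, f₀ x / f x ≤ C)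
    (hmono : MonotoneOn (fun x => f₀ x / f x) Z) (hab : a < b)
    (hfhi : Integrable fun x => f x * h x)
    (htot : ∫ x, f x * h x = 0) (htot₀ : ∫ x, f₀ x * h x = 0)
    (hne : ∀ x ∈ Ioo a b, ∫ y in Iic x, f y * h y ≠ 0)
    (hone : ∫ x, f x = 1) (hone₀ : ∫ x, f₀ x = 1) : f₀ =ᵐ[volume] f := by
  have hratio0 : ∀ x, 0 ≤ f₀ x / f x := fun x => by
    by_cases hx : x ∈ Ioo a b
    · exact div_nonneg (hf₀ x) (hfpos x hx).le
    · rw [hf0 x hx, div_zero]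
  obtain ⟨Φ, hΦm, hΦ⟩ := hmono.exists_monotone_extension
    ⟨0, by rintro _ ⟨x, -, rfl⟩; exact hratio0 x⟩ ⟨C, by rintro _ ⟨x, hx, rfl⟩; exact hC x hx⟩
  -- Truncation makes the monotone extension bounded on the whole line.
  set Ψ : ℝ → ℝ := fun x => max 0 (min (max C 0) (Φ x)) with hΨ
  have hΨm : Monotone Ψ := fun x y hxy => max_le_max le_rfl (min_le_min le_rfl (hΦm hxy))
  have hΨZ : ∀ x ∈ Z, Ψ x * f x = f₀ x := fun x hx => by
    have h1 : Φ x = f₀ x / f x := (hΦ hx).symm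
    have h2 : Ψ x = f₀ x / f x := by
      rw [hΨ]
      simp only [h1]
      rw [min_eq_right ((hC x hx).trans (le_max_left _ _)), max_eq_right (hratio0 x)]
    rw [h2, div_mul_cancel₀ _ (hfpos x (hZ hx)).ne']
  have hae : ∀ᵐ x, f₀ x = Ψ x * f x := by
    filter_upwards [hZae, hf₀0] with x h1 h2
    by_cases hx : x ∈ Ioo a b
    · exact (hΨZ x (h1 hx)).symm
    · rw [h2 hx, hf0 x hx, mul_zero]
  have hzero : ∫ x, f x * h x * Ψ x = 0 := by
    rw [← htot₀]
    refine integral_congr_ae ?_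
    filter_upwards [hae] with x hx
    rw [hx]; ring
  have hout : ∀ x ∉ Ioo a b, ∫ y in Iic x, f y * h y = 0 := by
    intro x hx
    rcases le_or_gt x a with h1 | h1
    · refine setIntegral_eq_zero_of_forall_eq_zero fun y hy => ?_
      rw [hf0 y fun h2 => absurd (h2.1.trans_le hy) (not_lt.2 h1), zero_mul]
    · have hxb : b ≤ x := by
        by_contra! h2
        exact hx ⟨h1, h2⟩
      rw [setIntegral_eq_integral_of_forall_compl_eq_zero, htot]
      intro y hy
      rw [hf0 y fun h2 => hy (h2.2.le.trans hxb), zero_mul]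
  have hconst : ∀ x ∈ Ioo a b, ∀ y ∈ Ioo a b, x ≤ y → Ψ x = Ψ y := by
    intro x hx y hy hxy
    have hΨ0 : ∀ x, 0 ≤ Ψ x := fun x => le_max_left _ _
    have hΨC : ∀ x, Ψ x ≤ max C 0 := fun x => max_le (le_max_right _ _) (min_le_left _ _)
    rcases setIntegral_Iic_sign hfhi hne with hs | hs
    · refine eq_of_integral_mul_monotone_eq_zero hfhi hΨm hΨ0 hΨC (fun x => ?_) hs htot hzero
        hx hy hxy
      by_cases hx : x ∈ Ioo a b
      · exact (hs x hx).le
      · exact (hout x hx).ge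
    · refine eq_of_integral_mul_monotone_eq_zero (g := fun x => -(f x * h x)) hfhi.neg hΨm hΨ0 hΨC
        (fun x => ?_) (fun x hx => ?_) ?_ ?_ hx hy hxy
      · rw [integral_neg]
        by_cases hx : x ∈ Ioo a b
        · linarith [hs x hx]
        · linarith [hout x hx]
      · rw [integral_neg]
        linarith [hs x hx]
      · rw [integral_neg, htot, neg_zero]
      · simp only [neg_mul]
        rw [integral_neg, hzero, neg_zero]
  obtain ⟨m, hm⟩ := exists_between hab
  have hm : m ∈ Ioo a b := hm
  have hae' : f₀ =ᵐ[volume] fun x => Ψ m * f x := by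
    filter_upwards [hae] with x hx
    rw [hx]
    by_cases hxI : x ∈ Ioo a b
    · rcases le_total x m with h1 | h1
      · rw [hconst x hxI m hm h1]
      · rw [hconst m hm x hxI h1]
    · rw [hf0 x hxI, mul_zero, mul_zero]
  have hκ : Ψ m = 1 := by
    rw [integral_congr_ae hae', integral_const_mul, hone, mul_one] at hone₀
    exact hone₀
  rw [hκ] at hae'
  simpa only [one_mul] using hae'

/-- Two quasi-concave functions with constant weighted sum are monotone, in opposite directions. -/
lemma monotoneOn_or_monotoneOn_of_quasi {φ ψ : ℝ → ℝ} {Z : Set ℝ} {s t : ℝ} (hs : 0 < s)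
    (ht : 0 < t) (hsum : ∀ x ∈ Z, s * φ x + t * ψ x = 1)
    (hφ : ∀ x ∈ Z, ∀ z ∈ Z, ∀ y ∈ Z, x < z → z < y → min (φ x) (φ y) ≤ φ z)
    (hψ : ∀ x ∈ Z, ∀ z ∈ Z, ∀ y ∈ Z, x < z → z < y → min (ψ x) (ψ y) ≤ ψ z) :
    MonotoneOn φ Z ∨ MonotoneOn ψ Z := by
  have hlt : ∀ x ∈ Z, ∀ y ∈ Z, φ x < φ y → ψ y < ψ x := fun x hx y hy h => by
    have h1 := hsum x hx
    have h2 := hsum y hy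
    by_contra! hc
    nlinarith
  have hmono : MonotoneOn φ Z ∨ AntitoneOn φ Z := by
    by_contra! hc
    obtain ⟨x, hx, z, hz, y, hy, hxz, hzy, hd⟩ :=
      not_monotoneOn_not_antitoneOn_iff_exists_lt_lt.1 hc
    rcases hd with ⟨h1, h2⟩ | ⟨h1, h2⟩
    · exact absurd (hψ x hx z hz y hy hxz hzy)
        (not_le.2 (lt_min (hlt x hx z hz h1) (hlt y hy z hz h2)))
    · exact absurd (hφ x hx z hz y hy hxz hzy) (not_le.2 (lt_min h1 h2))
  refine hmono.imp_right fun h x hx y hy hxy => ?_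
  have h1 := hsum x hx
  have h2 := hsum y hy
  have h3 := h hx hy hxy
  by_contra! hc
  nlinarith

/-! ### Models are extreme -/

section

variable {K : ℝ} {N : WithTop ℝ} {D : ℝ≥0∞} {h : ℝ → ℝ}

lemma distMean_of_mul_eq_zero {t d a b : ℝ} (h : a * b = 0) : distMean K N t d a b = 0 := by
  simp [distMean.eq_def, h]

/-- The density of a model measure is a concave density, with equality in its defining
inequality. -/
lemma IsModel.exists_isConcaveDensity (hN : N ≤ 0 ∨ 1 < N) {I : Set ℝ} {ξ : Measure ℝ}
    (h : IsModel K N D I ξ) {α β : ℝ} (hI : I ⊆ Icc α β) :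
    ∃ f a b, IsConcaveDensity K N f a b ∧ Integrable f ∧ ξ = densMeasure f ∧
      ∀ x ∈ Ioo a b, ∀ y ∈ Ioo a b, ∀ t ∈ Icc (0 : ℝ) 1,
        rmean K N t |y - x| (f x) (f y) = f ((1 - t) * x + t * y) := by
  have := h.finite
  obtain ⟨J, hJm, hJ0, hξ, hJ⟩ := h.density
  have hac : ξ ≪ volume := hξ ▸ withDensity_absolutelyContinuous _ _
  have hcpt : IsCompact ξ.support :=
    isCompact_Icc.of_isClosed_subset Measure.isClosed_support (h.support_subset.trans hI)
  have hnon : ξ.support.Nonempty := Measure.nonempty_support h.ne_zero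
  obtain ⟨a, b, hab, hsupp⟩ : ∃ a b, a ≤ b ∧ ξ.support = Icc a b := by
    have ha := hcpt.sInf_mem hnon
    have hb := hcpt.sSup_mem hnon
    refine ⟨sInf ξ.support, sSup ξ.support, csInf_le hcpt.bddBelow hb, ?_⟩
    exact Subset.antisymm
      (fun x hx => ⟨csInf_le hcpt.bddBelow hx, le_csSup hcpt.bddAbove hx⟩)
      (h.support_interval.out ha hb)
  have hnull : ξ (Ioo a b)ᶜ = 0 := by
    have h1 : ξ (Icc a b)ᶜ = 0 := hsupp ▸ Measure.measure_compl_support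
    have h2 : ξ {a, b} = 0 := hac ((Set.toFinite {a, b}).measure_zero volume)
    refine measure_mono_null (fun x hx => ?_) (measure_union_null h1 h2)
    by_cases hx' : x ∈ Icc a b
    · right
      rcases hx'.1.eq_or_lt with rfl | h3
      · exact mem_insert _ _
      · rcases hx'.2.eq_or_lt with rfl | h4
        · exact mem_insert_of_mem _ rfl
        · exact absurd ⟨h3, h4⟩ hx
    · exact Or.inl hx'
  have hlt : a < b := by
    by_contra! hc
    rw [Ioo_eq_empty (not_lt.2 hc), compl_empty] at hnull
    exact h.ne_zero (Measure.measure_univ_eq_zero.1 hnull)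
  rw [hsupp, interior_Icc] at hJ
  set f : ℝ → ℝ := (Ioo a b).indicator J with hf
  have hfJ : ∀ x ∈ Ioo a b, f x = J x := fun x hx => indicator_of_mem hx J
  have hfξ : ξ = densMeasure f := by
    have h1 : ξ = ξ.restrict (Ioo a b) := (Measure.restrict_eq_self_of_ae_mem (by
      rw [ae_iff]; exact hnull)).symm
    rw [h1, hξ, restrict_withDensity measurableSet_Ioo, ← withDensity_indicator measurableSet_Ioo]
    unfold densMeasure
    congr 1
    funext x
    by_cases hx : x ∈ Ioo a b
    · rw [indicator_of_mem hx, hfJ x hx]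
    · rw [indicator_of_notMem hx, hf, indicator_of_notMem hx, ENNReal.ofReal_zero]
  have hf0 : ∀ x, 0 ≤ f x := indicator_nonneg fun x _ => hJ0 x
  have hfm : Measurable f := hJm.indicator measurableSet_Ioo
  have hJpos : ∀ x ∈ Ioo a b, 0 < J x := by
    intro x hx
    refine (hJ0 x).lt_of_ne' fun hx0 => h.ne_zero ?_
    -- The relation at time one propagates a zero to the whole interval.
    have hz : f = fun _ => 0 := by
      funext y
      by_cases hy : y ∈ Ioo a b
      · have h1 := hJ x hx y hy 1 ⟨zero_le_one, le_rfl⟩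
        rw [distMean_of_mul_eq_zero (by rw [hx0, zero_mul]), ENNReal.ofReal_eq_zero] at h1
        rw [hfJ y hy]
        have e : (1 - 1) * x + 1 * y = y := by ring
        rw [e] at h1
        exact h1.antisymm (hJ0 y)
      · exact indicator_of_notMem hy J
    rw [hfξ, hz, densMeasure]
    simp
  have hrange : ∀ x ∈ Ioo a b, ∀ y ∈ Ioo a b, delta K N * |y - x| ^ 2 < Real.pi ^ 2 := by
    intro x hx y hy
    by_contra! hc
    have hhalf : (1 / 2 : ℝ) ∈ Icc (0 : ℝ) 1 := ⟨by norm_num, by norm_num⟩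
    have h1 := hJ x hx y hy _ hhalf
    rw [distMean_out_of_range hc (hJpos x hx) (hJpos y hy)] at h1
    split_ifs at h1
    · exact ENNReal.ofReal_ne_top h1
    · exact absurd (ENNReal.ofReal_eq_zero.1 h1)
        (not_le.2 (hJpos _ (interp_mem_Ioo hx hy hhalf)))
  have heq : ∀ x ∈ Ioo a b, ∀ y ∈ Ioo a b, ∀ t ∈ Icc (0 : ℝ) 1,
      rmean K N t |y - x| (f x) (f y) = f ((1 - t) * x + t * y) := by
    intro x hx y hy t ht
    have hxy := interp_mem_Ioo hx hy ht
    rw [hfJ x hx, hfJ y hy, hfJ _ hxy]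
    have h1 := hJ x hx y hy t ht
    have hr := hrange x hx y hy
    rw [distMean_eq hN ht (abs_nonneg _) hr (hJpos x hx) (hJpos y hy)] at h1
    exact ((ENNReal.ofReal_eq_ofReal_iff (hJ0 _)
      (rmean_pos hN ht (abs_nonneg _) hr (hJpos x hx) (hJpos y hy)).le).1 h1).symm
  refine ⟨f, a, b, ⟨hlt, hfm.aemeasurable, fun x hx => by rw [hfJ x hx]; exact hJpos x hx,
    fun x hx => indicator_of_notMem hx J, ?_, fun x hx y hy t ht => (heq x hx y hy t ht).le⟩,
    ⟨hfm.aestronglyMeasurable, ?_⟩, hfξ, heq⟩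
  · have hlim : Tendsto (fun ε : ℝ => delta K N * ((b - ε) - (a + ε)) ^ 2) (𝓝[>] 0)
        (𝓝 (delta K N * ((b - 0) - (a + 0)) ^ 2)) :=
      (Continuous.tendsto (by fun_prop) 0).mono_left nhdsWithin_le_nhds
    rw [sub_zero, add_zero] at hlim
    refine le_of_tendsto hlim ?_
    filter_upwards [Ioo_mem_nhdsGT (show (0 : ℝ) < (b - a) / 2 by linarith)] with ε hε
    have h1 := hrange (a + ε) ⟨by linarith [hε.1], by linarith [hε.2]⟩ (b - ε)
      ⟨by linarith [hε.2], by linarith [hε.1]⟩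
    rw [sq_abs] at h1
    exact h1.le
  · rw [hasFiniteIntegral_iff_ofReal (ae_of_all _ hf0)]
    have h1 := measure_lt_top ξ univ
    rw [hfξ, densMeasure, withDensity_apply _ MeasurableSet.univ, setLIntegral_univ] at h1
    exact h1

/-- A concave density divided by a model density is quasi-concave. -/
lemma min_div_le_div (hN : N ≤ 0 ∨ 1 < N) {f g : ℝ → ℝ} {a b a' b' x y z : ℝ}
    (hf : IsConcaveDensity K N f a b) (hg : IsConcaveDensity K N g a' b')
    (heq : ∀ x ∈ Ioo a b, ∀ y ∈ Ioo a b, ∀ t ∈ Icc (0 : ℝ) 1,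
      rmean K N t |y - x| (f x) (f y) = f ((1 - t) * x + t * y))
    (hx : x ∈ Ioo a b) (hz : z ∈ Ioo a b) (hy : y ∈ Ioo a b) (hxz : x < z) (hzy : z < y) :
    min (g x / f x) (g y / f y) ≤ g z / f z := by
  set c := min (g x / f x) (g y / f y) with hc
  have hfx := hf.pos x hx
  have hfy := hf.pos y hy
  have hfz := hf.pos z hz
  rcases le_or_gt c 0 with h0 | h0
  · exact h0.trans (div_nonneg (hg.nonneg z) hfz.le)
  have hgx : c * f x ≤ g x := (le_div_iff₀ hfx).1 (min_le_left _ _)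
  have hgy : c * f y ≤ g y := (le_div_iff₀ hfy).1 (min_le_right _ _)
  have hcx := mul_pos h0 hfx
  have hcy := mul_pos h0 hfy
  have hx' := hg.mem_of_pos (hcx.trans_le hgx)
  have hy' := hg.mem_of_pos (hcy.trans_le hgy)
  have hd : 0 < y - x := by linarith
  set t := (z - x) / (y - x) with ht
  have htm : t ∈ Icc (0 : ℝ) 1 :=
    ⟨div_nonneg (by linarith) hd.le, by rw [ht, div_le_one hd]; linarith⟩
  have hzt : (1 - t) * x + t * y = z := by
    have : t * (y - x) = z - x := div_mul_cancel₀ _ hd.ne'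
    linarith
  have hr := hf.range_lt hx hy
  rw [le_div_iff₀ hfz]
  calc c * f z = rmean K N t |y - x| (c * f x) (c * f y) := by
        rw [rmean_smul hN htm (abs_nonneg _) hr hfx hfy h0, heq x hx y hy t htm, hzt]
    _ ≤ rmean K N t |y - x| (g x) (g y) :=
        rmean_mono hN htm (abs_nonneg _) hr hcx hcy hgx hgy
    _ ≤ g z := hzt ▸ hg.rmean_le x hx' y hy' t htm

theorem mem_extremePoints_of_mem_modelProb (hN : N ≤ 0 ∨ 1 < N)
    (hD : 0 < delta K N → K < 0 → D < ell K N) (hm : Measurable h) {C : ℝ}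
    (hC : ∀ x, |h x| ≤ C) {α β : ℝ} (hI : hullSupport h ⊆ Icc α β) {ξ : Measure ℝ}
    (hξ : ξ ∈ modelProb K N D h) : ξ ∈ extremePoints ℝ≥0 (synthProb K N D h) := by
  obtain ⟨hprob, hmod, hzero, hne⟩ := hξ
  obtain ⟨f, a, b, hf, hfi, rfl, heq⟩ := hmod.exists_isConcaveDensity hN hI
  have hsupp := hf.support_eq
  have hfh := hzero
  rw [integral_densMeasure hf.aemeasurable hf.nonneg] at hfh
  rw [hsupp, interior_Icc] at hne
  have hdiam := hmod.diam_le
  rw [hsupp, Real.ediam_Icc] at hdiam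
  refine ⟨⟨hprob, hf.isSynthetic hN hfi (hsupp ▸ hmod.support_subset) hdiam, hzero⟩, ?_⟩
  rintro ξ₀ ⟨hprob₀, hsyn₀, hzero₀⟩ ξ₁ ⟨hprob₁, hsyn₁, hzero₁⟩ ⟨s, t, hs, ht, hst, hsum⟩
  have hac : ∀ (r : ℝ≥0) (η : Measure ℝ), 0 < r → r • η ≤ densMeasure f → η ≪ densMeasure f := by
    intro r η hr hle S hS
    have h1 : (r • η) S = 0 := le_antisymm ((hle S).trans hS.le) bot_le
    rw [Measure.smul_apply, ENNReal.smul_def, smul_eq_mul, mul_eq_zero] at h1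
    exact h1.resolve_left (ENNReal.coe_pos.2 hr).ne'
  have hac₀ := hac s ξ₀ hs (hsum ▸ Measure.le_add_right le_rfl)
  have hac₁ := hac t ξ₁ ht (hsum ▸ Measure.le_add_left le_rfl)
  have hdens : ∀ η : Measure ℝ, IsProbabilityMeasure η → IsSynthetic K N D (hullSupport h) η →
      η ≪ densMeasure f →
      ∃ g a' b', IsConcaveDensity K N g a' b' ∧ Integrable g ∧ η = densMeasure g := by
    intro η _ hη hηac
    rcases hη.eq_dirac_or_eq_densMeasure hN hD hI with ⟨x, rfl⟩ | hd
    · have h1 : densMeasure f {x} = 0 :=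
        withDensity_absolutelyContinuous _ _ (Real.volume_singleton (a := x))
      simpa using hηac h1
    · exact hd
  obtain ⟨f₀, a₀, b₀, hf₀, hfi₀, rfl⟩ := hdens ξ₀ hprob₀ hsyn₀ hac₀
  obtain ⟨f₁, a₁, b₁, hf₁, hfi₁, rfl⟩ := hdens ξ₁ hprob₁ hsyn₁ hac₁
  have hs' : (0 : ℝ) < s := hs
  have ht' : (0 : ℝ) < t := ht
  have hst' : (s : ℝ) + t = 1 := by exact_mod_cast hst
  have hsumae : (fun x => s * f₀ x + t * f₁ x) =ᵐ[volume] f := by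
    have hi : Integrable fun x => s * f₀ x + t * f₁ x :=
      (hfi₀.const_mul _).add (hfi₁.const_mul _)
    rw [← densMeasure_eq_iff hi hf.aemeasurable
      (fun x => add_nonneg (mul_nonneg hs'.le (hf₀.nonneg x)) (mul_nonneg ht'.le (hf₁.nonneg x)))
      hf.nonneg, densMeasure_add (hf₀.aemeasurable.const_mul _) (hf₀.smul hN hs').nonneg
      (hf₁.smul hN ht').nonneg, densMeasure_smul hs'.le, densMeasure_smul ht'.le,
      Real.toNNReal_coe, Real.toNNReal_coe, hsum]
  -- the full subset of the interval on which the decomposition of `f` holds pointwise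
  set Z : Set ℝ := {x | x ∈ Ioo a b ∧ s * f₀ x + t * f₁ x = f x} with hZ
  have hZae : ∀ᵐ x, x ∈ Ioo a b → x ∈ Z := by
    filter_upwards [hsumae] with x hx hxI using ⟨hxI, hx⟩
  have hratio : ∀ x ∈ Z, s * (f₀ x / f x) + t * (f₁ x / f x) = 1 := fun x hx => by
    have := hf.pos x hx.1
    rw [← mul_div_assoc, ← mul_div_assoc, ← add_div, hx.2, div_self this.ne']
  have hbound : ∀ (r r' : ℝ) (φ ψ : ℝ → ℝ), 0 < r → 0 < r' → (∀ x, 0 ≤ ψ x) →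
      (∀ x ∈ Z, r * (φ x / f x) + r' * (ψ x / f x) = 1) → ∀ x ∈ Z, φ x / f x ≤ r⁻¹ := by
    intro r r' φ ψ hr hr' hψ hsum x hx
    have h1 := mul_nonneg hr'.le (div_nonneg (hψ x) (hf.nonneg x))
    have h2 := hsum x hx
    rw [← mul_one r⁻¹, le_inv_mul_iff₀ hr]
    linarith
  have hout : ∀ᵐ x, x ∉ Ioo a b → f₀ x = 0 ∧ f₁ x = 0 := by
    filter_upwards [hsumae] with x hx hxI
    rw [hf.eq_zero x hxI] at hx
    have h1 := mul_nonneg hs'.le (hf₀.nonneg x)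
    have h2 := mul_nonneg ht'.le (hf₁.nonneg x)
    exact ⟨(mul_eq_zero.1 (by linarith : (s : ℝ) * f₀ x = 0)).resolve_left hs'.ne',
      (mul_eq_zero.1 (by linarith : (t : ℝ) * f₁ x = 0)).resolve_left ht'.ne'⟩
  rw [integral_densMeasure hf₀.aemeasurable hf₀.nonneg] at hzero₀
  rw [integral_densMeasure hf₁.aemeasurable hf₁.nonneg] at hzero₁
  have hne' : ∀ x ∈ Ioo a b, ∫ y in Iic x, f y * h y ≠ 0 := fun x hx => by
    rw [← setIntegral_densMeasure hf.aemeasurable hf.nonneg h measurableSet_Iic]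
    exact hne x hx
  have hone := integral_eq_one hfi hf.nonneg
  have hZsub : Z ⊆ Ioo a b := fun x hx => hx.1
  have hfhi := integrable_mul_of_bounded hfi hm hC
  refine densMeasure_congr ?_
  rcases monotoneOn_or_monotoneOn_of_quasi hs' ht' hratio
    (fun x hx z hz y hy => min_div_le_div hN hf hf₀ heq hx.1 hz.1 hy.1)
    (fun x hx z hz y hy => min_div_le_div hN hf hf₁ heq hx.1 hz.1 hy.1) with hmono | hmono
  · exact ae_eq_of_monotoneOn_ratio hZsub hZae hf.pos hf.eq_zero
      (hout.mono fun x hx hxI => (hx hxI).1) hf₀.nonneg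
      (hbound s t f₀ f₁ hs' ht' hf₁.nonneg hratio) hmono hf.lt hfhi hfh hzero₀ hne' hone
      (integral_eq_one hfi₀ hf₀.nonneg)
  · have h1 := ae_eq_of_monotoneOn_ratio hZsub hZae hf.pos hf.eq_zero
      (hout.mono fun x hx hxI => (hx hxI).2) hf₁.nonneg
      (hbound t s f₁ f₀ ht' hs' hf₀.nonneg fun x hx => by rw [add_comm]; exact hratio x hx)
      hmono hf.lt hfhi hfh hzero₁ hne' hone (integral_eq_one hfi₁ hf₁.nonneg)
    filter_upwards [h1, hsumae] with x h2 h3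
    rw [h2] at h3
    have h4 : (s : ℝ) * (f₀ x - f x) = 0 := by
      have : (t : ℝ) = 1 - s := by linarith
      rw [this] at h3
      linarith
    exact sub_eq_zero.1 ((mul_eq_zero.1 h4).resolve_left hs'.ne')

/-! ### Dirac masses and the constraint function -/

lemma eq_dirac_of_compl_singleton {ξ : Measure ℝ} [IsProbabilityMeasure ξ] {x : ℝ}
    (h : ξ {x}ᶜ = 0) : ξ = Measure.dirac x := by
  refine Measure.ext fun s hs => ?_
  rw [Measure.dirac_apply' x hs]
  by_cases hx : x ∈ s
  · rw [indicator_of_mem hx, Pi.one_apply, ← prob_compl_eq_zero_iff hs]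
    exact measure_mono_null (compl_subset_compl.2 (singleton_subset_iff.2 hx)) h
  · rw [indicator_of_notMem hx]
    exact measure_mono_null (subset_compl_singleton_iff.2 hx) h

lemma mem_extremePoints_of_mem_diracProb {ξ : Measure ℝ} (hξ : ξ ∈ diracProb K N D h) :
    ξ ∈ extremePoints ℝ≥0 (synthProb K N D h) := by
  obtain ⟨hmem, x, -, rfl⟩ := hξ
  refine ⟨hmem, ?_⟩
  rintro ξ₀ ⟨hprob, -, -⟩ ξ₁ - ⟨s, t, hs, -, -, hsum⟩
  refine eq_dirac_of_compl_singleton ?_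
  have h1 : (s • ξ₀ + t • ξ₁) {x}ᶜ = 0 := by
    rw [hsum, Measure.dirac_apply' x (measurableSet_singleton x).compl]
    simp
  rw [Measure.add_apply, add_eq_zero, Measure.smul_apply, ENNReal.smul_def, smul_eq_mul,
    mul_eq_zero] at h1
  exact h1.1.resolve_left (ENNReal.coe_pos.2 hs).ne'

lemma isCompact_hullSupport (hs : HasCompactSupport h) : IsCompact (hullSupport h) := by
  unfold hullSupport
  rcases eq_empty_or_nonempty (tsupport h) with he | hne
  · rw [he, convexHull_empty]; exact isCompact_empty
  have h1 := subset_convexHull ℝ (tsupport h)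
  have : convexHull ℝ (tsupport h) = Icc (sInf (tsupport h)) (sSup (tsupport h)) :=
    Subset.antisymm
      (convexHull_min (fun x hx => ⟨csInf_le hs.isCompact.bddBelow hx,
        le_csSup hs.isCompact.bddAbove hx⟩) (convex_Icc _ _))
      ((convex_convexHull ℝ _).ordConnected.out (h1 (hs.isCompact.sInf_mem hne))
        (h1 (hs.isCompact.sSup_mem hne)))
  rw [this]
  exact isCompact_Icc

lemma eq_zero_of_notMem_hullSupport {x : ℝ} (hx : x ∉ hullSupport h) : h x = 0 := by
  by_contra hc
  exact hx (subset_convexHull ℝ _ (subset_tsupport h hc))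

lemma measurable_of_continuousOn_hullSupport (hs : HasCompactSupport h)
    (hc : ContinuousOn h (hullSupport h)) : Measurable h := by
  classical
  have h1 : (hullSupport h).piecewise h (fun _ => 0) = h := by
    funext x
    by_cases hx : x ∈ hullSupport h
    · rw [piecewise_eq_of_mem _ _ _ hx]
    · rw [piecewise_eq_of_notMem _ _ _ hx, eq_zero_of_notMem_hullSupport hx]
  rw [← h1]
  exact hc.measurable_piecewise continuousOn_const (isCompact_hullSupport hs).measurableSet

lemma exists_bound_of_continuousOn_hullSupport (hs : HasCompactSupport h)
    (hc : ContinuousOn h (hullSupport h)) : ∃ C, ∀ x, |h x| ≤ C := by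
  obtain ⟨C, hC⟩ := (isCompact_hullSupport hs).exists_bound_of_continuousOn hc
  refine ⟨max C 0, fun x => ?_⟩
  by_cases hx : x ∈ hullSupport h
  · exact (hC x hx).trans (le_max_left _ _)
  · rw [eq_zero_of_notMem_hullSupport hx, abs_zero]
    exact le_max_right _ _

end

end SyntheticCDD

theorem mainTheorem2 (h : ℝ → ℝ) (h_supp : HasCompactSupport h)
    (h_cont : ContinuousOn h (SyntheticCDD.hullSupport h))
    (K : ℝ) (N : WithTop ℝ) (hN : N ≤ 0 ∨ 1 < N) (D : ℝ≥0∞) (hD : 0 < D)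
    (h_proviso : 0 < SyntheticCDD.delta K N → K < 0 → D < SyntheticCDD.ell K N) :
    ((N ≤ 0 ∨ 2 ≤ N) →
      Set.extremePoints ℝ≥0 (SyntheticCDD.synthProb K N D h) ⊆
        SyntheticCDD.modelProb K N D h ∪ SyntheticCDD.diracProb K N D h) ∧
    SyntheticCDD.modelProb K N D h ∪ SyntheticCDD.diracProb K N D h ⊆
      Set.extremePoints ℝ≥0 (SyntheticCDD.synthProb K N D h) := by
  have h_meas := SyntheticCDD.measurable_of_continuousOn_hullSupport h_supp h_cont
  obtain ⟨C, hC⟩ := SyntheticCDD.exists_bound_of_continuousOn_hullSupport h_supp h_cont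
  obtain ⟨α, β, hI⟩ : ∃ α β, SyntheticCDD.hullSupport h ⊆ Icc α β := by
    have hcpt := SyntheticCDD.isCompact_hullSupport h_supp
    exact ⟨_, _, fun x hx => ⟨csInf_le hcpt.bddBelow hx, le_csSup hcpt.bddAbove hx⟩⟩
  refine ⟨fun hN' ξ hξ => ?_, union_subset (fun ξ hξ => ?_) fun ξ hξ => ?_⟩
  · have hprob := hξ.1.1
    rcases hξ.1.2.1.eq_dirac_or_eq_densMeasure hN h_proviso hI with
      ⟨x, rfl⟩ | ⟨f, a, b, hf, hfi, rfl⟩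
    · have hx : x ∈ (Measure.dirac x).support := by
        rw [Measure.mem_support_iff_forall]
        intro U hU
        rw [Measure.dirac_apply_of_mem (mem_of_mem_nhds hU)]
        exact one_pos
      exact Or.inr ⟨hξ.1, x, hξ.1.2.1.support_subset hx, rfl⟩
    · exact Or.inl (SyntheticCDD.mem_modelProb_of_mem_extremePoints hN' h_meas hC hξ hf hfi)
  · exact SyntheticCDD.mem_extremePoints_of_mem_modelProb hN h_proviso h_meas hC hI hξ
  · exact SyntheticCDD.mem_extremePoints_of_mem_diracProb hξ
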